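/- Let $n\ge 2$, let $2<p_1<\dots<p_n$ be integers, let $\lambda_1,\dots,\lambda_n\ge 0$ with $\sum_i\lambda_i=1$, and put $\xi(x)=\sum_{i=1}^n\lambda_i x^{p_i}$. Let $\mathcal K$ be the set of measures $\nu(dx)=\mathbf 1_{[0,1)}(x)\gamma(x)\,dx+\Delta\,\delta_1(dx)$ on $[0,1]$ with $\gamma$ nonnegative, right-continuous and nondecreasing on $[0,1)$ and $\Delta>0$, and let the Parisi measure at zero temperature $\nu_P$ be the minimizer over $\mathcal K$ of $$\mathcal Q(\nu)=\tfrac12\Big(\int_0^1\xi'(x)\,\nu(dx)+\int_0^1\frac{dx}{\nu((x,1])}\Big).$$ It is called $n$-RSB if $\nu_P(dx)=\sum_{i=1}^n m_i\mathbf 1_{[q_{i-1},q_i)}(x)\,dx+\Delta\,\delta_1(dx)$ for some $0=q_0<q_1<\dots<q_n=1$, $0<m_1<\dots<m_n$ and $\Delta>0$. Put $$h(x,y,z)=\xi(y)-\xi(x)-\xi'(x)(y-x)+[\xi'(y)-\xi'(x)](y-x)\Big(\frac1{z-1}-\frac{z\log z}{(z-1)^2}\Big)$$ (the last bracket being $-\tfrac12$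 at $z=1$), $$r_1(x,y,z)=\frac{[\xi'(z)-\xi'(y)](z-x)}{(z-y)[\xi'(z)-\xi'(x)]},\qquad r_2(x,y)=\frac{\xi''(y)(y-x)}{\xi'(y)-\xi'(x)}.$$ For $0=q_0<q_1<\dots<q_n=1$ put $\mathbf r_l=r_1(q_{l-1},q_{l+1},q_l)$ and $$\mathcal F_l^n=r_2\big(q_{l-(-1)^{n-l}},q_l\big)\prod_{i=1}^{\lfloor (n-l)/2\rfloor}\Big(\frac{\mathbf r_{n+1-2i}}{\mathbf r_{n-2i}}\Big)^{(-1)^{n-l}}\quad(0\le l\le n),$$ $$\mathcal A_l^n=r_1\big(q_l,q_{l-(-1)^{n-l}},q_{l+(-1)^{n-l}}\big)\prod_{i=1}^{\lfloor (n-l)/2\rfloor}\Big(\frac{\mathbf r_{n-2i}}{\mathbf r_{n+1-2i}}\Big)^{(-1)^{n-l}}\quad(1\le l\le n-1),$$ where $\mathcal F_0^n=0$ (as $\xi''(0)=0$), also when $n$ is even. Let $\mathcal Z^n$ be the maximum of all $\mathcal F_l^n$ with $n-l$ odd and all $\mathcal A_l^n$ with $n-l$ even, let $\mathcal Y^n$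 be the maximum of all $\mathcal F_l^n$ with $n-l$ even and all $\mathcal A_l^n$ with $n-l$ odd, and for $1\le l\le n$ let $$h_l^n(\bar q,w)=h\Big(q_{l-1},q_l,\;w^{(-1)^{n-l}}\,\frac{r_2(q_{l-1},q_l)}{\mathcal F_l^n}\Big).$$ Then $\nu_P$ is $n$-RSB if and only if there exist a unique sequence $0=q_0<q_1<\dots<q_{n-1}<q_n=1$ and a unique $z_n>0$ (that is, a unique pair $((q_1,\dots,q_{n-1}),z_n)$) such that 1. $h_l^n(\bar q,1+z_n)=0$ for $l=1,\dots,n$; 2. $\mathcal Y^n\le 1+z_n\le(\mathcal Z^n)^{-1}$, where moreover the bounds coming from the $\mathcal A$-terms are strict: $\mathcal A_l^n<1+z_n$ for $n-l$ odd and $1+z_n<(\mathcal A_l^n)^{-1}$ for $n-l$ even, $1\le l\le n-1$. -/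

import Mathlib

open scoped ENNReal

namespace SphericalSpinGlass

noncomputable section

/-- The covariance function `ξ(x) = ∑ᵢ λᵢ x ^ pᵢ` of the spherical mixed `p`-spin model. -/
def mixture {n : ℕ} (p : Fin n → ℕ) (lam : Fin n → ℝ) (x : ℝ) : ℝ :=
  ∑ i, lam i * x ^ p i

/-! ### The Parisi measure at zero temperature -/

/-- The measure `1_{[0,1)}(x) γ(x) dx + Δ δ₁(dx)`, viewed as a measure on `ℝ`. -/
def densityAndAtom (γ : ℝ → ℝ) (Δ : ℝ) : MeasureTheory.Measure ℝ :=
  (MeasureTheory.volume.restrict (Set.Ico (0 : ℝ) 1)).withDensity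
      (fun x => ENNReal.ofReal (γ x))
    + ENNReal.ofReal Δ • MeasureTheory.Measure.dirac 1

/-- The class `𝒦` of measures `1_{[0,1)} γ dx + Δ δ₁` with `γ` nonnegative, nondecreasing and
right-continuous on `[0,1)` and `Δ > 0`. -/
def classK : Set (MeasureTheory.Measure ℝ) :=
  {ν | ∃ (γ : ℝ → ℝ) (Δ : ℝ),
    (∀ x ∈ Set.Ico (0 : ℝ) 1, 0 ≤ γ x) ∧
    MonotoneOn γ (Set.Ico (0 : ℝ) 1) ∧
    (∀ x ∈ Set.Ico (0 : ℝ) 1, ContinuousWithinAt γ (Set.Ici x) x) ∧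
    0 < Δ ∧ ν = densityAndAtom γ Δ}

/-- The Crisanti–Sommers functional
`𝒬(ν) = (1/2) (∫₀¹ ξ'(x) ν(dx) + ∫₀¹ dx / ν((x,1]))`, with values in `[0,∞]`
(both integrands are nonnegative for the functions `ξ` considered here). -/
def crisantiSommers (ξ : ℝ → ℝ) (ν : MeasureTheory.Measure ℝ) : ℝ≥0∞ :=
  (1 / 2) * ((∫⁻ x in Set.Icc (0 : ℝ) 1, ENNReal.ofReal (deriv ξ x) ∂ν)
    + ∫⁻ x in Set.Ico (0 : ℝ) 1, (ν (Set.Ioc x 1))⁻¹)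

/-- `ν` is the Parisi measure at zero temperature: it minimizes `𝒬` over `𝒦`. -/
def IsParisiMeasure (ξ : ℝ → ℝ) (ν : MeasureTheory.Measure ℝ) : Prop :=
  ν ∈ classK ∧ ∀ ν' ∈ classK, crisantiSommers ξ ν ≤ crisantiSommers ξ ν'

/-- `k`-step replica symmetry breaking, for `k ≥ 1`:
`ν(dx) = ∑_{i=1}^k m_i 1_{[q_{i-1}, q_i)}(x) dx + Δ δ₁(dx)` with `0 = q_0 < q_1 < ⋯ < q_k = 1`,
`0 < m_1 < m_2 < ⋯ < m_k` and `Δ > 0`. The strict inequalities say that there are exactly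
`k + 1` atoms: `q_0, …, q_{k-1}` of the measure with distribution function `γ`, and `q_k = 1`. -/
def IsRSB (k : ℕ) (ν : MeasureTheory.Measure ℝ) : Prop :=
  ∃ (m : Fin k → ℝ) (q : Fin (k + 1) → ℝ) (Δ : ℝ),
    (∀ i, 0 < m i) ∧ StrictMono m ∧
    StrictMono q ∧ q 0 = 0 ∧ q (Fin.last k) = 1 ∧ 0 < Δ ∧
    ν = densityAndAtom
      (fun x => ∑ i : Fin k,
        (Set.Ico (q i.castSucc) (q i.succ)).indicator (fun _ => m i) x) Δ

/-! ### The auxiliary functions -/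

/-- `1/(z-1) - z log z/(z-1)²`, extended by continuity at `z = 1`. -/
def logKernel (z : ℝ) : ℝ :=
  if z = 1 then -1 / 2 else 1 / (z - 1) - z / (z - 1) ^ 2 * Real.log z

/-- `h(x,y,z) = ξ(y) - ξ(x) - ξ'(x)(y-x)
+ (ξ'(y) - ξ'(x)) (y-x) (1/(z-1) - z log z/(z-1)²)`. -/
def h (ξ : ℝ → ℝ) (x y z : ℝ) : ℝ :=
  ξ y - ξ x - deriv ξ x * (y - x)
    + (deriv ξ y - deriv ξ x) * (y - x) * logKernel z

/-- `r₁(x,y,z) = (ξ'(z)-ξ'(y))(z-x) / ((z-y)(ξ'(z)-ξ'(x)))`. -/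
def r₁ (ξ : ℝ → ℝ) (x y z : ℝ) : ℝ :=
  ((deriv ξ z - deriv ξ y) * (z - x)) / ((z - y) * (deriv ξ z - deriv ξ x))

/-- `r₂(x,y) = ξ''(y)(y-x) / (ξ'(y)-ξ'(x))`. -/
def r₂ (ξ : ℝ → ℝ) (x y : ℝ) : ℝ :=
  (deriv (deriv ξ) y * (y - x)) / (deriv ξ y - deriv ξ x)

/-- `𝐫_l(x) = r₁(x_{l-1}, x_{l+1}, x_l)`, for `l ≥ 1`. -/
def rBold (ξ : ℝ → ℝ) (x : ℕ → ℝ) (l : ℕ) : ℝ :=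
  r₁ ξ (x (l - 1)) (x (l + 1)) (x l)

/-- `𝓕_l^s(x) = r₂(x_{l-(-1)^{s-l}}, x_l) ∏_{i=1}^{⌊(s-l)/2⌋} (𝐫_{s+1-2i}/𝐫_{s-2i})^{(-1)^{s-l}}`,
for `0 ≤ l ≤ s`. When `l = 0` and `s` is even, `x_{-1}` does not exist; since `x_0 = 0` and
`ξ''(0) = 0`, the value is `0`, and this is what the formula below gives. -/
def calF (ξ : ℝ → ℝ) (s : ℕ) (x : ℕ → ℝ) (l : ℕ) : ℝ :=
  if Even (s - l) then
    r₂ ξ (x (l - 1)) (x l) *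
      ∏ i ∈ Finset.Icc 1 ((s - l) / 2), rBold ξ x (s + 1 - 2 * i) / rBold ξ x (s - 2 * i)
  else
    r₂ ξ (x (l + 1)) (x l) *
      ∏ i ∈ Finset.Icc 1 ((s - l) / 2), rBold ξ x (s - 2 * i) / rBold ξ x (s + 1 - 2 * i)

/-- `𝓐_l^s(x) = r₁(x_l, x_{l-(-1)^{s-l}}, x_{l+(-1)^{s-l}})
∏_{i=1}^{⌊(s-l)/2⌋} (𝐫_{s-2i}/𝐫_{s+1-2i})^{(-1)^{s-l}}`, for `1 ≤ l ≤ s - 1`. -/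
def calA (ξ : ℝ → ℝ) (s : ℕ) (x : ℕ → ℝ) (l : ℕ) : ℝ :=
  if Even (s - l) then
    r₁ ξ (x l) (x (l - 1)) (x (l + 1)) *
      ∏ i ∈ Finset.Icc 1 ((s - l) / 2), rBold ξ x (s - 2 * i) / rBold ξ x (s + 1 - 2 * i)
  else
    r₁ ξ (x l) (x (l + 1)) (x (l - 1)) *
      ∏ i ∈ Finset.Icc 1 ((s - l) / 2), rBold ξ x (s + 1 - 2 * i) / rBold ξ x (s - 2 * i)

/-- `𝓩^s(x)`: the maximum of the `𝓕_l^s(x)` with `0 ≤ l ≤ s`, `s - l` odd, and of the `𝓐_l^s(x)`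
with `1 ≤ l ≤ s - 1`, `s - l` even (the set is finite, and nonempty for `s ≥ 1`). -/
def calZ (ξ : ℝ → ℝ) (s : ℕ) (x : ℕ → ℝ) : ℝ :=
  sSup ({v | ∃ l, l ≤ s ∧ Odd (s - l) ∧ v = calF ξ s x l} ∪
    {v | ∃ l, 1 ≤ l ∧ l < s ∧ Even (s - l) ∧ v = calA ξ s x l})

/-- `𝓨^s(x)`: the maximum of the `𝓕_l^s(x)` with `0 ≤ l ≤ s`, `s - l` even, and of the `𝓐_l^s(x)`
with `1 ≤ l ≤ s - 1`, `s - l` odd (the set is finite and nonempty). -/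
def calY (ξ : ℝ → ℝ) (s : ℕ) (x : ℕ → ℝ) : ℝ :=
  sSup ({v | ∃ l, l ≤ s ∧ Even (s - l) ∧ v = calF ξ s x l} ∪
    {v | ∃ l, 1 ≤ l ∧ l < s ∧ Odd (s - l) ∧ v = calA ξ s x l})

/-- `h_l^k(x, w) = h(x_{l-1}, x_l, w^{(-1)^{k-l}} (𝓕_l^k(x))⁻¹ r₂(x_{l-1}, x_l))`,
for `1 ≤ l ≤ k`. -/
def hStep (ξ : ℝ → ℝ) (k : ℕ) (x : ℕ → ℝ) (l : ℕ) (w : ℝ) : ℝ :=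
  h ξ (x (l - 1)) (x l)
    (w ^ ((-1 : ℤ) ^ (k - l)) * (calF ξ k x l)⁻¹ * r₂ ξ (x (l - 1)) (x l))

/-- The finite sequence `(q_0, …, q_n)` as a function on `ℕ`; only the entries with index at most
`n` matter. -/
def toSeq {n : ℕ} (q : Fin (n + 1) → ℝ) (i : ℕ) : ℝ :=
  if hi : i < n + 1 then q ⟨i, hi⟩ else 0

end

end SphericalSpinGlass

/-! Write `α(x) = ν((x,1])`. For `n`-step data, `α` is continuous and positive on `[0,1]`, and
affine with slope `-m_l` on each piece. Put `g = ξ' - ∫₀ dx/α²`. The theorem compares three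
descriptions of such data: minimality for `𝒬`, stationarity (`g` vanishes at every `q_l`, has
integral zero over every piece, and `g' = ξ'' - 1/α² ≤ 0` at every `q_l`), and the explicit system
in `(q, z)`.

Minimal implies stationary (`IsStepData.isStationary`): the atom at `1` may be varied both ways, the
density may be raised on any `[u,1)`, and it may be lowered on `[q_l,1)` because it jumps there.
Hence `G(u) = ∫_u^1 g` is nonnegative and vanishes at the atoms, and the conditions on `g` and `g'`
follow.

Stationary implies minimal (`IsStationary.isParisiMeasure`): if `G ≥ 0`, the tangent-line inequality
`1/b ≥ 2/α - b/α²` yields a dual bound `2𝒬(ν) ≥ ∫ 2/α`, which the data attain; equality forces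
`ν((x,1]) = α(x)` almost everywhere, so the minimizer is unique too. The hard point is `G ≥ 0`
(`overlap_nonneg`), the only place where the number of monomials is compared with the number of
steps. With `f = ξ''`, stationarity makes `f^(-1/2)` dip below the line `α` on each of the `n`
pieces, and a negative value of `G` would give an `(n+1)`-st dip. Successive dips force sign changes
of the second derivative of `f^(-1/2)`, that is, of `3 f'² - 2 f f''`. A Descartes-type bound
(`alternates_le_gapCount`) shows that a polynomial with nonnegative coefficients and at most `n`
monomials admits at most `n` dips.

Stationary data and solutions correspond (`IsTailSeq.isSolution_iff`,
`IsSolution.exists_stationary`): in terms of `a_l = α(q_l)` the products defining `𝓕` and `𝓐`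
telescope. With `w = 1 + z_n = a_{n-1}/a_n`, the equations say that `g` has mean zero on the pieces,
the `𝓕`-bounds are the stability conditions, and the strict `𝓐`-bounds are `m_l < m_{l+1}`. Each
solution therefore produces the minimizer, and uniqueness of the minimizer gives uniqueness of the
solution. -/

namespace SphericalSpinGlass

/-! ### Sign alternations and Rolle's theorem -/

/-- `g` takes values of alternating sign, the first one of the sign of `ε`, at `N` increasing
points to the right of `b`. -/
def Alternates (g : ℝ → ℝ) : ℕ → ℝ → ℝ → Prop
  | 0, _, _ => True
  | N + 1, ε, b => ∃ x, b < x ∧ 0 < ε * g x ∧ Alternates g N (-ε) x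

lemma Alternates.mono_left {g : ℝ → ℝ} {N : ℕ} {ε b c : ℝ} (hbc : b ≤ c)
    (h : Alternates g N ε c) : Alternates g N ε b := by
  cases N with
  | zero => trivial
  | succ N =>
    obtain ⟨x, hx, h1, h2⟩ := h
    exact ⟨x, hbc.trans_lt hx, h1, h2⟩

lemma Alternates.congr_sign {g k : ℝ → ℝ} {N : ℕ} {ε b : ℝ} (hb : 0 ≤ b)
    (hgk : ∀ x, 0 < x → ∀ η : ℝ, 0 < η * g x → 0 < η * k x)
    (h : Alternates g N ε b) : Alternates k N ε b := by
  induction N generalizing ε b with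
  | zero => trivial
  | succ N ih =>
    obtain ⟨x, hx, h1, h2⟩ := h
    exact ⟨x, hx, hgk x (hb.trans_lt hx) ε h1, ih (hb.trans hx.le) h2⟩

/-- Rolle's theorem for alternations. -/
lemma Alternates.of_deriv {E E' k : ℝ → ℝ} {N : ℕ} {ε b : ℝ} (hb : 0 ≤ b)
    (hd : ∀ x, 0 < x → HasDerivAt E (E' x) x)
    (hk : ∀ x, 0 < x → ∀ η : ℝ, 0 < η * E' x → 0 < η * k x)
    (hc : ContinuousOn E (Set.Ici b)) (hEb : ε * E b ≤ 0)
    (h : Alternates E N ε b) : Alternates k N ε b := by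
  induction N generalizing ε b with
  | zero => trivial
  | succ N ih =>
    obtain ⟨y, hy, h1, h2⟩ := h
    have hy0 : 0 < y := hb.trans_lt hy
    obtain ⟨c, hc1, hc2⟩ := exists_hasDerivAt_eq_slope E E' hy
      (hc.mono Set.Icc_subset_Ici_self) (fun x hx => hd x (hb.trans_lt hx.1))
    have hc0 : 0 < c := hb.trans_lt hc1.1
    refine ⟨c, hc1.1, hk c hc0 ε ?_, Alternates.mono_left hc1.2.le
      (ih hy0.le (hc.mono (Set.Ici_subset_Ici.2 hy.le)) (by linarith) h2)⟩
    rw [hc2, ← mul_div_assoc]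
    exact div_pos (by linarith) (sub_pos.2 hy)

/-! ### A Descartes-type bound for `(p + 1) f'² - p f f''` -/

open Polynomial

lemma eval_nonneg_of_coeff_nonneg {f : ℝ[X]} (hf : ∀ k, 0 ≤ f.coeff k) {x : ℝ} (hx : 0 ≤ x) :
    0 ≤ f.eval x := by
  rw [eval_eq_sum_range]
  exact Finset.sum_nonneg fun i _ => mul_nonneg (hf i) (pow_nonneg hx i)

lemma eval_pos_of_coeff_nonneg {f : ℝ[X]} (hf : ∀ k, 0 ≤ f.coeff k) (h0 : f ≠ 0) {x : ℝ}
    (hx : 0 < x) : 0 < f.eval x := by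
  rw [eval_eq_sum_range]
  refine Finset.sum_pos' (fun i _ => mul_nonneg (hf i) (pow_nonneg hx.le i))
    ⟨f.natDegree, by simp, mul_pos (lt_of_le_of_ne (hf _) ?_) (pow_pos hx _)⟩
  exact (leadingCoeff_ne_zero.2 h0).symm

lemma coeff_derivative_nonneg {f : ℝ[X]} (hf : ∀ k, 0 ≤ f.coeff k) (k : ℕ) :
    0 ≤ (derivative f).coeff k := by
  rw [coeff_derivative]
  exact mul_nonneg (hf _) (by positivity)

/-- The number of `j ≤ deg f - 2` for which `f` has a monomial of degree `j` or `j + 1`. -/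
noncomputable def gapCount (f : ℝ[X]) : ℕ :=
  ∑ j ∈ Finset.range (f.natDegree - 1), if f.coeff j ≠ 0 ∨ f.coeff (j + 1) ≠ 0 then 1 else 0

lemma gapCount_derivative (f : ℝ[X]) (hd : 2 ≤ f.natDegree) :
    gapCount f = gapCount (derivative f) + if f.coeff 0 ≠ 0 ∨ f.coeff 1 ≠ 0 then 1 else 0 := by
  unfold gapCount
  rw [natDegree_derivative]
  obtain ⟨d, hd'⟩ : ∃ d, f.natDegree = d + 2 := ⟨f.natDegree - 2, by omega⟩
  rw [hd', show d + 2 - 1 = d + 1 by omega, Finset.sum_range_succ']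
  congr 1
  refine Finset.sum_congr (by simp) fun j _ => ?_
  have h1 : ((j : ℝ) + 1) ≠ 0 := by positivity
  have h2 : ((j : ℝ) + 1 + 1) ≠ 0 := by positivity
  simp [coeff_derivative, h1, h2]

/-- A nonzero coefficient is responsible for at most two counted indices, its own degree and the one
before, and the leading coefficient for none. -/
lemma gapCount_le (f : ℝ[X]) (hf : f ≠ 0) : gapCount f + 2 ≤ 2 * f.support.card := by
  have hs : f.support.card = (∑ j ∈ Finset.range f.natDegree, if f.coeff j ≠ 0 then 1 else 0) + 1 := by
    have h1 : f.support = (Finset.range (f.natDegree + 1)).filter fun j => f.coeff j ≠ 0 := by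
      ext j
      simp only [mem_support_iff, Finset.mem_filter, Finset.mem_range]
      exact ⟨fun h => ⟨Nat.lt_succ_of_le (le_natDegree_of_ne_zero h), h⟩, fun h => h.2⟩
    have h2 : f.coeff f.natDegree ≠ 0 := leadingCoeff_ne_zero.2 hf
    rw [h1, Finset.card_filter, Finset.sum_range_succ, if_pos h2]
  set φ : ℕ → ℕ := fun j => if f.coeff j ≠ 0 then 1 else 0 with hφ
  have h1 : gapCount f ≤ ∑ j ∈ Finset.range (f.natDegree - 1), (φ j + φ (j + 1)) := by
    refine Finset.sum_le_sum fun j _ => ?_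
    simp only [hφ]
    split_ifs <;> simp_all
  rw [Finset.sum_add_distrib] at h1
  have h2 : ∑ j ∈ Finset.range (f.natDegree - 1), φ j ≤ ∑ j ∈ Finset.range f.natDegree, φ j :=
    Finset.sum_le_sum_of_subset (Finset.range_subset_range.2 (Nat.sub_le _ _))
  have h3 : ∑ j ∈ Finset.range (f.natDegree - 1), φ (j + 1) ≤ ∑ j ∈ Finset.range f.natDegree, φ j := by
    rcases Nat.eq_zero_or_pos f.natDegree with h | h
    · simp [h]
    · obtain ⟨d, hd⟩ : ∃ d, f.natDegree = d + 1 := ⟨f.natDegree - 1, by omega⟩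
      rw [hd, Finset.sum_range_succ']
      simp
  change f.support.card = ∑ j ∈ Finset.range f.natDegree, φ j + 1 at hs
  omega

/-- For a polynomial `f` with nonnegative coefficients, the number of alternations on `(0, ∞)` of
`(p + 1) f'² - p f f''`, whose sign is that of the second derivative of `f ^ (-1/p)`. -/
lemma alternates_le_gapCount (f : ℝ[X]) (hf : ∀ k, 0 ≤ f.coeff k) (p : ℝ) (hp : 0 < p) (N : ℕ)
    (ε : ℝ)
    (h : Alternates (fun x => (p + 1) * ((derivative f).eval x) ^ 2
      - p * f.eval x * (derivative (derivative f)).eval x) N ε 0) : N ≤ 1 + gapCount f := by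
  induction hd : f.natDegree generalizing f p N ε with
  | zero =>
    have h1 : derivative f = 0 := derivative_of_natDegree_zero hd
    simp only [h1] at h
    cases N with
    | zero => simp
    | succ N => obtain ⟨x, -, hx, -⟩ := h; simp at hx
  | succ d ih =>
  rcases Nat.lt_or_ge d 1 with hd1 | hd1
  · have h1 : derivative (derivative f) = 0 :=
      derivative_of_natDegree_zero (by rw [natDegree_derivative]; omega)
    simp only [h1] at h
    match N, h with
    | 0, _ => simp
    | 1, _ => simp
    | N + 2, h =>
      obtain ⟨x, -, hx, y, -, hy, -⟩ := h
      simp only [eval_zero, mul_zero, sub_zero] at hx hy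
      nlinarith [pos_of_mul_pos_left hx (by positivity), pos_of_mul_pos_left hy (by positivity)]
  set f1 := derivative f with hf1
  set f2 := derivative f1 with hf2
  set f3 := derivative f2 with hf3
  have hc1 : ∀ k, 0 ≤ f1.coeff k := coeff_derivative_nonneg hf
  have hc2 : ∀ k, 0 ≤ f2.coeff k := coeff_derivative_nonneg hc1
  have hdeg1 : f1.natDegree = d := by rw [hf1, natDegree_derivative]; omega
  have hn1 : f1 ≠ 0 := by
    intro h0; rw [h0] at hdeg1; simp at hdeg1; omega
  have hn2 : f2 ≠ 0 := by
    intro h0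
    have := derivative_eq_zero.1 (hf2 ▸ h0)
    omega
  have hp1 : ∀ x, 0 < x → 0 < f1.eval x := fun x hx => eval_pos_of_coeff_nonneg hc1 hn1 hx
  have hp2 : ∀ x, 0 < x → 0 < f2.eval x := fun x hx => eval_pos_of_coeff_nonneg hc2 hn2 hx
  -- Division by `f'' > 0` keeps the sign and makes the induction close: up to a positive factor,
  -- the derivative of `E` is the same expression for `f'` and `p + 1`.
  set E : ℝ → ℝ := fun x => (p + 1) * (f1.eval x) ^ 2 / f2.eval x - p * f.eval x with hE
  set E1 : ℝ → ℝ := fun x => (p + 1 + 1) * (f2.eval x) ^ 2 - (p + 1) * f1.eval x * f3.eval x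
    with hE1
  have hEd : ∀ x, 0 < x → HasDerivAt E (f1.eval x / (f2.eval x) ^ 2 * E1 x) x := by
    intro x hx
    have h2 := (hp2 x hx).ne'
    have := ((((f1.hasDerivAt x).pow 2).const_mul (p + 1)).div (f2.hasDerivAt x) h2).sub
      ((f.hasDerivAt x).const_mul p)
    refine this.congr_deriv ?_
    simp only [hE1, ← hf1, ← hf2, ← hf3]
    field_simp
    simp
    ring
  have hk : ∀ x, 0 < x → ∀ η : ℝ, 0 < η * (f1.eval x / (f2.eval x) ^ 2 * E1 x) → 0 < η * E1 x := by
    intro x hx η hη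
    have h3 : 0 < f1.eval x / (f2.eval x) ^ 2 := div_pos (hp1 x hx) (pow_pos (hp2 x hx) 2)
    have h4 : η * (f1.eval x / (f2.eval x) ^ 2 * E1 x)
      = (f1.eval x / (f2.eval x) ^ 2) * (η * E1 x) := by ring
    rw [h4] at hη
    exact pos_of_mul_pos_right hη h3.le
  have hEalt : Alternates E N ε 0 := by
    refine h.congr_sign le_rfl fun x hx η hη => ?_
    have h5 : η * E x = (η * ((p + 1) * f1.eval x ^ 2 - p * f.eval x * f2.eval x)) / f2.eval x := by
      have := (hp2 x hx).ne'
      simp only [hE]; field_simp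
    rw [h5]
    exact div_pos hη (hp2 x hx)
  have hstep := gapCount_derivative f (by omega)
  rw [← hf1] at hstep
  -- In general Rolle's theorem loses the first alternation. If `f(0) = f'(0) = 0`, then `E`
  -- vanishes at `0`, which serves as the missing starting point, and nothing is lost. This
  -- dichotomy is the summand of index `0` in `gapCount`.
  by_cases hcase : f.coeff 0 ≠ 0 ∨ f.coeff 1 ≠ 0
  · rw [if_pos hcase] at hstep
    cases N with
    | zero => simp
    | succ N =>
      obtain ⟨x, hx, h1, h2⟩ := hEalt
      have := ih f1 hc1 (p + 1) (by linarith) N (-ε) (Alternates.mono_left hx.le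
        (h2.of_deriv hx.le hEd hk
          (fun y hy => (hEd y (hx.trans_le hy)).continuousAt.continuousWithinAt) (by linarith)))
        hdeg1
      omega
  · rw [if_neg hcase] at hstep
    push Not at hcase
    -- If also `f''(0) = 0`, the quotient at `0` is `0` by the convention for division; the bound
    -- `f' ≤ x f''` below shows that this is the right limit, since `f'² / f'' ≤ x f'`.
    have hE0 : E 0 = 0 := by
      have e0 : f.eval 0 = 0 := by rw [← coeff_zero_eq_eval_zero, hcase.1]
      have e1 : f1.eval 0 = 0 := by
        rw [← coeff_zero_eq_eval_zero, hf1, coeff_derivative]; simp [hcase.2]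
      simp [hE, e0, e1]
    have hle : ∀ x, 0 < x → f1.eval x ≤ x * f2.eval x := by
      intro x hx
      have e1 : f1.coeff 0 = 0 := by rw [hf1, coeff_derivative]; simp [hcase.2]
      have hX : ∀ k, 0 ≤ (X * f2 - f1).coeff k := by
        intro k
        cases k with
        | zero => simp [e1]
        | succ k =>
          rw [coeff_sub, coeff_X_mul, hf2, coeff_derivative]
          have := hc1 (k + 1)
          nlinarith [(Nat.cast_nonneg k : (0 : ℝ) ≤ k)]
      have := eval_nonneg_of_coeff_nonneg hX hx.le
      simp only [eval_sub, eval_mul, eval_X] at this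
      linarith
    have hcont : ContinuousOn E (Set.Ici 0) := by
      intro x hx
      rcases (Set.mem_Ici.1 hx).eq_or_lt with h0 | h0
      · subst h0
        have hf0c : Filter.Tendsto (fun x => f.eval x) (nhdsWithin 0 (Set.Ici 0)) (nhds 0) := by
          have := (f.continuous.tendsto 0).mono_left (nhdsWithin_le_nhds (s := Set.Ici 0))
          rwa [← coeff_zero_eq_eval_zero, hcase.1] at this
        have hb : Filter.Tendsto (fun x => (p + 1) * (x * f1.eval x))
            (nhdsWithin 0 (Set.Ici 0)) (nhds 0) := by
          have : Continuous fun x => (p + 1) * (x * f1.eval x) := by fun_prop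
          have := (this.tendsto 0).mono_left (nhdsWithin_le_nhds (s := Set.Ici 0))
          simpa using this
        have hq : Filter.Tendsto (fun x => (p + 1) * (f1.eval x) ^ 2 / f2.eval x)
            (nhdsWithin 0 (Set.Ici 0)) (nhds 0) := by
          refine tendsto_of_tendsto_of_tendsto_of_le_of_le' tendsto_const_nhds hb ?_ ?_
          · filter_upwards [self_mem_nhdsWithin] with x hx
            exact div_nonneg (by positivity) (eval_nonneg_of_coeff_nonneg hc2 hx)
          · filter_upwards [self_mem_nhdsWithin] with x hx
            rcases (Set.mem_Ici.1 hx).eq_or_lt with h0 | h0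
            · subst h0
              have e1 : f1.eval 0 = 0 := by
                rw [← coeff_zero_eq_eval_zero, hf1, coeff_derivative]; simp [hcase.2]
              simp [e1]
            · rw [div_le_iff₀ (hp2 x h0)]
              have := mul_le_mul_of_nonneg_left (hle x h0) (hp1 x h0).le
              nlinarith
        have := hq.sub (hf0c.const_mul p)
        rw [ContinuousWithinAt, hE0]
        simpa using this
      · exact (hEd x h0).continuousAt.continuousWithinAt
    have := ih f1 hc1 (p + 1) (by linarith) N ε
      (hEalt.of_deriv le_rfl hEd hk hcont (by simp [hE0])) hdeg1
    omega

end SphericalSpinGlass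

/-! ### Dips of `f ^ (-1/2)` below a line -/

namespace SphericalSpinGlass
open Polynomial

/-- The derivative of `f ^ (-1/2)`. -/
noncomputable def rsqrtDeriv (f : ℝ[X]) (x : ℝ) : ℝ :=
  -(derivative f).eval x / (2 * f.eval x * √(f.eval x))

lemma hasDerivAt_rsqrt (f : ℝ[X]) {x : ℝ} (hx : 0 < f.eval x) :
    HasDerivAt (fun x => (√(f.eval x))⁻¹) (rsqrtDeriv f x) x := by
  have hs : 0 < √(f.eval x) := Real.sqrt_pos.2 hx
  refine (((f.hasDerivAt x).sqrt hx.ne').inv hs.ne').congr_deriv ?_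
  rw [Real.sq_sqrt hx.le, rsqrtDeriv]
  field_simp

/-- The numerator is the expression of `alternates_le_gapCount` for `p = 2`, so convexity changes of
`f ^ (-1/2)` can be counted. -/
lemma hasDerivAt_rsqrtDeriv (f : ℝ[X]) {x : ℝ} (hx : 0 < f.eval x) :
    HasDerivAt (rsqrtDeriv f) (((2 + 1) * ((derivative f).eval x) ^ 2
      - 2 * f.eval x * (derivative (derivative f)).eval x) / (4 * f.eval x ^ 2 * √(f.eval x))) x := by
  have hs : 0 < √(f.eval x) := Real.sqrt_pos.2 hx
  have h1 : HasDerivAt (fun y => 2 * f.eval y * √(f.eval y))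
      (3 * √(f.eval x) * (derivative f).eval x) x := by
    refine (((f.hasDerivAt x).const_mul 2).mul ((f.hasDerivAt x).sqrt hx.ne')).congr_deriv ?_
    have h2 := Real.sq_sqrt hx.le
    field_simp
    rw [h2]
    ring
  refine (((derivative f).hasDerivAt x).neg.div h1 (by positivity)).congr_deriv ?_
  have h3 : √(f.eval x) ≠ 0 := hs.ne'
  field_simp
  simp only [Pi.neg_apply]
  ring

/-- `f ^ (-1/2)` dips below a line of slope `-m` on `(s, t)`. -/
def Dips (f : ℝ[X]) (s t m : ℝ) : Prop :=
  ∃ a b, s < a ∧ a < b ∧ b < t ∧ rsqrtDeriv f a < -m ∧ -m < rsqrtDeriv f b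

lemma rsqrt_le_of_le {F A : ℝ} (hF : 0 < F) (hA : 0 < A) (h : F ≤ 1 / A ^ 2) : A ≤ (√F)⁻¹ := by
  have h1 : √F ≤ A⁻¹ := Real.sqrt_le_iff.2 ⟨by positivity, by simpa using h⟩
  exact (le_inv_comm₀ (Real.sqrt_pos.2 hF) hA).1 h1

lemma rsqrt_lt_of_lt {F A : ℝ} (hA : 0 < A) (h : 1 / A ^ 2 < F) : (√F)⁻¹ < A := by
  have h1 : A⁻¹ < √F := Real.lt_sqrt_of_sq_lt (by simpa using h)
  exact inv_lt_of_inv_lt₀ hA h1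

/-- `f ^ (-1/2)` is at least the affine function near `s` and at `t`, and strictly below it at `y`;
the mean value theorem on either side of `y` gives slopes below and above `-m`. -/
lemma dips_of_lt (f : ℝ[X]) (hf : ∀ k, 0 ≤ f.coeff k) (hf0 : f.coeff 0 = 0) (hne : f ≠ 0)
    {α : ℝ → ℝ} (hα : Continuous α) (hpos : ∀ x, 0 < α x) {s y t m A : ℝ} (hs : 0 ≤ s)
    (hsy : s < y) (hyt : y < t) (hlin : ∀ x ∈ Set.Icc s t, α x = A - m * x)
    (h1 : f.eval s ≤ 1 / α s ^ 2) (h2 : f.eval t ≤ 1 / α t ^ 2) (h3 : 1 / α y ^ 2 < f.eval y) :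
    Dips f s t m := by
  -- At `s = 0` the function `f ^ (-1/2)` is infinite because `f(0) = 0`, so the left end is moved
  -- to a small positive point, where `f < 1/α²` by continuity.
  obtain ⟨r, hr0, hsr, hry, hr⟩ : ∃ r, 0 < r ∧ s ≤ r ∧ r < y ∧ f.eval r ≤ 1 / α r ^ 2 := by
    rcases hs.eq_or_lt with h | h
    · subst h
      have hcont : Continuous fun x => 1 / α x ^ 2 - f.eval x :=
        (continuous_const.div (hα.pow 2) fun x => (pow_pos (hpos x) 2).ne').sub f.continuous
      have hlt : 0 < 1 / α 0 ^ 2 - f.eval 0 := by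
        rw [← coeff_zero_eq_eval_zero, hf0, sub_zero]
        exact div_pos one_pos (pow_pos (hpos 0) 2)
      have hev : ∀ᶠ x in nhds (0 : ℝ), 0 < 1 / α x ^ 2 - f.eval x :=
        hcont.continuousAt.eventually (lt_mem_nhds hlt)
      obtain ⟨δ, hδ, hball⟩ := Metric.eventually_nhds_iff.1 hev
      refine ⟨min (δ / 2) (y / 2), by positivity, by positivity,
        (min_le_right _ _).trans_lt (by linarith), ?_⟩
      have := hball (y := min (δ / 2) (y / 2)) (by
        rw [Real.dist_eq, sub_zero, abs_of_pos (by positivity)]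
        exact (min_le_left _ _).trans_lt (by linarith))
      linarith
    · exact ⟨s, h, le_rfl, hsy, h1⟩
  have hfp : ∀ x, 0 < x → 0 < f.eval x := fun x hx => eval_pos_of_coeff_nonneg hf hne hx
  set u : ℝ → ℝ := fun x => (√(f.eval x))⁻¹ with hu
  have hud : ∀ x, 0 < x → HasDerivAt u (rsqrtDeriv f x) x := fun x hx =>
    hasDerivAt_rsqrt f (hfp x hx)
  have er : A - m * r ≤ u r := by
    rw [← hlin r ⟨hsr, (hry.trans hyt).le⟩]; exact rsqrt_le_of_le (hfp r hr0) (hpos r) hr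
  have et : A - m * t ≤ u t := by
    rw [← hlin t ⟨(hsy.trans hyt).le, le_rfl⟩]
    exact rsqrt_le_of_le (hfp t (hr0.trans (hry.trans hyt))) (hpos t) h2
  have ey : u y < A - m * y := by
    rw [← hlin y ⟨hsy.le, hyt.le⟩]; exact rsqrt_lt_of_lt (hpos y) h3
  obtain ⟨a, ha, ha'⟩ := exists_hasDerivAt_eq_slope u (rsqrtDeriv f) hry
    (fun x hx => (hud x (hr0.trans_le hx.1)).continuousAt.continuousWithinAt)
    (fun x hx => hud x (hr0.trans hx.1))
  obtain ⟨b, hb, hb'⟩ := exists_hasDerivAt_eq_slope u (rsqrtDeriv f) hyt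
    (fun x hx => (hud x (hr0.trans (hry.trans_le hx.1))).continuousAt.continuousWithinAt)
    (fun x hx => hud x (hr0.trans (hry.trans hx.1)))
  refine ⟨a, b, hsr.trans_lt ha.1, ha.2.trans hb.1, hb.2, ?_, ?_⟩
  · rw [ha', div_lt_iff₀ (by linarith)]; linarith
  · rw [hb', lt_div_iff₀ (by linarith)]; linarith

/-- To the right of `x` there is room for `k` successive dips, the first one with a slope less
than `-μ` at its start. -/
def DipChain (f : ℝ[X]) (x μ : ℝ) : ℕ → Prop
  | 0 => True
  | k + 1 => ∃ a, x < a ∧ rsqrtDeriv f a < -μ ∧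
      Alternates (fun x => (2 + 1) * ((derivative f).eval x) ^ 2
        - 2 * f.eval x * (derivative (derivative f)).eval x) (2 * k + 1) 1 a

/-- Inside the new dip the slope rises through `-m`, so the second derivative is positive somewhere.
From its end (slope above `-m ≥ -μ`) to the start of the next dip (slope below `-μ`) the slope
falls, so it is negative somewhere. Each additional dip thus adds two alternations. -/
lemma DipChain.cons (f : ℝ[X]) (hf : ∀ k, 0 ≤ f.coeff k) (hne : f ≠ 0) {s t m μ : ℝ} {k : ℕ}
    (hs : 0 ≤ s) (hm : m ≤ μ) (hdip : Dips f s t m) (h : DipChain f t μ k) :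
    DipChain f s m (k + 1) := by
  obtain ⟨a, b, hsa, hab, hbt, ha, hb⟩ := hdip
  have hfp : ∀ x, 0 < x → 0 < f.eval x := fun x hx => eval_pos_of_coeff_nonneg hf hne hx
  have mvt : ∀ x y, 0 < x → x < y → ∃ c, x < c ∧ c < y ∧ ∀ η : ℝ,
      0 < η * (rsqrtDeriv f y - rsqrtDeriv f x) → 0 < η * ((2 + 1) * ((derivative f).eval c) ^ 2
        - 2 * f.eval c * (derivative (derivative f)).eval c) := by
    intro x y hx hxy
    obtain ⟨c, hc, hc'⟩ := exists_hasDerivAt_eq_slope (rsqrtDeriv f) _ hxy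
      (fun z hz => (hasDerivAt_rsqrtDeriv f
        (hfp z (hx.trans_le hz.1))).continuousAt.continuousWithinAt)
      (fun z hz => hasDerivAt_rsqrtDeriv f (hfp z (hx.trans hz.1)))
    refine ⟨c, hc.1, hc.2, fun η hη => ?_⟩
    have hc0 := hfp c (hx.trans hc.1)
    have h4 : 0 < 4 * f.eval c ^ 2 * √(f.eval c) :=
      mul_pos (by positivity) (Real.sqrt_pos.2 hc0)
    rw [div_eq_div_iff h4.ne' (sub_pos.2 hxy).ne'] at hc'
    refine pos_of_mul_pos_left (b := y - x) ?_ (sub_pos.2 hxy).le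
    rw [mul_assoc, hc', ← mul_assoc]
    exact mul_pos hη h4
  have ha0 : 0 < a := hs.trans_lt hsa
  obtain ⟨c, hac, hcb, hc⟩ := mvt a b ha0 hab
  refine ⟨a, hsa, ha, c, hac, hc 1 (by linarith), ?_⟩
  cases k with
  | zero => trivial
  | succ k =>
    obtain ⟨a', hta', ha', halt⟩ := h
    obtain ⟨c', hbc', hca', hc'⟩ := mvt b a' (ha0.trans hab) (hbt.trans hta')
    refine ⟨c', hcb.trans hbc', hc' (-1) (by linarith), ?_⟩
    rw [neg_neg]
    exact halt.mono_left hca'.le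

/-- `k ≥ 1` dips produce `2k - 1` alternations, while at most `1 + gapCount f`, hence at most twice
the number of monomials minus one, are possible. -/
lemma DipChain.length_le (f : ℝ[X]) (hf : ∀ k, 0 ≤ f.coeff k) (hne : f ≠ 0) {x μ : ℝ} {k : ℕ}
    (hx : 0 ≤ x) (h : DipChain f x μ k) : k ≤ f.support.card := by
  cases k with
  | zero => simp
  | succ k =>
    obtain ⟨a, hxa, -, halt⟩ := h
    have h1 := alternates_le_gapCount f hf 2 (by norm_num) _ _ (halt.mono_left (hx.trans hxa.le))
    have h2 := gapCount_le f hne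
    omega

/-! ### Nonnegativity of the overlap function -/

open Set intervalIntegral

/-- An overlap function whose derivative vanishes at both ends, and which is somewhere negative,
has a second derivative changing sign at least four times. -/
lemma exists_pos_neg_pos {g D : ℝ → ℝ} {s t x : ℝ} (hg : ∀ x, HasDerivAt g (D x) x)
    (hs : g s = 0) (ht : g t = 0) (hint : ∫ y in s..t, g y = 0) (hx : x ∈ Icc s t)
    (hneg : ∫ y in x..t, g y < 0) :
    ∃ y z y', s < y ∧ y < z ∧ z < y' ∧ y' < t ∧ 0 < D y ∧ D z < 0 ∧ 0 < D y' := by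
  have hgc : Continuous g := continuous_iff_continuousAt.2 fun x => (hg x).continuousAt
  set G : ℝ → ℝ := fun x => ∫ y in x..t, g y with hG
  have hGd : ∀ x, HasDerivAt G (-g x) x := fun x =>
    integral_hasDerivAt_left (hgc.intervalIntegrable _ _)
      (hgc.stronglyMeasurableAtFilter _ _) hgc.continuousAt
  have hGc : Continuous G := continuous_iff_continuousAt.2 fun x => (hGd x).continuousAt
  -- The negative minimum of `G` is interior, so `g` has a third zero `x₀` and is positive somewhere
  -- before it and negative somewhere after it. The slopes of `g` between these points have signs
  -- `+`, `-`, `+`.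
  obtain ⟨x₀, hx₀, hmin⟩ := isCompact_Icc.exists_isMinOn ⟨x, hx⟩ hGc.continuousOn
  have hG0 : G x₀ < 0 := (hmin hx).trans_lt hneg
  have hGs : G s = 0 := hint
  have hGt : G t = 0 := integral_same
  have h1 : s < x₀ := lt_of_le_of_ne hx₀.1 (by rintro rfl; linarith)
  have h2 : x₀ < t := lt_of_le_of_ne hx₀.2 (by rintro rfl; linarith)
  have hg0 : g x₀ = 0 := by
    have hloc : IsLocalMin G x₀ := hmin.isLocalMin (Icc_mem_nhds h1 h2)
    have := hloc.hasDerivAt_eq_zero (hGd x₀)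
    linarith
  have slope : ∀ (h : ℝ → ℝ) (h' : ℝ → ℝ), (∀ x, HasDerivAt h (h' x) x) → ∀ a b, a < b →
      ∃ c, a < c ∧ c < b ∧ h' c * (b - a) = h b - h a := by
    intro h h' hd a b hab
    obtain ⟨c, hc, hc'⟩ := exists_hasDerivAt_eq_slope h h' hab
      (fun z _ => (hd z).continuousAt.continuousWithinAt) (fun z _ => hd z)
    exact ⟨c, hc.1, hc.2, by rw [hc']; exact div_mul_cancel₀ _ (sub_pos.2 hab).ne'⟩
  obtain ⟨a, ha1, ha2, ha⟩ := slope G _ hGd s x₀ h1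
  obtain ⟨b, hb1, hb2, hb⟩ := slope G _ hGd x₀ t h2
  have hga : 0 < g a := by
    by_contra hcon
    nlinarith [mul_nonneg_of_nonpos_of_nonpos (not_lt.1 hcon) (by linarith : s - x₀ ≤ 0)]
  have hgb : g b < 0 := by
    by_contra hcon
    nlinarith [mul_nonneg (not_lt.1 hcon) (by linarith : 0 ≤ t - x₀)]
  obtain ⟨y, hy1, hy2, hy⟩ := slope g D hg s a ha1
  obtain ⟨z, hz1, hz2, hz⟩ := slope g D hg a x₀ ha2
  obtain ⟨y', hy1', hy2', hy'⟩ := slope g D hg b t hb2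
  refine ⟨y, z, y', hy1, hy2.trans hz1, (hz2.trans hb1).trans hy1', hy2', ?_, ?_, ?_⟩
  · exact pos_of_mul_pos_left (by linarith : 0 < D y * (a - s)) (by linarith)
  · exact (neg_iff_pos_of_mul_neg (by linarith : D z * (x₀ - a) < 0)).2 (by linarith)
  · exact pos_of_mul_pos_left (by linarith : 0 < D y' * (t - b)) (by linarith)

/-- A nonconstant polynomial is not the inverse square of an affine function on an interval. -/
lemma exists_ne_rsq_affine (f : ℝ[X]) (hf0 : f.coeff 0 = 0) {s t m A : ℝ} (hst : s < t)
    (hpos : ∀ x ∈ Icc s t, 0 < A - m * x) :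
    ∃ x ∈ Ioo s t, f.eval x ≠ 1 / (A - m * x) ^ 2 := by
  by_contra! hcon
  have h1 : f * (C A - C m * X) ^ 2 = 1 := by
    refine Polynomial.eq_of_infinite_eval_eq _ _ ((Ioo_infinite hst).mono fun x hx => ?_)
    have := (hpos x (Ioo_subset_Icc_self hx)).ne'
    simp only [mem_ofPred_eq, eval_mul, eval_pow, eval_sub, eval_C, eval_X, eval_one, hcon x hx]
    field_simp
  have h2 := congrArg (fun r : ℝ[X] => r.eval 0) h1
  simp [← coeff_zero_eq_eval_zero, hf0] at h2

lemma exists_pos_of_ends {g D : ℝ → ℝ} {s t : ℝ} (hst : s < t) (hg : ∀ x, HasDerivAt g (D x) x)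
    (hs : g s = 0) (ht : g t = 0) (hne : ∃ x ∈ Ioo s t, D x ≠ 0) : ∃ y, s < y ∧ y < t ∧ 0 < D y := by
  by_contra! hcon
  have hanti : AntitoneOn g (Icc s t) := by
    refine antitoneOn_of_deriv_nonpos (convex_Icc s t)
      (fun z _ => (hg z).continuousAt.continuousWithinAt)
      (fun z _ => (hg z).differentiableAt.differentiableWithinAt) fun z hz => ?_
    rw [interior_Icc] at hz
    rw [(hg z).deriv]
    exact hcon z hz.1 hz.2
  obtain ⟨x, hx, hx0⟩ := hne
  have hzero : ∀ z ∈ Icc s t, g z = 0 := fun z hz => le_antisymm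
    (hs ▸ hanti (left_mem_Icc.2 hst.le) hz hz.1) (ht ▸ hanti hz (right_mem_Icc.2 hst.le) hz.2)
  have hev : g =ᶠ[nhds x] fun _ => (0 : ℝ) := by
    filter_upwards [Icc_mem_nhds hx.1 hx.2] with z hz using hzero z hz
  exact hx0 ((hg x).unique ((hasDerivAt_const x (0 : ℝ)).congr_of_eventuallyEq hev))

/-- The stationarity equations together with the local conditions at the atoms imply that the
overlap function is nonnegative. -/
theorem overlap_nonneg (f : ℝ[X]) (hf : ∀ k, 0 ≤ f.coeff k) (hf0 : f.coeff 0 = 0) (hne : f ≠ 0)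
    {n : ℕ} (hcard : f.support.card ≤ n) {q m : ℕ → ℝ} {α g : ℝ → ℝ} (hα : Continuous α)
    (hpos : ∀ x, 0 < α x) (hq0 : q 0 = 0) (hq : ∀ l < n, q l < q (l + 1))
    (hm : ∀ l, l + 1 < n → m l ≤ m (l + 1))
    (hlin : ∀ l < n, ∀ x ∈ Icc (q l) (q (l + 1)), α x = α (q (l + 1)) + m l * (q (l + 1) - x))
    (hg : ∀ x, HasDerivAt g (f.eval x - 1 / α x ^ 2) x) (hgq : ∀ l ≤ n, g (q l) = 0)
    (hint : ∀ l < n, ∫ x in q l..q (l + 1), g x = 0)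
    (hloc : ∀ l ≤ n, f.eval (q l) ≤ 1 / α (q l) ^ 2) :
    ∀ l < n, ∀ x ∈ Icc (q l) (q (l + 1)), 0 ≤ ∫ y in x..q (l + 1), g y := by
  intro l₀ hl₀ x hx
  by_contra! hneg
  have hqn : ∀ l, l ≤ n → 0 ≤ q l := by
    intro l
    induction l with
    | zero => intro _; exact hq0.ge
    | succ l ih => intro h; exact (ih (by omega)).trans (hq l (by omega)).le
  have hlin' : ∀ l < n, ∀ x ∈ Icc (q l) (q (l + 1)),
      α x = α (q (l + 1)) + m l * q (l + 1) - m l * x := by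
    intro l hl x hx; rw [hlin l hl x hx]; ring
  -- One dip per piece: `g` vanishes at both ends without being constant, so `g' = f - 1/α²` is
  -- positive somewhere.
  have hdip : ∀ l < n, Dips f (q l) (q (l + 1)) (m l) := by
    intro l hl
    obtain ⟨x, hx, hxne⟩ := exists_ne_rsq_affine f hf0 (hq l hl)
      (m := m l) (A := α (q (l + 1)) + m l * q (l + 1))
      (fun x hx => by rw [← hlin' l hl x hx]; exact hpos x)
    rw [← hlin' l hl x (Ioo_subset_Icc_self hx)] at hxne
    obtain ⟨y, h1, h2, h3⟩ := exists_pos_of_ends (hq l hl) hg (hgq l hl.le) (hgq (l + 1) hl)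
      ⟨x, hx, sub_ne_zero.2 hxne⟩
    exact dips_of_lt f hf hf0 hne hα hpos (hqn l hl.le) h1 h2 (hlin' l hl) (hloc l hl.le)
      (hloc (l + 1) hl) (sub_pos.1 h3)
  have hright : ∀ k, k ≤ n → (k = 0 ∨ DipChain f (q (n - k)) (m (n - k)) k) := by
    intro k
    induction k with
    | zero => intro _; exact Or.inl rfl
    | succ k ih =>
      intro hk
      right
      have hd := hdip (n - (k + 1)) (by omega)
      rcases Nat.eq_zero_or_pos k with hk0 | hk0
      · subst hk0
        exact DipChain.cons f hf hne (hqn _ (by omega)) le_rfl hd trivial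
      · have h := (ih (by omega)).resolve_left hk0.ne'
        rw [show n - k = n - (k + 1) + 1 by omega] at h
        exact h.cons f hf hne (hqn _ (by omega)) (hm _ (by omega)) hd
  -- The piece with a negative overlap contains two dips, separated at a point `z` where `g' < 0`;
  -- hence the surplus `+ 1`.
  have hbad : DipChain f (q l₀) (m l₀) (n - l₀ + 1) := by
    obtain ⟨y, z, y', h1, h2, h3, h4, hy, hz, hy'⟩ := exists_pos_neg_pos hg (hgq l₀ hl₀.le)
      (hgq (l₀ + 1) hl₀) (hint l₀ hl₀) hx hneg
    have hsub1 : ∀ x ∈ Icc (q l₀) z, α x = α (q (l₀ + 1)) + m l₀ * q (l₀ + 1) - m l₀ * x :=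
      fun x hx => hlin' l₀ hl₀ x ⟨hx.1, hx.2.trans (h3.trans h4).le⟩
    have hsub2 : ∀ x ∈ Icc z (q (l₀ + 1)),
        α x = α (q (l₀ + 1)) + m l₀ * q (l₀ + 1) - m l₀ * x :=
      fun x hx => hlin' l₀ hl₀ x ⟨(h1.trans h2).le.trans hx.1, hx.2⟩
    have hz0 : 0 ≤ z := (hqn l₀ hl₀.le).trans (h1.trans h2).le
    have hd1 : Dips f (q l₀) z (m l₀) := dips_of_lt f hf hf0 hne hα hpos (hqn l₀ hl₀.le) h1 h2
      hsub1 (hloc l₀ hl₀.le) (sub_neg.1 hz).le (sub_pos.1 hy)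
    have hd2 : Dips f z (q (l₀ + 1)) (m l₀) := dips_of_lt f hf hf0 hne hα hpos hz0 h3 h4
      hsub2 (sub_neg.1 hz).le (hloc (l₀ + 1) hl₀) (sub_pos.1 hy')
    refine DipChain.cons f hf hne (hqn l₀ hl₀.le) le_rfl hd1 ?_
    rw [show n - l₀ = n - (l₀ + 1) + 1 by omega]
    rcases hright (n - (l₀ + 1)) (by omega) with h | h
    · rw [h]
      exact DipChain.cons f hf hne hz0 le_rfl hd2 trivial
    · rcases Nat.lt_or_ge (l₀ + 1) n with hlt | hge
      · rw [show n - (n - (l₀ + 1)) = l₀ + 1 by omega] at h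
        exact h.cons f hf hne hz0 (hm l₀ hlt) hd2
      · rw [show n - (l₀ + 1) = 0 by omega]
        exact DipChain.cons f hf hne hz0 le_rfl hd2 trivial
  have hleft : ∀ l, l ≤ l₀ → DipChain f (q (l₀ - l)) (m (l₀ - l)) (n - (l₀ - l) + 1) := by
    intro l
    induction l with
    | zero => intro _; exact hbad
    | succ l ih =>
      intro hl
      have h := ih (by omega)
      have hd := hdip (l₀ - (l + 1)) (by omega)
      rw [show l₀ - l = l₀ - (l + 1) + 1 by omega] at h
      have := h.cons f hf hne (hqn (l₀ - (l + 1)) (by omega)) (hm _ (by omega)) hd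
      rwa [show n - (l₀ - (l + 1) + 1) + 1 + 1 = n - (l₀ - (l + 1)) + 1 by omega] at this
  have h := hleft l₀ le_rfl
  rw [Nat.sub_self] at h
  -- There are now `n + 1` dips, against at most `n` monomials.
  have := h.length_le f hf hne hq0.ge
  omega

end SphericalSpinGlass

/-! ### Duality for the Crisanti–Sommers functional -/

namespace SphericalSpinGlass
open MeasureTheory Set

lemma setLIntegral_densityAndAtom {γ : ℝ → ℝ} {Δ : ℝ}
    (hγ : AEMeasurable γ (volume.restrict (Ico (0 : ℝ) 1))) {g : ℝ → ℝ≥0∞} (hg : Measurable g) :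
    ∫⁻ x in Icc (0 : ℝ) 1, g x ∂(densityAndAtom γ Δ)
      = (∫⁻ x in Ico (0 : ℝ) 1, ENNReal.ofReal (γ x) * g x) + ENNReal.ofReal Δ * g 1 := by
  rw [densityAndAtom, Measure.restrict_add, lintegral_add_measure, Measure.restrict_smul,
    lintegral_smul_measure, restrict_withDensity measurableSet_Icc,
    Measure.restrict_restrict measurableSet_Icc, inter_eq_right.2 Ico_subset_Icc_self,
    lintegral_withDensity_eq_lintegral_mul₀ hγ.ennreal_ofReal hg.aemeasurable]
  congr 1
  rw [setLIntegral_dirac' hg measurableSet_Icc, if_pos (by simp)]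
  rfl

lemma densityAndAtom_Ioc (γ : ℝ → ℝ) (Δ : ℝ) {x : ℝ} (hx : x ∈ Ico (0 : ℝ) 1) :
    densityAndAtom γ Δ (Ioc x 1)
      = (∫⁻ y in Ioo x 1, ENNReal.ofReal (γ y)) + ENNReal.ofReal Δ := by
  have h1 : Ioc x 1 ∩ Ico 0 1 = Ioo x 1 := by
    ext y
    simp only [mem_inter_iff, mem_Ioc, mem_Ico, mem_Ioo]
    constructor
    · rintro ⟨⟨h1, h2⟩, h3, h4⟩; exact ⟨h1, h4⟩
    · rintro ⟨h1, h2⟩; exact ⟨⟨h1, h2.le⟩, hx.1.trans h1.le, h2⟩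
  rw [densityAndAtom, Measure.add_apply, withDensity_apply _ measurableSet_Ioc,
    Measure.restrict_restrict measurableSet_Ioc, h1, Measure.smul_apply,
    Measure.dirac_apply' _ measurableSet_Ioc, indicator_of_mem (by exact ⟨hx.2, le_rfl⟩)]
  simp

/-- This is the tangent line at `a` to the convex function `b ↦ 1/b`; for finite positive `b` the
defect is `(a - b)² / (b a²)`. -/
lemma two_div_le_inv_add {a : ℝ} (ha : 0 < a) (b : ℝ≥0∞) :
    ENNReal.ofReal (2 / a) ≤ b⁻¹ + b * ENNReal.ofReal (1 / a ^ 2) := by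
  rcases eq_or_ne b ⊤ with rfl | hb
  · rw [ENNReal.top_mul (by simpa using ha.ne')]; simp
  rcases eq_or_ne b 0 with rfl | hb0
  · simp
  obtain ⟨r, hr, rfl⟩ : ∃ r : ℝ, 0 < r ∧ b = ENNReal.ofReal r :=
    ⟨b.toReal, ENNReal.toReal_pos hb0 hb, (ENNReal.ofReal_toReal hb).symm⟩
  rw [← ENNReal.ofReal_inv_of_pos hr, ← ENNReal.ofReal_mul hr.le,
    ← ENNReal.ofReal_add (by positivity) (by positivity)]
  refine ENNReal.ofReal_le_ofReal ?_
  have : r⁻¹ + r * (1 / a ^ 2) - 2 / a = (a - r) ^ 2 / (r * a ^ 2) := by field_simp; ring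
  have : 0 ≤ (a - r) ^ 2 / (r * a ^ 2) := by positivity
  linarith

/-- The equality case is what yields uniqueness of the minimizer. -/
lemma eq_ofReal_of_inv_add_eq {a : ℝ} (ha : 0 < a) {b : ℝ≥0∞}
    (h : ENNReal.ofReal (2 / a) = b⁻¹ + b * ENNReal.ofReal (1 / a ^ 2)) :
    b = ENNReal.ofReal a := by
  rcases eq_or_ne b ⊤ with rfl | hb
  · rw [ENNReal.top_mul (by simpa using ha.ne')] at h; simp at h
  rcases eq_or_ne b 0 with rfl | hb0
  · simp at h
  obtain ⟨r, hr, rfl⟩ : ∃ r : ℝ, 0 < r ∧ b = ENNReal.ofReal r :=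
    ⟨b.toReal, ENNReal.toReal_pos hb0 hb, (ENNReal.ofReal_toReal hb).symm⟩
  rw [← ENNReal.ofReal_inv_of_pos hr, ← ENNReal.ofReal_mul hr.le,
    ← ENNReal.ofReal_add (by positivity) (by positivity),
    ENNReal.ofReal_eq_ofReal_iff (by positivity) (by positivity)] at h
  have h1 : r⁻¹ + r * (1 / a ^ 2) - 2 / a = (a - r) ^ 2 / (r * a ^ 2) := by field_simp; ring
  have h2 : (a - r) ^ 2 / (r * a ^ 2) = 0 := by linarith
  rw [div_eq_zero_iff] at h2
  rcases h2 with h2 | h2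
  · rw [show r = a by linarith [pow_eq_zero_iff (two_ne_zero) |>.1 h2]]
  · exact absurd h2 (by positivity)

/-- The primitive `y ↦ ∫₀^y dx / α(x)²`. -/
noncomputable def rsqPrimitive (α : ℝ → ℝ) (y : ℝ) : ℝ := ∫ x in (0 : ℝ)..y, 1 / α x ^ 2

section
variable {α : ℝ → ℝ}

lemma continuous_rsq (hα : Continuous α) (hpos : ∀ x, 0 < α x) :
    Continuous fun x => 1 / α x ^ 2 :=
  continuous_const.div (hα.pow 2) fun x => (pow_pos (hpos x) 2).ne'

lemma hasDerivAt_rsqPrimitive (hα : Continuous α) (hpos : ∀ x, 0 < α x) (y : ℝ) :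
    HasDerivAt (rsqPrimitive α) (1 / α y ^ 2) y :=
  intervalIntegral.integral_hasDerivAt_right ((continuous_rsq hα hpos).intervalIntegrable _ _)
    ((continuous_rsq hα hpos).stronglyMeasurableAtFilter _ _) (continuous_rsq hα hpos).continuousAt

lemma continuous_rsqPrimitive (hα : Continuous α) (hpos : ∀ x, 0 < α x) :
    Continuous (rsqPrimitive α) :=
  continuous_iff_continuousAt.2 fun y => (hasDerivAt_rsqPrimitive hα hpos y).continuousAt

lemma rsqPrimitive_nonneg (hpos : ∀ x, 0 < α x) {y : ℝ} (hy : 0 ≤ y) : 0 ≤ rsqPrimitive α y :=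
  intervalIntegral.integral_nonneg hy fun x _ => by have := hpos x; positivity

lemma ofReal_rsqPrimitive (hα : Continuous α) (hpos : ∀ x, 0 < α x) {y : ℝ}
    (hy : y ∈ Icc (0 : ℝ) 1) :
    ENNReal.ofReal (rsqPrimitive α y)
      = ∫⁻ x in Ico (0 : ℝ) 1, (Ioi x).indicator 1 y * ENNReal.ofReal (1 / α x ^ 2) := by
  have h1 : ∀ x, (Ioi x).indicator (1 : ℝ → ℝ≥0∞) y * ENNReal.ofReal (1 / α x ^ 2)
      = (Iio y).indicator (fun x => ENNReal.ofReal (1 / α x ^ 2)) x := by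
    intro x
    by_cases h : x < y
    · rw [indicator_of_mem (by exact h), indicator_of_mem (by exact h)]; simp
    · rw [indicator_of_notMem (by exact h), indicator_of_notMem (by exact h), zero_mul]
  simp_rw [h1]
  rw [lintegral_indicator measurableSet_Iio, Measure.restrict_restrict measurableSet_Iio,
    show Iio y ∩ Ico 0 1 = Ico 0 y by
      ext x; simp only [mem_inter_iff, mem_Iio, mem_Ico]
      exact ⟨fun h => ⟨h.2.1, h.1⟩, fun h => ⟨h.2, h.1, h.2.trans_le hy.2⟩⟩,
    setLIntegral_congr Ico_ae_eq_Ioc, rsqPrimitive, intervalIntegral.integral_of_le hy.1,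
    ofReal_integral_eq_lintegral_ofReal]
  · exact ((continuous_rsq hα hpos).intervalIntegrable 0 y).1
  · exact Filter.Eventually.of_forall fun x => by have := hpos x; positivity

lemma aemeasurable_of_monotoneOn {γ : ℝ → ℝ} (hγ : MonotoneOn γ (Ico (0 : ℝ) 1)) :
    AEMeasurable γ (volume.restrict (Ico (0 : ℝ) 1)) :=
  aemeasurable_restrict_of_monotoneOn measurableSet_Ico hγ

/-- Tonelli's theorem on `{x < y}`. It turns the linear term of the dual problem into one involving
only the tail of the measure. -/
lemma setLIntegral_rsqPrimitive (hα : Continuous α) (hpos : ∀ x, 0 < α x) (γ : ℝ → ℝ) (Δ : ℝ) :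
    ∫⁻ y in Icc (0 : ℝ) 1, ENNReal.ofReal (rsqPrimitive α y) ∂(densityAndAtom γ Δ)
      = ∫⁻ x in Ico (0 : ℝ) 1, densityAndAtom γ Δ (Ioc x 1) * ENNReal.ofReal (1 / α x ^ 2) := by
  have hsf : SFinite (densityAndAtom γ Δ) := by unfold densityAndAtom; infer_instance
  rw [setLIntegral_congr_fun measurableSet_Icc (fun y hy => ofReal_rsqPrimitive hα hpos hy),
    lintegral_lintegral_swap]
  · refine setLIntegral_congr_fun measurableSet_Ico fun x hx => ?_
    have h1 : ∀ y, (Ioi x).indicator (1 : ℝ → ℝ≥0∞) y * ENNReal.ofReal (1 / α x ^ 2)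
        = (Ioi x).indicator (fun _ => ENNReal.ofReal (1 / α x ^ 2)) y := by
      intro y
      by_cases h : y ∈ Ioi x <;> simp [h]
    simp_rw [h1]
    rw [lintegral_indicator measurableSet_Ioi, lintegral_const,
      Measure.restrict_restrict measurableSet_Ioi, Measure.restrict_apply_univ,
      show Ioi x ∩ Icc 0 1 = Ioc x 1 by
        ext y; simp only [mem_inter_iff, mem_Ioi, mem_Icc, mem_Ioc]
        exact ⟨fun h => ⟨h.1, h.2.2⟩, fun h => ⟨h.1, hx.1.trans h.1.le, h.2⟩⟩, mul_comm]
  · refine Measurable.aemeasurable ?_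
    have h1 : Measurable fun z : ℝ × ℝ => (Ioi z.2).indicator (1 : ℝ → ℝ≥0∞) z.1 := by
      have h2 : (fun z : ℝ × ℝ => (Ioi z.2).indicator (1 : ℝ → ℝ≥0∞) z.1)
          = {z : ℝ × ℝ | z.2 < z.1}.indicator 1 := by
        ext z
        by_cases h : z.2 < z.1 <;> simp [indicator, h]
      rw [h2]
      exact measurable_one.indicator (measurableSet_lt measurable_snd measurable_fst)
    exact h1.mul ((continuous_rsq hα hpos).measurable.comp measurable_snd).ennreal_ofReal

lemma measurable_densityAndAtom_Ioc (γ : ℝ → ℝ) (Δ : ℝ) :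
    Measurable fun x => densityAndAtom γ Δ (Ioc x 1) :=
  Antitone.measurable fun _ _ hxy => measure_mono (Ioc_subset_Ioc_left hxy)

/-- Integration of a nonnegative nondecreasing density is monotone in the tail integrals. -/
lemma lintegral_monotoneOn_mul_le {γ F A : ℝ → ℝ} (hγ0 : ∀ x ∈ Ico (0 : ℝ) 1, 0 ≤ γ x)
    (hγ : MonotoneOn γ (Ico (0 : ℝ) 1)) (hF : Continuous F) (hA : Continuous A)
    (hF0 : ∀ x ∈ Icc (0 : ℝ) 1, 0 ≤ F x) (hA0 : ∀ x ∈ Icc (0 : ℝ) 1, 0 ≤ A x)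
    (htail : ∀ u ∈ Icc (0 : ℝ) 1, ∫ x in u..1, A x ≤ ∫ x in u..1, F x) :
    ∫⁻ x in Ico (0 : ℝ) 1, ENNReal.ofReal (γ x) * ENNReal.ofReal (A x)
      ≤ ∫⁻ x in Ico (0 : ℝ) 1, ENNReal.ofReal (γ x) * ENNReal.ofReal (F x) := by
  -- Layer-cake formula: `γ` is cut off outside `[0,1)` so that its superlevel sets at positive
  -- levels lie there. By monotonicity each nonempty one is, up to a null set, an interval `(u,1)`,
  -- on which the tail hypothesis applies.
  set δ : ℝ → ℝ := (Ico (0 : ℝ) 1).indicator γ with hδ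
  have hδ0 : ∀ x, 0 ≤ δ x := indicator_nonneg hγ0
  have hset : ∀ t : ℝ, 0 < t → {x | t < δ x} = {x ∈ Ico (0 : ℝ) 1 | t < γ x} := by
    intro t ht
    ext x
    by_cases h : x ∈ Ico (0 : ℝ) 1
    · simp only [mem_ofPred_eq, hδ, indicator_of_mem h]
      exact ⟨fun h' => ⟨h, h'⟩, fun h' => h'.2⟩
    · simp only [mem_ofPred_eq, hδ, indicator_of_notMem h]
      exact ⟨fun h' => absurd h' (not_lt.2 ht.le), fun h' => absurd h'.1 h⟩
  have layer : ∀ B : ℝ → ℝ, Continuous B →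
      ∫⁻ x in Ico (0 : ℝ) 1, ENNReal.ofReal (γ x) * ENNReal.ofReal (B x)
        = ∫⁻ t in Ioi (0 : ℝ), ((volume.restrict (Ico (0 : ℝ) 1)).withDensity
            fun x => ENNReal.ofReal (B x)) {x | t < δ x} := by
    intro B hB
    have hδm : AEMeasurable δ (volume.restrict (Ico (0 : ℝ) 1)) :=
      (aemeasurable_of_monotoneOn hγ).indicator measurableSet_Ico
    rw [← lintegral_eq_lintegral_meas_lt _ (Filter.Eventually.of_forall hδ0)
      (hδm.mono_ac (withDensity_absolutelyContinuous _ _)),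
      lintegral_withDensity_eq_lintegral_mul₀ hB.measurable.ennreal_ofReal.aemeasurable
        hδm.ennreal_ofReal]
    refine setLIntegral_congr_fun measurableSet_Ico fun x hx => ?_
    simp only [Pi.mul_apply, hδ, indicator_of_mem hx]
    rw [mul_comm]
  rw [layer A hA, layer F hF]
  refine setLIntegral_mono' measurableSet_Ioi fun t ht => ?_
  have ht0 : 0 < t := ht
  set S := {x | t < δ x} with hS
  have hSsub : S ⊆ Ico 0 1 := by
    intro x hx; rw [hS, hset t ht0] at hx; exact hx.1
  rcases S.eq_empty_or_nonempty with hemp | hne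
  · simp [hemp]
  set u := sInf S with hu
  have hbdd : BddBelow S := ⟨0, fun x hx => (hSsub hx).1⟩
  have hu0 : 0 ≤ u := le_csInf hne fun x hx => (hSsub hx).1
  have hu1 : u < 1 := by
    obtain ⟨x, hx⟩ := hne
    exact (csInf_le hbdd hx).trans_lt (hSsub hx).2
  have h1 : S ⊆ Ico u 1 := fun x hx => ⟨csInf_le hbdd hx, (hSsub hx).2⟩
  have h2 : Ioo u 1 ⊆ S := by
    intro x hx
    obtain ⟨y, hy, hyx⟩ := exists_lt_of_csInf_lt hne hx.1
    rw [hS, hset t ht0] at hy ⊢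
    have hx' : x ∈ Ico (0 : ℝ) 1 := ⟨hu0.trans hx.1.le, hx.2⟩
    exact ⟨hx', hy.2.trans_le (hγ hy.1 hx' hyx.le)⟩
  have hae : S =ᵐ[volume] Ioo u 1 := by
    refine Filter.EventuallyLE.antisymm ?_ (LE.le.eventuallyLE h2)
    exact (LE.le.eventuallyLE h1).trans Ioo_ae_eq_Ico.symm.le
  have hSm : NullMeasurableSet S volume := measurableSet_Ioo.nullMeasurableSet.congr hae.symm
  have val : ∀ B : ℝ → ℝ, Continuous B → (∀ x ∈ Icc (0 : ℝ) 1, 0 ≤ B x) →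
      ((volume.restrict (Ico (0 : ℝ) 1)).withDensity fun x => ENNReal.ofReal (B x)) S
        = ENNReal.ofReal (∫ x in u..1, B x) := by
    intro B hB hB0
    have hac : S =ᵐ[(volume.restrict (Ico (0 : ℝ) 1)).withDensity fun x => ENNReal.ofReal (B x)]
        Ioo u 1 :=
      ((withDensity_absolutelyContinuous _ _).trans
        Measure.restrict_le_self.absolutelyContinuous).ae_le hae
    rw [measure_congr hac, withDensity_apply _ measurableSet_Ioo,
      Measure.restrict_restrict measurableSet_Ioo, inter_eq_left.2 (h2.trans hSsub),
      intervalIntegral.integral_of_le hu1.le, setLIntegral_congr Ioo_ae_eq_Ioc,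
      ofReal_integral_eq_lintegral_ofReal (hB.intervalIntegrable u 1).1]
    filter_upwards [ae_restrict_mem measurableSet_Ioc] with x hx
    exact hB0 x ⟨hu0.trans hx.1.le, hx.2⟩
  rw [val A hA hA0, val F hF hF0]
  exact ENNReal.ofReal_le_ofReal (htail u ⟨hu0, hu1.le⟩)

/-- The dual lower bound for the Crisanti–Sommers functional. -/
lemma lintegral_two_div_le (hα : Continuous α) (hpos : ∀ x, 0 < α x) {ξ : ℝ → ℝ}
    (hF : Continuous (deriv ξ)) (hF0 : ∀ x ∈ Icc (0 : ℝ) 1, 0 ≤ deriv ξ x)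
    (h1 : deriv ξ 1 = rsqPrimitive α 1)
    (htail : ∀ u ∈ Icc (0 : ℝ) 1, ∫ x in u..1, rsqPrimitive α x ≤ ∫ x in u..1, deriv ξ x)
    {ν : Measure ℝ} (hν : ν ∈ classK) :
    ∫⁻ x in Ico (0 : ℝ) 1, ENNReal.ofReal (2 / α x)
      ≤ ∫⁻ x in Ico (0 : ℝ) 1, ((ν (Ioc x 1))⁻¹ + ν (Ioc x 1) * ENNReal.ofReal (1 / α x ^ 2)) ∧
    ∫⁻ x in Ico (0 : ℝ) 1, ((ν (Ioc x 1))⁻¹ + ν (Ioc x 1) * ENNReal.ofReal (1 / α x ^ 2))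
      ≤ (∫⁻ x in Icc (0 : ℝ) 1, ENNReal.ofReal (deriv ξ x) ∂ν)
        + ∫⁻ x in Ico (0 : ℝ) 1, (ν (Ioc x 1))⁻¹ := by
  obtain ⟨γ, Δ, hγ0, hγ, -, -, rfl⟩ := hν
  have hAc := continuous_rsqPrimitive hα hpos
  refine ⟨lintegral_mono fun x => two_div_le_inv_add (hpos x) _, ?_⟩
  have hm : Measurable fun x => (densityAndAtom γ Δ (Ioc x 1))⁻¹ :=
    (measurable_densityAndAtom_Ioc γ Δ).inv
  rw [lintegral_add_left hm,
    ← setLIntegral_rsqPrimitive hα hpos, add_comm]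
  refine add_le_add_left ?_ _
  rw [setLIntegral_densityAndAtom (aemeasurable_of_monotoneOn hγ) hAc.measurable.ennreal_ofReal,
    setLIntegral_densityAndAtom (aemeasurable_of_monotoneOn hγ) hF.measurable.ennreal_ofReal, h1]
  exact add_le_add_left (lintegral_monotoneOn_mul_le hγ0 hγ hF hAc hF0
    (fun x hx => rsqPrimitive_nonneg hpos hx.1) htail) _

end

end SphericalSpinGlass

/-! ### Tails and the first variation -/

namespace SphericalSpinGlass
open MeasureTheory Set

/-- `α` is the tail `x ↦ ν((x, 1])` of the measure `ν` with density `γ` and atom `Δ` at `1`. -/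
structure IsTail (γ : ℝ → ℝ) (Δ : ℝ) (α : ℝ → ℝ) : Prop where
  integrable : IntervalIntegrable γ volume 0 1
  nonneg : ∀ x ∈ Ico (0 : ℝ) 1, 0 ≤ γ x
  atom_pos : 0 < Δ
  continuous : Continuous α
  eq_integral : ∀ x ∈ Icc (0 : ℝ) 1, α x = Δ + ∫ y in x..1, γ y

namespace IsTail
variable {γ α F : ℝ → ℝ} {Δ : ℝ}

lemma integrableOn (h : IsTail γ Δ α) : IntegrableOn γ (Ioc 0 1) := by
  simpa [intervalIntegrable_iff_integrableOn_Ioc_of_le zero_le_one] using h.integrable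

lemma aemeasurable (h : IsTail γ Δ α) : AEMeasurable γ (volume.restrict (Ico (0 : ℝ) 1)) := by
  rw [Measure.restrict_congr_set Ico_ae_eq_Ioc]
  exact h.integrableOn.aemeasurable

lemma atom_le (h : IsTail γ Δ α) {x : ℝ} (hx : x ∈ Icc (0 : ℝ) 1) : Δ ≤ α x := by
  rw [h.eq_integral x hx, intervalIntegral.integral_of_le hx.2, ← setIntegral_congr_set Ioo_ae_eq_Ioc]
  have : 0 ≤ ∫ y in Ioo x 1, γ y := setIntegral_nonneg measurableSet_Ioo fun y hy =>
    h.nonneg y ⟨hx.1.trans hy.1.le, hy.2⟩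
  linarith

lemma pos (h : IsTail γ Δ α) {x : ℝ} (hx : x ∈ Icc (0 : ℝ) 1) : 0 < α x :=
  h.atom_pos.trans_le (h.atom_le hx)

lemma measure_Ioc (h : IsTail γ Δ α) {x : ℝ} (hx : x ∈ Ico (0 : ℝ) 1) :
    densityAndAtom γ Δ (Ioc x 1) = ENNReal.ofReal (α x) := by
  have hsub : Ioo x 1 ⊆ Ioc 0 1 := fun y hy => ⟨hx.1.trans_lt hy.1, hy.2.le⟩
  have h0 : ∀ y ∈ Ioo x 1, 0 ≤ γ y := fun y hy => h.nonneg y ⟨hx.1.trans hy.1.le, hy.2⟩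
  rw [densityAndAtom_Ioc γ Δ hx, h.eq_integral x (Ico_subset_Icc_self hx),
    intervalIntegral.integral_of_le hx.2.le, ← setIntegral_congr_set Ioo_ae_eq_Ioc, add_comm Δ,
    ENNReal.ofReal_add (setIntegral_nonneg measurableSet_Ioo h0) h.atom_pos.le,
    ofReal_integral_eq_lintegral_ofReal (h.integrableOn.mono_set hsub)]
  filter_upwards [ae_restrict_mem measurableSet_Ioo] with y hy using h0 y hy

lemma setLIntegral_ofReal (h : IsTail γ Δ α) (hF : Continuous F)
    (hF0 : ∀ x ∈ Icc (0 : ℝ) 1, 0 ≤ F x) :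
    ∫⁻ x in Icc (0 : ℝ) 1, ENNReal.ofReal (F x) ∂(densityAndAtom γ Δ)
      = ENNReal.ofReal ((∫ x in (0 : ℝ)..1, γ x * F x) + Δ * F 1) := by
  have hnn : ∀ x ∈ Ico (0 : ℝ) 1, 0 ≤ γ x * F x := fun x hx =>
    mul_nonneg (h.nonneg x hx) (hF0 x (Ico_subset_Icc_self hx))
  have hint : IntegrableOn (fun x => γ x * F x) (Ico 0 1) := by
    rw [integrableOn_congr_set_ae Ico_ae_eq_Ioc]
    exact (h.integrable.mul_continuousOn hF.continuousOn).1
  rw [setLIntegral_densityAndAtom h.aemeasurable hF.measurable.ennreal_ofReal,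
    intervalIntegral.integral_of_le zero_le_one, ← setIntegral_congr_set Ico_ae_eq_Ioc,
    ENNReal.ofReal_add (setIntegral_nonneg measurableSet_Ico hnn)
      (mul_nonneg h.atom_pos.le (hF0 1 (by simp))), ENNReal.ofReal_mul h.atom_pos.le,
    ofReal_integral_eq_lintegral_ofReal hint
      (by filter_upwards [ae_restrict_mem measurableSet_Ico] with y hy using hnn y hy)]
  congr 1
  exact setLIntegral_congr_fun measurableSet_Ico fun x hx =>
    (ENNReal.ofReal_mul (h.nonneg x hx)).symm

lemma continuousOn_inv (h : IsTail γ Δ α) : ContinuousOn (fun x => 1 / α x) (uIcc 0 1) := by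
  rw [uIcc_of_le zero_le_one]
  exact continuousOn_const.div h.continuous.continuousOn fun x hx => (h.pos hx).ne'

lemma crisantiSommers_eq (h : IsTail γ Δ α) {ξ : ℝ → ℝ} (hF : Continuous (deriv ξ))
    (hF0 : ∀ x ∈ Icc (0 : ℝ) 1, 0 ≤ deriv ξ x) :
    crisantiSommers ξ (densityAndAtom γ Δ) = (1 / 2) * ENNReal.ofReal
      ((∫ x in (0 : ℝ)..1, γ x * deriv ξ x) + Δ * deriv ξ 1 + ∫ x in (0 : ℝ)..1, 1 / α x) := by
  have h2 : ∫⁻ x in Ico (0 : ℝ) 1, (densityAndAtom γ Δ (Ioc x 1))⁻¹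
      = ENNReal.ofReal (∫ x in (0 : ℝ)..1, 1 / α x) := by
    have hint : IntegrableOn (fun x => 1 / α x) (Ico 0 1) := by
      rw [integrableOn_congr_set_ae Ico_ae_eq_Ioc]
      exact h.continuousOn_inv.intervalIntegrable.1
    rw [intervalIntegral.integral_of_le zero_le_one, ← setIntegral_congr_set Ico_ae_eq_Ioc,
      ofReal_integral_eq_lintegral_ofReal hint]
    · refine setLIntegral_congr_fun measurableSet_Ico fun x hx => ?_
      rw [h.measure_Ioc hx, one_div, ENNReal.ofReal_inv_of_pos (h.pos (Ico_subset_Icc_self hx))]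
    · filter_upwards [ae_restrict_mem measurableSet_Ico] with x hx
      exact (one_div_pos.2 (h.pos (Ico_subset_Icc_self hx))).le
  have h3 : 0 ≤ ∫ x in (0 : ℝ)..1, 1 / α x := intervalIntegral.integral_nonneg zero_le_one
    fun x hx => (one_div_pos.2 (h.pos hx)).le
  have h4 : 0 ≤ (∫ x in (0 : ℝ)..1, γ x * deriv ξ x) + Δ * deriv ξ 1 := by
    refine add_nonneg ?_ (mul_nonneg h.atom_pos.le (hF0 1 (by simp)))
    rw [intervalIntegral.integral_of_le zero_le_one, ← setIntegral_congr_set Ico_ae_eq_Ioc]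
    exact setIntegral_nonneg measurableSet_Ico fun x hx =>
      mul_nonneg (h.nonneg x hx) (hF0 x (Ico_subset_Icc_self hx))
  rw [crisantiSommers, h2, h.setLIntegral_ofReal hF hF0, ← ENNReal.ofReal_add h4 h3]

/-- First variation of the Crisanti–Sommers functional at a minimizer. -/
lemma first_variation (h : IsTail γ Δ α) {ξ : ℝ → ℝ} (hF : Continuous (deriv ξ))
    (hF0 : ∀ x ∈ Icc (0 : ℝ) 1, 0 ≤ deriv ξ x)
    (hmin : ∀ ν ∈ classK, crisantiSommers ξ (densityAndAtom γ Δ) ≤ crisantiSommers ξ ν)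
    {η b : ℝ → ℝ} {δ ε₀ : ℝ} (hη : IntervalIntegrable η volume 0 1) (hb : Continuous b)
    (hbη : ∀ x ∈ Icc (0 : ℝ) 1, b x = δ + ∫ y in x..1, η y) (hε₀ : 0 < ε₀)
    (hK : ∀ ε, 0 < ε → ε < ε₀ → (∀ x ∈ Ico (0 : ℝ) 1, 0 ≤ γ x + ε * η x) ∧ 0 < Δ + ε * δ ∧
      densityAndAtom (fun x => γ x + ε * η x) (Δ + ε * δ) ∈ classK) :
    ∫ x in (0 : ℝ)..1, b x * (1 / α x ^ 2)
      ≤ (∫ x in (0 : ℝ)..1, η x * deriv ξ x) + δ * deriv ξ 1 := by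
  obtain ⟨B, hB⟩ := isCompact_Icc.exists_bound_of_continuousOn (s := Icc (0 : ℝ) 1) hb.continuousOn
  have hB0 : 0 ≤ B := (norm_nonneg _).trans (hB 0 (by simp))
  set W := (∫ x in (0 : ℝ)..1, η x * deriv ξ x) + δ * deriv ξ 1
    - ∫ x in (0 : ℝ)..1, b x * (1 / α x ^ 2) with hW
  -- This bounds the Taylor remainder `b² / (α² (α + ε b))` of `1/(α + ε b)`, since `α ≥ Δ` and, for
  -- `ε B ≤ Δ/2`, also `α + ε b ≥ Δ/2`.
  set C := B ^ 2 * (2 / Δ ^ 3) with hC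
  have hΔ := h.atom_pos
  have hC0 : 0 ≤ C := by positivity
  have main : ∀ ε, 0 < ε → ε < ε₀ → ε * B ≤ Δ / 2 → 0 ≤ W + ε * C := by
    intro ε hε hεε₀ hεB
    obtain ⟨hnn, hpos, hmem⟩ := hK ε hε hεε₀
    have ht : IsTail (fun x => γ x + ε * η x) (Δ + ε * δ) (fun x => α x + ε * b x) := by
      refine ⟨h.integrable.add (hη.const_mul ε), hnn, hpos,
        h.continuous.add (continuous_const.mul hb), fun x hx => ?_⟩
      have hsub : uIcc x 1 ⊆ uIcc 0 1 := by
        rw [uIcc_of_le hx.2, uIcc_of_le zero_le_one]; exact Icc_subset_Icc_left hx.1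
      rw [intervalIntegral.integral_add (h.integrable.mono_set hsub)
        ((hη.const_mul ε).mono_set hsub), intervalIntegral.integral_const_mul, hbη x hx,
        h.eq_integral x hx]
      ring
    have hle := hmin _ hmem
    rw [h.crisantiSommers_eq hF hF0, ht.crisantiSommers_eq hF hF0,
      ENNReal.mul_le_mul_iff_right (by simp) (by simp), ENNReal.ofReal_le_ofReal_iff] at hle
    swap
    · refine add_nonneg (add_nonneg ?_ (mul_nonneg hpos.le (hF0 1 (by simp)))) ?_
      · rw [intervalIntegral.integral_of_le zero_le_one, ← setIntegral_congr_set Ico_ae_eq_Ioc]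
        exact setIntegral_nonneg measurableSet_Ico fun x hx =>
          mul_nonneg (hnn x hx) (hF0 x (Ico_subset_Icc_self hx))
      · exact intervalIntegral.integral_nonneg zero_le_one
          fun x hx => (one_div_pos.2 (ht.pos hx)).le
    have e1 : ∫ x in (0 : ℝ)..1, (γ x + ε * η x) * deriv ξ x
        = (∫ x in (0 : ℝ)..1, γ x * deriv ξ x) + ε * ∫ x in (0 : ℝ)..1, η x * deriv ξ x := by
      rw [← intervalIntegral.integral_const_mul, ← intervalIntegral.integral_add
        (h.integrable.mul_continuousOn hF.continuousOn)
        ((hη.mul_continuousOn hF.continuousOn).const_mul ε)]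
      exact intervalIntegral.integral_congr fun x _ => by ring
    have hrsq : ContinuousOn (fun x => b x * (1 / α x ^ 2)) (uIcc 0 1) := by
      rw [uIcc_of_le zero_le_one]
      exact hb.continuousOn.mul (continuousOn_const.div (h.continuous.continuousOn.pow 2)
        fun x hx => (pow_pos (h.pos hx) 2).ne')
    have e2 : ∫ x in (0 : ℝ)..1, 1 / (α x + ε * b x)
        ≤ ∫ x in (0 : ℝ)..1, (1 / α x - ε * (b x * (1 / α x ^ 2)) + ε ^ 2 * C) := by
      refine intervalIntegral.integral_mono_on zero_le_one ht.continuousOn_inv.intervalIntegrable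
        (((h.continuousOn_inv.sub (continuousOn_const.mul hrsq)).add
          continuousOn_const).intervalIntegrable) fun x hx => ?_
      have ha := h.pos hx
      have haΔ := h.atom_le hx
      have hbB : |b x| ≤ B := hB x hx
      have hlow : Δ / 2 ≤ α x + ε * b x := by
        have := (abs_le.1 hbB).1
        nlinarith
      have hp : 0 < α x + ε * b x := by linarith
      have e3 : 1 / (α x + ε * b x) - (1 / α x - ε * (b x * (1 / α x ^ 2)))
          = ε ^ 2 * (b x ^ 2 * (1 / (α x ^ 2 * (α x + ε * b x)))) := by
        field_simp; ring
      have e4 : b x ^ 2 * (1 / (α x ^ 2 * (α x + ε * b x))) ≤ C := by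
        refine mul_le_mul (by rw [← sq_abs (b x)]; gcongr) ?_ (by positivity) (by positivity)
        rw [show 2 / Δ ^ 3 = 1 / (Δ ^ 2 * (Δ / 2)) by field_simp]
        refine one_div_le_one_div_of_le (by positivity) ?_
        gcongr
      have := mul_le_mul_of_nonneg_left e4 (sq_nonneg ε)
      linarith
    have e5 : ∫ x in (0 : ℝ)..1, (1 / α x - ε * (b x * (1 / α x ^ 2)) + ε ^ 2 * C)
        = (∫ x in (0 : ℝ)..1, 1 / α x) - ε * (∫ x in (0 : ℝ)..1, b x * (1 / α x ^ 2))
          + ε ^ 2 * C := by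
      rw [intervalIntegral.integral_add (f := fun x => 1 / α x - ε * (b x * (1 / α x ^ 2)))
          (h.continuousOn_inv.sub (continuousOn_const.mul hrsq)).intervalIntegrable
          intervalIntegrable_const,
        intervalIntegral.integral_sub h.continuousOn_inv.intervalIntegrable
          (hrsq.intervalIntegrable.const_mul ε), intervalIntegral.integral_const_mul,
        intervalIntegral.integral_const, sub_zero, one_smul]
    rw [e5] at e2
    rw [e1] at hle
    have : 0 ≤ ε * (W + ε * C) := by
      rw [hW]; linarith
    exact nonneg_of_mul_nonneg_right this hε
  by_contra! hcon
  have hWneg : W < 0 := by rw [hW]; linarith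
  -- The three bounds make the perturbation admissible, keep the perturbed tail above `Δ/2`, and
  -- force `W + ε C < 0`.
  set ε := min (ε₀ / 2) (min (Δ / (2 * (B + 1))) (-W / (2 * (C + 1)))) with hε
  have hεpos : 0 < ε := lt_min (by positivity) (lt_min (by positivity)
    (div_pos (by linarith) (by positivity)))
  have h1 : ε ≤ ε₀ / 2 := min_le_left _ _
  have h2 : ε ≤ Δ / (2 * (B + 1)) := (min_le_right _ _).trans (min_le_left _ _)
  have h3 : ε ≤ -W / (2 * (C + 1)) := (min_le_right _ _).trans (min_le_right _ _)
  rw [le_div_iff₀ (by positivity)] at h2 h3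
  have := main ε hεpos (by linarith) (by nlinarith)
  nlinarith

end IsTail

/-! ### Measures with finitely many steps -/

/-- The step function with value `m l` on `[q l, q (l + 1))`, `l < n`. -/
noncomputable def stepDensity (n : ℕ) (q m : ℕ → ℝ) (x : ℝ) : ℝ :=
  ∑ l ∈ Finset.range n, (Ico (q l) (q (l + 1))).indicator (fun _ => m l) x

/-- The tail of the measure with density `stepDensity n q m` and an atom `Δ` at `1`. -/
noncomputable def stepTail (n : ℕ) (q m : ℕ → ℝ) (Δ x : ℝ) : ℝ :=
  Δ + ∑ l ∈ Finset.range n, m l * (max (q (l + 1)) x - max (q l) x)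

/-- The data of a measure with `n` steps. -/
structure IsStepData (n : ℕ) (q m : ℕ → ℝ) (Δ : ℝ) : Prop where
  zero : q 0 = 0
  last : q n = 1
  lt : ∀ l < n, q l < q (l + 1)
  pos : ∀ l < n, 0 < m l
  slope_lt : ∀ l, l + 1 < n → m l < m (l + 1)
  atom_pos : 0 < Δ

lemma integral_indicator_Ico {x a b : ℝ} (c : ℝ) (hx : x ≤ 1) (hab : a ≤ b) (hb : b ≤ 1) :
    ∫ y in x..1, (Ico a b).indicator (fun _ => c) y = c * (max b x - max a x) := by
  rw [intervalIntegral.integral_of_le hx, ← setIntegral_congr_set Ico_ae_eq_Ioc,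
    setIntegral_indicator measurableSet_Ico, Ico_inter_Ico, setIntegral_const, smul_eq_mul,
    mul_comm, Measure.real, Real.volume_Ico, min_eq_right hb, max_comm x a]
  congr 1
  rcases le_total b x with h | h
  · rw [max_eq_right h, max_eq_right (hab.trans h),
      ENNReal.ofReal_of_nonpos (by linarith)]
    simp
  · rw [max_eq_left h, ENNReal.toReal_ofReal (sub_nonneg.2 (max_le hab h))]

lemma intervalIntegrable_indicator_Ico (a b c : ℝ) :
    IntervalIntegrable ((Ico a b).indicator fun _ => c) volume 0 1 := by
  rw [intervalIntegrable_iff]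
  exact IntegrableOn.indicator (by simp) measurableSet_Ico

lemma continuousWithinAt_indicator_Ico (a b c x : ℝ) :
    ContinuousWithinAt ((Ico a b).indicator fun _ => c) (Ici x) x := by
  rcases lt_or_ge x a with h | h
  · refine ContinuousAt.continuousWithinAt ?_
    refine (continuousAt_const (y := (0 : ℝ))).congr ?_
    filter_upwards [Iio_mem_nhds h] with y hy
    rw [indicator_of_notMem fun hy' => (not_le.2 hy) hy'.1]
  · rcases lt_or_ge x b with h' | h'
    · have : (Ico a b).indicator (fun _ => c) =ᶠ[nhdsWithin x (Ici x)] fun _ => c := by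
        filter_upwards [self_mem_nhdsWithin, mem_nhdsWithin_of_mem_nhds (Iio_mem_nhds h')]
          with y hy hy'
        exact indicator_of_mem (mem_Ico.2 ⟨h.trans hy, hy'⟩) _
      exact continuousWithinAt_const.congr_of_eventuallyEq this
        (indicator_of_mem (mem_Ico.2 ⟨h, h'⟩) _)
    · have : (Ico a b).indicator (fun _ => c) =ᶠ[nhdsWithin x (Ici x)] fun _ => 0 := by
        filter_upwards [self_mem_nhdsWithin] with y hy
        exact indicator_of_notMem (fun hy' => (not_lt.2 (h'.trans hy)) hy'.2) _
      exact continuousWithinAt_const.congr_of_eventuallyEq this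
        (indicator_of_notMem (fun hy' => (not_lt.2 h') hy'.2) _)

namespace IsStepData
variable {n : ℕ} {q m : ℕ → ℝ} {Δ : ℝ}

lemma mono (h : IsStepData n q m Δ) {i j : ℕ} (hij : i ≤ j) (hj : j ≤ n) : q i ≤ q j := by
  induction j, hij using Nat.le_induction with
  | base => exact le_rfl
  | succ j hij ih => exact (ih (by omega)).trans (h.lt j (by omega)).le

lemma nonneg (h : IsStepData n q m Δ) {l : ℕ} (hl : l ≤ n) : 0 ≤ q l :=
  h.zero ▸ h.mono (Nat.zero_le l) hl

lemma le_one (h : IsStepData n q m Δ) {l : ℕ} (hl : l ≤ n) : q l ≤ 1 :=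
  h.last ▸ h.mono hl le_rfl

lemma slope_mono (h : IsStepData n q m Δ) {i j : ℕ} (hij : i ≤ j) (hj : j < n) : m i ≤ m j := by
  induction j, hij using Nat.le_induction with
  | base => exact le_rfl
  | succ j hij ih => exact (ih (by omega)).trans (h.slope_lt j (by omega)).le

lemma density_eq (h : IsStepData n q m Δ) {l : ℕ} (hl : l < n) {x : ℝ}
    (hx : x ∈ Ico (q l) (q (l + 1))) : stepDensity n q m x = m l := by
  rw [stepDensity, Finset.sum_eq_single_of_mem l (Finset.mem_range.2 hl), indicator_of_mem hx]
  intro j hj hjl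
  refine indicator_of_notMem (fun hxj => ?_) _
  have hj' := Finset.mem_range.1 hj
  rcases lt_or_gt_of_ne hjl with h' | h'
  · have := h.mono (i := j + 1) (j := l) h' hl.le
    linarith [hxj.2, hx.1]
  · have := h.mono (i := l + 1) (j := j) h' hj'.le
    linarith [hxj.1, hx.2]

lemma exists_piece (h : IsStepData n q m Δ) {x : ℝ} (hx : x ∈ Ico (0 : ℝ) 1) :
    ∃ l < n, x ∈ Ico (q l) (q (l + 1)) := by
  have key : ∀ k ≤ n, x < q k → ∃ l < n, x ∈ Ico (q l) (q (l + 1)) := by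
    intro k
    induction k with
    | zero => intro _ h0; rw [h.zero] at h0; linarith [hx.1]
    | succ k ih =>
      intro hk hxk
      rcases lt_or_ge x (q k) with h' | h'
      · exact ih (by omega) h'
      · exact ⟨k, hk, h', hxk⟩
  exact key n le_rfl (h.last ▸ hx.2)

lemma density_pos (h : IsStepData n q m Δ) {x : ℝ} (hx : x ∈ Ico (0 : ℝ) 1) :
    0 < stepDensity n q m x := by
  obtain ⟨l, hl, hxl⟩ := h.exists_piece hx
  rw [h.density_eq hl hxl]
  exact h.pos l hl

lemma piece_le (h : IsStepData n q m Δ) {i j : ℕ} (hi : i < n) {x y : ℝ}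
    (hx : x ∈ Ico (q i) (q (i + 1))) (hy : y ∈ Ico (q j) (q (j + 1))) (hxy : x ≤ y) : i ≤ j := by
  by_contra! hlt
  have := h.mono (i := j + 1) (j := i) hlt hi.le
  linarith [hx.1, hy.2]

lemma density_monotoneOn (h : IsStepData n q m Δ) :
    MonotoneOn (stepDensity n q m) (Ico 0 1) := by
  intro x hx y hy hxy
  obtain ⟨i, hi, hxi⟩ := h.exists_piece hx
  obtain ⟨j, hj, hyj⟩ := h.exists_piece hy
  rw [h.density_eq hi hxi, h.density_eq hj hyj]
  exact h.slope_mono (h.piece_le hi hxi hyj hxy) hj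

lemma density_continuousWithinAt (n : ℕ) (q m : ℕ → ℝ) (x : ℝ) :
    ContinuousWithinAt (stepDensity n q m) (Ici x) x := by
  unfold stepDensity
  exact tendsto_finsetSum _ fun l _ => continuousWithinAt_indicator_Ico _ _ _ _

lemma mem_classK (h : IsStepData n q m Δ) : densityAndAtom (stepDensity n q m) Δ ∈ classK :=
  ⟨_, Δ, fun _ hx => (h.density_pos hx).le, h.density_monotoneOn,
    fun x _ => density_continuousWithinAt n q m x, h.atom_pos, rfl⟩

lemma isTail (h : IsStepData n q m Δ) : IsTail (stepDensity n q m) Δ (stepTail n q m Δ) := by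
  refine ⟨?_, fun _ hx => (h.density_pos hx).le, h.atom_pos, ?_, fun x hx => ?_⟩
  · have : stepDensity n q m = ∑ l ∈ Finset.range n, (Ico (q l) (q (l + 1))).indicator
        (fun _ => m l) := by ext x; simp [stepDensity]
    rw [this]
    exact IntervalIntegrable.sum _ fun l _ => intervalIntegrable_indicator_Ico _ _ _
  · unfold stepTail; fun_prop
  · have hsub : uIcc x 1 ⊆ uIcc 0 1 := by
      rw [uIcc_of_le hx.2, uIcc_of_le zero_le_one]; exact Icc_subset_Icc_left hx.1
    unfold stepTail stepDensity
    rw [intervalIntegral.integral_finsetSum fun l _ =>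
      (intervalIntegrable_indicator_Ico _ _ _).mono_set hsub]
    congr 1
    refine Finset.sum_congr rfl fun l hl => ?_
    have hl' := Finset.mem_range.1 hl
    rw [integral_indicator_Ico _ hx.2 (h.lt l hl').le (h.le_one hl')]

/-- The differences of maxima are nonnegative for every real `x`. Thus the tail extends positively
to the whole line, and `1/α²` is continuous there. -/
lemma atom_le_tail (h : IsStepData n q m Δ) (x : ℝ) : Δ ≤ stepTail n q m Δ x := by
  refine le_add_of_nonneg_right (Finset.sum_nonneg fun l hl => ?_)
  have hl' := Finset.mem_range.1 hl
  exact mul_nonneg (h.pos l hl').le (sub_nonneg.2 (max_le_max_right x (h.lt l hl').le))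

lemma tail_pos (h : IsStepData n q m Δ) (x : ℝ) : 0 < stepTail n q m Δ x :=
  h.atom_pos.trans_le (h.atom_le_tail x)

lemma tail_one (h : IsStepData n q m Δ) : stepTail n q m Δ 1 = Δ := by
  rw [h.isTail.eq_integral 1 (by simp)]; simp

lemma tail_linear (h : IsStepData n q m Δ) {l : ℕ} (hl : l < n) {x : ℝ}
    (hx : x ∈ Icc (q l) (q (l + 1))) :
    stepTail n q m Δ x = stepTail n q m Δ (q (l + 1)) + m l * (q (l + 1) - x) := by
  unfold stepTail
  rw [add_assoc, ← Finset.sum_erase_add _ _ (Finset.mem_range.2 hl),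
    ← Finset.sum_erase_add (Finset.range n) _ (Finset.mem_range.2 hl), add_assoc]
  congr 2
  · refine Finset.sum_congr rfl fun j hj => ?_
    have hj' := Finset.mem_range.1 (Finset.mem_of_mem_erase hj)
    rcases lt_or_gt_of_ne (Finset.ne_of_mem_erase hj) with h' | h'
    · have h1 := h.mono (i := j + 1) (j := l) h' hl.le
      have h2 := h.lt j hj'
      have h3 := h.lt l hl
      rw [max_eq_right (h1.trans hx.1), max_eq_right ((h2.le.trans h1).trans hx.1),
        max_eq_right (h1.trans h3.le), max_eq_right ((h2.le.trans h1).trans h3.le)]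
      ring
    · have h1 := h.mono (i := l + 1) (j := j) h' hj'.le
      have h2 := h.lt j hj'
      rw [max_eq_left (hx.2.trans (h1.trans h2.le)), max_eq_left (hx.2.trans h1),
        max_eq_left (h1.trans h2.le), max_eq_left h1]
  · rw [max_eq_left hx.2, max_eq_right hx.1, max_self, max_eq_right (h.lt l hl).le]
    ring

end IsStepData

end SphericalSpinGlass

/-! ### Stationary data: recovery from the tail, and sufficiency -/

namespace SphericalSpinGlass
open MeasureTheory Set Polynomial

namespace IsStepData
variable {n : ℕ} {q m : ℕ → ℝ} {Δ : ℝ}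

/-- Two step data with the same tail coincide. -/
lemma eq_of_tail_eq {q' m' : ℕ → ℝ} {Δ' : ℝ} (h : IsStepData n q m Δ)
    (h' : IsStepData n q' m' Δ')
    (heq : ∀ x ∈ Icc (0 : ℝ) 1, stepTail n q m Δ x = stepTail n q' m' Δ' x) :
    (∀ l ≤ n, q l = q' l) ∧ Δ = Δ' := by
  -- The two tails are affine and equal on a common interval to the right of `x`, so their slopes
  -- agree.
  have hγ : ∀ x ∈ Ico (0 : ℝ) 1, stepDensity n q m x = stepDensity n q' m' x := by
    intro x hx
    obtain ⟨i, hi, hxi⟩ := h.exists_piece hx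
    obtain ⟨j, hj, hxj⟩ := h'.exists_piece hx
    rw [h.density_eq hi hxi, h'.density_eq hj hxj]
    set y := min (q (i + 1)) (q' (j + 1)) with hy
    have hxy : x < y := lt_min hxi.2 hxj.2
    have hy1 : y ≤ q (i + 1) := min_le_left _ _
    have hy2 : y ≤ q' (j + 1) := min_le_right _ _
    have hy3 : y ∈ Icc (0 : ℝ) 1 := ⟨hx.1.trans hxy.le, hy1.trans (h.le_one hi)⟩
    have e1 := h.tail_linear hi ⟨hxi.1, hxi.2.le⟩
    have e2 := h.tail_linear hi ⟨hxi.1.trans hxy.le, hy1⟩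
    have e3 := h'.tail_linear hj ⟨hxj.1, hxj.2.le⟩
    have e4 := h'.tail_linear hj ⟨hxj.1.trans hxy.le, hy2⟩
    have e5 := heq x (Ico_subset_Icc_self hx)
    have e6 := heq y hy3
    have : (m i - m' j) * (y - x) = 0 := by linarith
    rcases mul_eq_zero.1 this with h0 | h0
    · linarith
    · linarith
  have hrange : ∀ {q m : ℕ → ℝ} {Δ : ℝ}, IsStepData n q m Δ →
      range (fun i : Fin n => m i) = stepDensity n q m '' Ico 0 1 := by
    intro q m Δ h
    ext y
    constructor
    · rintro ⟨i, rfl⟩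
      have hi : q i ∈ Ico (q i) (q (i + 1)) := ⟨le_rfl, h.lt i i.2⟩
      exact ⟨q i, ⟨h.nonneg i.2.le, hi.2.trans_le (h.le_one i.2)⟩, h.density_eq i.2 hi⟩
    · rintro ⟨x, hx, rfl⟩
      obtain ⟨i, hi, hxi⟩ := h.exists_piece hx
      exact ⟨⟨i, hi⟩, (h.density_eq hi hxi).symm⟩
  have hmono : ∀ {q m : ℕ → ℝ} {Δ : ℝ}, IsStepData n q m Δ →
      StrictMono (fun i : Fin n => m i) := by
    intro q m Δ h i j hij
    exact (h.slope_lt i (by omega)).trans_le (h.slope_mono (Nat.succ_le_of_lt hij) j.2)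
  -- Both sequences enumerate, in strictly increasing order, the set of values of the same density.
  have hm : (fun i : Fin n => m i) = fun i : Fin n => m' i := by
    refine ((hmono h).range_inj (hmono h')).1 ?_
    rw [hrange h, hrange h']
    exact image_congr hγ
  -- The value of the density at `q l` is `m l`; since the slopes are distinct, `q l` lies in the
  -- piece of the same index for the other data. Exchanging the data gives the reverse inequality.
  have hle : ∀ {q m q' m' : ℕ → ℝ} {Δ Δ' : ℝ}, IsStepData n q m Δ → IsStepData n q' m' Δ' →
      (∀ x ∈ Ico (0 : ℝ) 1, stepDensity n q m x = stepDensity n q' m' x) →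
      ((fun i : Fin n => m i) = fun i : Fin n => m' i) → ∀ l < n, q' l ≤ q l := by
    intro q m q' m' Δ Δ' h h' hγ hm l hl
    have hi : q l ∈ Ico (q l) (q (l + 1)) := ⟨le_rfl, h.lt l hl⟩
    have hx : q l ∈ Ico (0 : ℝ) 1 := ⟨h.nonneg hl.le, hi.2.trans_le (h.le_one hl)⟩
    obtain ⟨j, hj, hxj⟩ := h'.exists_piece hx
    have e := hγ _ hx
    rw [h.density_eq hl hi, h'.density_eq hj hxj] at e
    have e' : (fun i : Fin n => m i) ⟨l, hl⟩ = (fun i : Fin n => m i) ⟨j, hj⟩ := by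
      rw [show (fun i : Fin n => m i) ⟨j, hj⟩ = m' j from congrFun hm ⟨j, hj⟩]; exact e
    have : l = j := congrArg Fin.val ((hmono h).injective e')
    rw [this] at hxj ⊢
    exact hxj.1
  refine ⟨fun l hl => ?_, ?_⟩
  · rcases hl.eq_or_lt with rfl | hl
    · rw [h.last, h'.last]
    · exact le_antisymm (hle h' h (fun x hx => (hγ x hx).symm) hm.symm l hl)
        (hle h h' hγ hm l hl)
  · have := heq 1 (by simp)
    rwa [h.tail_one, h'.tail_one] at this

end IsStepData

/-- A mixture without constant, linear and quadratic terms, as a polynomial. -/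
structure IsMixturePoly (P : ℝ[X]) : Prop where
  coeff_nonneg : ∀ k, 0 ≤ P.coeff k
  coeff_eq_zero : ∀ k < 3, P.coeff k = 0
  ne_zero : P ≠ 0

namespace IsMixturePoly
variable {P : ℝ[X]}

lemma deriv_coeff_nonneg (hP : IsMixturePoly P) : ∀ k, 0 ≤ (derivative P).coeff k :=
  coeff_derivative_nonneg hP.coeff_nonneg

lemma deriv2_coeff_nonneg (hP : IsMixturePoly P) :
    ∀ k, 0 ≤ (derivative (derivative P)).coeff k :=
  coeff_derivative_nonneg hP.deriv_coeff_nonneg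

lemma three_le_natDegree (hP : IsMixturePoly P) : 3 ≤ P.natDegree := by
  by_contra! h
  exact leadingCoeff_ne_zero.2 hP.ne_zero (hP.coeff_eq_zero _ h)

lemma deriv2_ne_zero (hP : IsMixturePoly P) : derivative (derivative P) ≠ 0 := by
  intro h
  have h1 := derivative_eq_zero.1 h
  rw [natDegree_derivative] at h1
  have := hP.three_le_natDegree
  omega

lemma deriv_eval_zero (hP : IsMixturePoly P) : (derivative P).eval 0 = 0 := by
  rw [← coeff_zero_eq_eval_zero, coeff_derivative, hP.coeff_eq_zero _ (by norm_num)]; simp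

lemma deriv2_coeff_zero (hP : IsMixturePoly P) : (derivative (derivative P)).coeff 0 = 0 := by
  rw [coeff_derivative, coeff_derivative, hP.coeff_eq_zero _ (by norm_num)]; simp

lemma deriv2_eval_pos (hP : IsMixturePoly P) {x : ℝ} (hx : 0 < x) :
    0 < (derivative (derivative P)).eval x :=
  eval_pos_of_coeff_nonneg hP.deriv2_coeff_nonneg hP.deriv2_ne_zero hx

end IsMixturePoly

lemma deriv_eval_poly (P : ℝ[X]) :
    deriv (fun x => P.eval x) = fun x => (derivative P).eval x :=
  funext fun x => (P.hasDerivAt x).deriv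

/-- The function `ξ' - ∫₀ dx / ν((x, 1])²` of step data. -/
noncomputable def stepGap (P : ℝ[X]) (n : ℕ) (q m : ℕ → ℝ) (Δ x : ℝ) : ℝ :=
  (derivative P).eval x - rsqPrimitive (stepTail n q m Δ) x

/-- The stationarity and stability conditions at the atoms of step data. -/
structure IsStationary (P : ℝ[X]) (n : ℕ) (q m : ℕ → ℝ) (Δ : ℝ) : Prop where
  gap_eq_zero : ∀ l ≤ n, stepGap P n q m Δ (q l) = 0
  integral_gap : ∀ l < n, ∫ x in q l..q (l + 1), stepGap P n q m Δ x = 0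
  stable : ∀ l ≤ n, (derivative (derivative P)).eval (q l) ≤ 1 / stepTail n q m Δ (q l) ^ 2

section
variable {P : ℝ[X]} {n : ℕ} {q m : ℕ → ℝ} {Δ : ℝ}

lemma IsStepData.hasDerivAt_gap (h : IsStepData n q m Δ) (P : ℝ[X]) (x : ℝ) :
    HasDerivAt (stepGap P n q m Δ)
      ((derivative (derivative P)).eval x - 1 / stepTail n q m Δ x ^ 2) x :=
  ((derivative P).hasDerivAt x).sub (hasDerivAt_rsqPrimitive h.isTail.continuous h.tail_pos x)

lemma IsStepData.continuous_gap (h : IsStepData n q m Δ) (P : ℝ[X]) :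
    Continuous (stepGap P n q m Δ) :=
  continuous_iff_continuousAt.2 fun x => (h.hasDerivAt_gap P x).continuousAt

lemma IsStationary.integral_gap_to_one (hs : IsStationary P n q m Δ) (h : IsStepData n q m Δ)
    {l : ℕ} (hl : l ≤ n) : ∫ x in q l..1, stepGap P n q m Δ x = 0 := by
  induction hl using Nat.decreasingInduction with
  | self => rw [h.last]; simp
  | of_succ l hl ih =>
    rw [← intervalIntegral.integral_add_adjacent_intervals
      ((h.continuous_gap P).intervalIntegrable _ (q (l + 1)))
      ((h.continuous_gap P).intervalIntegrable _ _), hs.integral_gap l hl, ih, add_zero]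

/-- The density is constant on pieces, where the gap integrates to zero. This is complementary
slackness: replacing `ξ'` by the primitive of `1/α²` does not change the linear term at the data
themselves. -/
lemma IsStationary.integral_density_mul_gap (hs : IsStationary P n q m Δ)
    (h : IsStepData n q m Δ) :
    ∫ x in (0 : ℝ)..1, stepDensity n q m x * stepGap P n q m Δ x = 0 := by
  have hint := h.isTail.integrable.mul_continuousOn (h.continuous_gap P).continuousOn
  have key : ∀ l ≤ n, ∫ x in q l..1, stepDensity n q m x * stepGap P n q m Δ x = 0 := by
    intro l hl
    induction hl using Nat.decreasingInduction with
    | self => rw [h.last]; simp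
    | of_succ l hl ih =>
      have hsub : ∀ a b, a ∈ Icc (0 : ℝ) 1 → b ∈ Icc (0 : ℝ) 1 → uIcc a b ⊆ uIcc 0 1 := by
        intro a b ha hb
        rw [uIcc_of_le zero_le_one]
        exact uIcc_subset_Icc ha hb
      have m1 : q l ∈ Icc (0 : ℝ) 1 := ⟨h.nonneg hl.le, h.le_one hl.le⟩
      have m2 : q (l + 1) ∈ Icc (0 : ℝ) 1 := ⟨h.nonneg hl, h.le_one hl⟩
      rw [← intervalIntegral.integral_add_adjacent_intervals
        (hint.mono_set (hsub _ (q (l + 1)) m1 m2)) (hint.mono_set (hsub _ _ m2 (by simp))),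
        ih, add_zero, intervalIntegral.integral_of_le (h.lt l hl).le,
        ← setIntegral_congr_set Ico_ae_eq_Ioc,
        setIntegral_congr_fun (g := fun x => m l * stepGap P n q m Δ x) measurableSet_Ico
          (fun x hx => by simp only [h.density_eq hl hx]),
        setIntegral_congr_set Ico_ae_eq_Ioc, ← intervalIntegral.integral_of_le (h.lt l hl).le,
        intervalIntegral.integral_const_mul, hs.integral_gap l hl, mul_zero]
  have := key 0 (Nat.zero_le n)
  rwa [h.zero] at this

/-- Sufficiency: stationary step data of a mixture with at most `n` components give a minimizer,
and the tail of any minimizer agrees with the tail of the step data. -/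
theorem IsStationary.isParisiMeasure (hP : IsMixturePoly P)
    (hcard : (derivative (derivative P)).support.card ≤ n) (h : IsStepData n q m Δ)
    (hs : IsStationary P n q m Δ) :
    IsParisiMeasure (fun x => P.eval x) (densityAndAtom (stepDensity n q m) Δ) ∧
    ∀ ν, IsParisiMeasure (fun x => P.eval x) ν →
      ∀ᵐ x ∂(volume.restrict (Ico (0 : ℝ) 1)), ν (Ioc x 1) = ENNReal.ofReal (stepTail n q m Δ x) := by
  set α := stepTail n q m Δ with hαdef
  have hα : Continuous α := h.isTail.continuous
  have hpos : ∀ x, 0 < α x := h.tail_pos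
  have hF : Continuous (deriv fun x => P.eval x) := by
    rw [deriv_eval_poly]; exact (derivative P).continuous
  have hF0 : ∀ x ∈ Icc (0 : ℝ) 1, 0 ≤ deriv (fun x => P.eval x) x := fun x hx => by
    rw [deriv_eval_poly]; exact eval_nonneg_of_coeff_nonneg hP.deriv_coeff_nonneg hx.1
  have hA := continuous_rsqPrimitive hα hpos
  have hgap : ∀ x, stepGap P n q m Δ x = deriv (fun x => P.eval x) x - rsqPrimitive α x :=
    fun x => by rw [deriv_eval_poly, stepGap]
  have hG := overlap_nonneg (derivative (derivative P)) hP.deriv2_coeff_nonneg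
    hP.deriv2_coeff_zero hP.deriv2_ne_zero hcard hα hpos h.zero h.lt
    (fun l hl => (h.slope_lt l hl).le) (fun l hl x hx => h.tail_linear hl hx)
    (h.hasDerivAt_gap P) hs.gap_eq_zero hs.integral_gap hs.stable
  have hgc := h.continuous_gap P
  have htail : ∀ u ∈ Icc (0 : ℝ) 1,
      ∫ x in u..1, rsqPrimitive α x ≤ ∫ x in u..1, deriv (fun x => P.eval x) x := by
    intro u hu
    have hnn : 0 ≤ ∫ x in u..1, stepGap P n q m Δ x := by
      rcases hu.2.eq_or_lt with rfl | hu1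
      · simp
      · obtain ⟨l, hl, hul⟩ := h.exists_piece ⟨hu.1, hu1⟩
        rw [← intervalIntegral.integral_add_adjacent_intervals
          (hgc.intervalIntegrable _ (q (l + 1))) (hgc.intervalIntegrable _ _),
          hs.integral_gap_to_one h hl, add_zero]
        exact hG l hl u ⟨hul.1, hul.2.le⟩
    simp_rw [hgap] at hnn
    rw [intervalIntegral.integral_sub (hF.intervalIntegrable _ _)
      (hA.intervalIntegrable _ _)] at hnn
    linarith
  have h1 : deriv (fun x => P.eval x) 1 = rsqPrimitive α 1 := by
    have := hs.gap_eq_zero n le_rfl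
    rw [h.last, hgap] at this
    linarith
  -- The step data attain the dual bound, because `1/α + α · (1/α²) = 2/α`.
  have hval : (∫⁻ x in Icc (0 : ℝ) 1, ENNReal.ofReal (deriv (fun x => P.eval x) x)
        ∂(densityAndAtom (stepDensity n q m) Δ))
      + ∫⁻ x in Ico (0 : ℝ) 1, (densityAndAtom (stepDensity n q m) Δ (Ioc x 1))⁻¹
      = ∫⁻ x in Ico (0 : ℝ) 1, ENNReal.ofReal (2 / α x) := by
    have hFA : ∫ x in (0 : ℝ)..1, stepDensity n q m x * deriv (fun x => P.eval x) x
        = ∫ x in (0 : ℝ)..1, stepDensity n q m x * rsqPrimitive α x := by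
      have h0 := hs.integral_density_mul_gap h
      simp_rw [hgap, mul_sub] at h0
      rw [intervalIntegral.integral_sub (h.isTail.integrable.mul_continuousOn hF.continuousOn)
        (h.isTail.integrable.mul_continuousOn hA.continuousOn)] at h0
      linarith
    have hm : Measurable fun x => (densityAndAtom (stepDensity n q m) Δ (Ioc x 1))⁻¹ :=
      (measurable_densityAndAtom_Ioc _ _).inv
    rw [h.isTail.setLIntegral_ofReal hF hF0, hFA, h1,
      ← h.isTail.setLIntegral_ofReal hA (fun x hx => rsqPrimitive_nonneg hpos hx.1),
      setLIntegral_rsqPrimitive hα hpos, add_comm, ← lintegral_add_left hm]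
    refine setLIntegral_congr_fun measurableSet_Ico fun x hx => ?_
    have hx' := hpos x
    rw [h.isTail.measure_Ioc hx, ← hαdef, ← ENNReal.ofReal_inv_of_pos hx',
      ← ENNReal.ofReal_mul hx'.le, ← ENNReal.ofReal_add (by positivity) (by positivity)]
    congr 1
    field_simp
    norm_num
  refine ⟨⟨h.mem_classK, fun ν hν => ?_⟩, fun ν hν => ?_⟩
  · obtain ⟨h2, h3⟩ := lintegral_two_div_le hα hpos hF hF0 h1 htail hν
    unfold crisantiSommers
    rw [hval]
    gcongr
    exact h2.trans h3
  · obtain ⟨h2, h3⟩ := lintegral_two_div_le hα hpos hF hF0 h1 htail hν.1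
    have h4 := hν.2 _ h.mem_classK
    unfold crisantiSommers at h4
    rw [hval, ENNReal.mul_le_mul_iff_right (by simp) (by simp)] at h4
    have hfin : ∫⁻ x in Ico (0 : ℝ) 1, ENNReal.ofReal (2 / α x) ≠ ⊤ := by
      have hc : Continuous fun x => 2 / α x := continuous_const.div hα fun x => (hpos x).ne'
      have hint : IntegrableOn (fun x => 2 / α x) (Ico 0 1) :=
        (hc.integrableOn_Icc).mono_set Ico_subset_Icc_self
      exact hint.lintegral_lt_top.ne
    obtain ⟨γ, δ, hγ0, hγ, hγc, hδ, rfl⟩ := hν.1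
    -- For another minimizer the pointwise tangent-line inequality integrates to an equality with
    -- finite value, so it is an equality almost everywhere.
    have hae := ae_eq_of_ae_le_of_lintegral_le (Filter.Eventually.of_forall fun x =>
      two_div_le_inv_add (hpos x) (densityAndAtom γ δ (Ioc x 1))) hfin
      ((measurable_densityAndAtom_Ioc γ δ).inv.add ((measurable_densityAndAtom_Ioc γ δ).mul
        (continuous_rsq hα hpos).measurable.ennreal_ofReal)).aemeasurable (h3.trans h4)
    filter_upwards [hae] with x hx using eq_ofReal_of_inv_add_eq (hpos x) hx

/-- The Parisi measure determines its step data. -/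
lemma IsStationary.eq_of_isParisiMeasure (hP : IsMixturePoly P)
    (hcard : (derivative (derivative P)).support.card ≤ n) (h : IsStepData n q m Δ)
    (hs : IsStationary P n q m Δ) {q' m' : ℕ → ℝ} {Δ' : ℝ} (h' : IsStepData n q' m' Δ')
    (hν : IsParisiMeasure (fun x => P.eval x) (densityAndAtom (stepDensity n q' m') Δ')) :
    ∀ x ∈ Icc (0 : ℝ) 1, stepTail n q m Δ x = stepTail n q' m' Δ' x := by
  have hae := (hs.isParisiMeasure hP hcard h).2 _ hν
  refine Measure.eqOn_Icc_of_ae_eq volume zero_ne_one ?_ h.isTail.continuous.continuousOn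
    h'.isTail.continuous.continuousOn
  rw [← Measure.restrict_congr_set Ico_ae_eq_Icc]
  filter_upwards [hae, ae_restrict_mem measurableSet_Ico] with x hx hx'
  rw [h'.isTail.measure_Ioc hx',
    ENNReal.ofReal_eq_ofReal_iff (h'.tail_pos x).le (h.tail_pos x).le] at hx
  exact hx.symm

end

end SphericalSpinGlass

/-! ### Necessity of stationarity -/

namespace SphericalSpinGlass
open MeasureTheory Set Polynomial

lemma integral_indicator_Ico_mul {u : ℝ} (hu : u ∈ Ico (0 : ℝ) 1) (c : ℝ) (F : ℝ → ℝ) :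
    ∫ x in (0 : ℝ)..1, (Ico u 1).indicator (fun _ => c) x * F x = c * ∫ x in u..1, F x := by
  have h1 : ∀ x, (Ico u 1).indicator (fun _ => c) x * F x
      = (Ico u 1).indicator (fun x => c * F x) x := fun x => by
    by_cases hx : x ∈ Ico u 1 <;> simp [hx]
  simp_rw [h1]
  rw [intervalIntegral.integral_of_le zero_le_one, ← setIntegral_congr_set Ico_ae_eq_Ioc,
    setIntegral_indicator measurableSet_Ico,
    inter_eq_right.2 (Ico_subset_Ico_left hu.1), setIntegral_congr_set Ico_ae_eq_Ioc,
    ← intervalIntegral.integral_of_le hu.2.le, intervalIntegral.integral_const_mul]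

/-- Integration by parts for the tail of an indicator. -/
lemma integral_one_sub_max_mul {α : ℝ → ℝ} (hα : Continuous α) (hpos : ∀ x, 0 < α x) {u : ℝ}
    (hu : u ∈ Ico (0 : ℝ) 1) :
    ∫ x in (0 : ℝ)..1, (1 - max u x) * (1 / α x ^ 2) = ∫ x in u..1, rsqPrimitive α x := by
  have hA := continuous_rsqPrimitive hα hpos
  have hrsq := continuous_rsq hα hpos
  have hc : Continuous fun x => (1 - max u x) * (1 / α x ^ 2) := by fun_prop
  rw [← intervalIntegral.integral_add_adjacent_intervals (hc.intervalIntegrable 0 u)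
    (hc.intervalIntegrable u 1)]
  have e1 : ∫ x in (0 : ℝ)..u, (1 - max u x) * (1 / α x ^ 2) = (1 - u) * rsqPrimitive α u := by
    rw [rsqPrimitive, ← intervalIntegral.integral_const_mul]
    refine intervalIntegral.integral_congr fun x hx => ?_
    rw [uIcc_of_le hu.1] at hx
    rw [max_eq_left hx.2]
  have e2 : ∫ x in u..1, (1 - max u x) * (1 / α x ^ 2)
      = ∫ x in u..1, ((1 - x) * (1 / α x ^ 2) - rsqPrimitive α x + rsqPrimitive α x) := by
    refine intervalIntegral.integral_congr fun x hx => ?_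
    rw [uIcc_of_le hu.2.le] at hx
    rw [max_eq_right hx.1]
    ring
  have hd : ∀ x ∈ uIcc u 1, HasDerivAt (fun x => (1 - x) * rsqPrimitive α x)
      ((1 - x) * (1 / α x ^ 2) - rsqPrimitive α x) x := by
    intro x _
    refine (((hasDerivAt_id x).const_sub 1).mul (hasDerivAt_rsqPrimitive hα hpos x)).congr_deriv ?_
    simp only [id]
    ring
  have hc2 : Continuous fun x => (1 - x) * (1 / α x ^ 2) - rsqPrimitive α x := by fun_prop
  rw [e1, e2, intervalIntegral.integral_add (hc2.intervalIntegrable _ _)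
    (hA.intervalIntegrable _ _), intervalIntegral.integral_eq_sub_of_hasDerivAt hd
    (hc2.intervalIntegrable _ _)]
  ring

section
variable {P : ℝ[X]} {n : ℕ} {q m : ℕ → ℝ} {Δ : ℝ}

lemma integral_gap_eq (h : IsStepData n q m Δ) (P : ℝ[X]) (u v : ℝ) :
    ∫ x in u..v, stepGap P n q m Δ x
      = (∫ x in u..v, (derivative P).eval x) - ∫ x in u..v, rsqPrimitive (stepTail n q m Δ) x := by
  unfold stepGap
  exact intervalIntegral.integral_sub ((derivative P).continuous.intervalIntegrable _ _)
    ((continuous_rsqPrimitive h.isTail.continuous h.tail_pos).intervalIntegrable _ _)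

/-- The first variation in all admissible directions. -/
lemma IsStepData.variation (hP : IsMixturePoly P) (h : IsStepData n q m Δ)
    (hmin : IsParisiMeasure (fun x => P.eval x) (densityAndAtom (stepDensity n q m) Δ)) :
    stepGap P n q m Δ 1 = 0 ∧
    (∀ u ∈ Ico (0 : ℝ) 1, 0 ≤ ∫ x in u..1, stepGap P n q m Δ x) ∧
    ∀ l < n, ∫ x in q l..1, stepGap P n q m Δ x ≤ 0 := by
  have hF : Continuous (deriv fun x => P.eval x) := by
    rw [deriv_eval_poly]; exact (derivative P).continuous
  have hF0 : ∀ x ∈ Icc (0 : ℝ) 1, 0 ≤ deriv (fun x => P.eval x) x := fun x hx => by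
    rw [deriv_eval_poly]; exact eval_nonneg_of_coeff_nonneg hP.deriv_coeff_nonneg hx.1
  have hα : Continuous (stepTail n q m Δ) := h.isTail.continuous
  have hγ0 : ∀ x ∈ Ico (0 : ℝ) 1, 0 < stepDensity n q m x := fun x hx => h.density_pos hx
  -- Varying only the atom at `1`; the choices `c = 1` and `c = -1` are both admissible and give
  -- `g(1) = 0`.
  have hatom : ∀ c : ℝ, (∀ ε, 0 < ε → ε < Δ → 0 < Δ + ε * c) →
      c * rsqPrimitive (stepTail n q m Δ) 1 ≤ c * (derivative P).eval 1 := by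
    intro c hc
    have := h.isTail.first_variation hF hF0 hmin.2 (η := fun _ => 0) (b := fun _ => c) (δ := c)
      (by simp) continuous_const (by simp) h.atom_pos (fun ε h1 h2 => by
        refine ⟨fun x hx => by simpa using (hγ0 x hx).le, hc ε h1 h2, ?_⟩
        exact ⟨_, _, fun x hx => by simpa using (hγ0 x hx).le,
          by simpa using h.density_monotoneOn,
          fun x _ => by simpa using density_continuousWithinAt n q m x, hc ε h1 h2, rfl⟩)
    rw [intervalIntegral.integral_const_mul, deriv_eval_poly] at this
    simpa [rsqPrimitive] using this
  have hdir : ∀ u ∈ Ico (0 : ℝ) 1, ∀ c ε₀ : ℝ, 0 < ε₀ → (∀ ε, 0 < ε → ε < ε₀ →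
      (∀ x ∈ Ico (0 : ℝ) 1, 0 ≤ stepDensity n q m x + ε * (Ico u 1).indicator (fun _ => c) x) ∧
      MonotoneOn (fun x => stepDensity n q m x + ε * (Ico u 1).indicator (fun _ => c) x)
        (Ico 0 1)) → 0 ≤ c * ∫ x in u..1, stepGap P n q m Δ x := by
    intro u hu c ε₀ hε₀ hε
    have := h.isTail.first_variation hF hF0 hmin.2 (η := (Ico u 1).indicator (fun _ => c))
      (b := fun x => c * (max 1 x - max u x)) (δ := 0)
      (intervalIntegrable_indicator_Ico _ _ _) (by fun_prop)
      (fun x hx => by rw [zero_add, integral_indicator_Ico c hx.2 hu.2.le le_rfl]) hε₀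
      (fun ε h1 h2 => by
        refine ⟨(hε ε h1 h2).1, by simpa using h.atom_pos, ?_⟩
        exact ⟨_, _, (hε ε h1 h2).1, (hε ε h1 h2).2, fun x _ =>
          (density_continuousWithinAt n q m x).add
            ((continuousWithinAt_indicator_Ico u 1 c x).const_mul ε),
          by simpa using h.atom_pos, rfl⟩)
    rw [integral_indicator_Ico_mul hu, zero_mul, add_zero, deriv_eval_poly] at this
    have e : ∫ x in (0 : ℝ)..1, c * (max 1 x - max u x) * (1 / stepTail n q m Δ x ^ 2)
        = c * ∫ x in u..1, rsqPrimitive (stepTail n q m Δ) x := by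
      rw [← integral_one_sub_max_mul hα h.tail_pos hu, ← intervalIntegral.integral_const_mul]
      refine intervalIntegral.integral_congr fun x hx => ?_
      rw [uIcc_of_le zero_le_one] at hx
      rw [max_eq_left hx.2]
      ring
    rw [e] at this
    rw [integral_gap_eq h]
    linarith
  refine ⟨?_, fun u hu => ?_, fun l hl => ?_⟩
  · have h1 := hatom 1 (fun ε h1 _ => by linarith [h.atom_pos])
    have h2 := hatom (-1) (fun ε _ h2 => by linarith)
    unfold stepGap
    linarith
  · have := hdir u hu 1 1 one_pos fun ε h1 _ => by
      have hmon : MonotoneOn (fun x => ε * (Ico u 1).indicator (fun _ => (1 : ℝ)) x) (Ico 0 1) := by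
        intro x hx y hy hxy
        refine mul_le_mul_of_nonneg_left ?_ h1.le
        by_cases hxu : x ∈ Ico u 1
        · rw [indicator_of_mem hxu, indicator_of_mem (mem_Ico.2 ⟨hxu.1.trans hxy, hy.2⟩)]
        · rw [indicator_of_notMem hxu]
          exact indicator_nonneg (fun _ _ => zero_le_one) y
      exact ⟨fun x hx => add_nonneg (hγ0 x hx).le
        (mul_nonneg h1.le (indicator_nonneg (fun _ _ => zero_le_one) x)),
        h.density_monotoneOn.add hmon⟩
    linarith
  -- `ε₀` is the jump of the density at `q l` (its value there if `l = 0`): lowering the density on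
  -- `[q l, 1)` by less than this keeps it nonnegative and nondecreasing.
  · obtain ⟨ε₀, hε₀, h0, hprev⟩ : ∃ ε₀ : ℝ, 0 < ε₀ ∧ (ε₀ ≤ m l) ∧
        ∀ i < l, ε₀ ≤ m l - m i := by
      cases l with
      | zero => exact ⟨m 0, h.pos 0 hl, le_rfl, fun i hi => absurd hi (Nat.not_lt_zero i)⟩
      | succ l =>
        refine ⟨m (l + 1) - m l, sub_pos.2 (h.slope_lt l hl), ?_, fun i hi => ?_⟩
        · linarith [h.pos l (by omega)]
        · linarith [h.slope_mono (i := i) (j := l) (by omega) (by omega)]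
    have hu : q l ∈ Ico (0 : ℝ) 1 :=
      ⟨h.nonneg hl.le, (h.lt l hl).trans_le (h.le_one hl)⟩
    have hql : q l ∈ Ico (q l) (q (l + 1)) := ⟨le_rfl, h.lt l hl⟩
    have := hdir (q l) hu (-1) ε₀ hε₀ fun ε h1 h2 => by
      constructor
      · intro x hx
        by_cases hxu : x ∈ Ico (q l) 1
        · rw [indicator_of_mem hxu]
          have := h.density_monotoneOn hu hx hxu.1
          rw [h.density_eq hl hql] at this
          linarith
        · rw [indicator_of_notMem hxu]
          linarith [hγ0 x hx]
      · intro x hx y hy hxy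
        simp only
        have hxy' := h.density_monotoneOn hx hy hxy
        by_cases hxu : x ∈ Ico (q l) 1
        · rw [indicator_of_mem hxu, indicator_of_mem (mem_Ico.2 ⟨hxu.1.trans hxy, hy.2⟩)]
          linarith
        · rw [indicator_of_notMem hxu]
          by_cases hyu : y ∈ Ico (q l) 1
          · rw [indicator_of_mem hyu]
            have hy' := h.density_monotoneOn hu hy hyu.1
            rw [h.density_eq hl hql] at hy'
            have hxl : x < q l := by
              by_contra! hcon
              exact hxu ⟨hcon, hx.2⟩
            obtain ⟨i, hi, hxi⟩ := h.exists_piece hx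
            rw [h.density_eq hi hxi]
            have hil : i < l := by
              have h3 := h.piece_le hi hxi hql hxl.le
              rcases h3.eq_or_lt with rfl | h3
              · exact absurd hxi.1 (not_le.2 hxl)
              · exact h3
            linarith [hprev i hil]
          · rw [indicator_of_notMem hyu]
            linarith
    linarith

/-- Necessity: the step data of a minimizer are stationary. -/
theorem IsStepData.isStationary (hP : IsMixturePoly P) (h : IsStepData n q m Δ)
    (hmin : IsParisiMeasure (fun x => P.eval x) (densityAndAtom (stepDensity n q m) Δ)) :
    IsStationary P n q m Δ := by
  obtain ⟨hone, hnn, hnp⟩ := h.variation hP hmin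
  have hgd := h.hasDerivAt_gap P
  have hgc := h.continuous_gap P
  set g := stepGap P n q m Δ with hg
  set G : ℝ → ℝ := fun x => ∫ y in x..1, g y with hG
  have hGd : ∀ x, HasDerivAt G (-g x) x := fun x =>
    intervalIntegral.integral_hasDerivAt_left (hgc.intervalIntegrable _ _)
      (hgc.stronglyMeasurableAtFilter _ _) hgc.continuousAt
  have hmem : ∀ l < n, q l ∈ Ico (0 : ℝ) 1 := fun l hl =>
    ⟨h.nonneg hl.le, (h.lt l hl).trans_le (h.le_one hl)⟩
  have hGq : ∀ l ≤ n, G (q l) = 0 := by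
    intro l hl
    rcases hl.eq_or_lt with rfl | hl
    · simp [hG, h.last]
    · exact le_antisymm (hnp l hl) (hnn _ (hmem l hl))
  have hgq : ∀ l ≤ n, g (q l) = 0 := by
    intro l hl
    rcases hl.eq_or_lt with rfl | hl
    · rw [h.last]; exact hone
    · rcases Nat.eq_zero_or_pos l with rfl | hl0
      · rw [h.zero, hg, stepGap, hP.deriv_eval_zero, rsqPrimitive]; simp
      · have h0 : 0 < q l := by
          have h1 := h.lt 0 (by omega)
          rw [h.zero] at h1
          exact h1.trans_le (h.mono (by omega) hl.le)
        -- `G` is nonnegative and vanishes at the atom, which is interior here, so its derivative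
        -- `-g` vanishes.
        have hloc : IsLocalMin G (q l) := by
          filter_upwards [Ioo_mem_nhds h0 (hmem l hl).2] with x hx
          rw [hGq l hl.le]
          exact hnn x ⟨hx.1.le, hx.2⟩
        have := hloc.hasDerivAt_eq_zero (hGd (q l))
        linarith
  refine ⟨hgq, fun l hl => ?_, fun l hl => ?_⟩
  · have h1 := intervalIntegral.integral_add_adjacent_intervals
      (hgc.intervalIntegrable (μ := volume) (q l) (q (l + 1))) (hgc.intervalIntegrable _ 1)
    have h2 := hGq l hl.le
    have h3 := hGq (l + 1) hl
    simp only [hG] at h2 h3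
    linarith
  · rcases Nat.eq_zero_or_pos l with rfl | hl0
    · rw [h.zero, ← coeff_zero_eq_eval_zero, hP.deriv2_coeff_zero]
      positivity
    -- If `g' > 0` at `q l`, then `g < 0` just to its left, so `G` increases there up to `G (q l) =
    -- 0` and would be negative. Only the left side is used, which covers `q n = 1` as well.
    by_contra! hcon
    have h0 : 0 < q l := by
      have h1 := h.lt 0 (by omega)
      rw [h.zero] at h1
      exact h1.trans_le (h.mono (by omega) hl)
    set D : ℝ → ℝ := fun x => (derivative (derivative P)).eval x - 1 / stepTail n q m Δ x ^ 2
      with hD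
    have hDc : Continuous D := (derivative (derivative P)).continuous.sub
      (continuous_rsq h.isTail.continuous h.tail_pos)
    have hev : ∀ᶠ x in nhds (q l), 0 < D x :=
      hDc.continuousAt.eventually (lt_mem_nhds (sub_pos.2 hcon))
    obtain ⟨δ, hδ, hball⟩ := Metric.eventually_nhds_iff.1 hev
    set x := max 0 (q l - δ / 2) with hx
    have hx0 : 0 ≤ x := le_max_left _ _
    have hxq : x < q l := max_lt h0 (by linarith)
    have hxδ : q l - δ / 2 ≤ x := le_max_right _ _
    obtain ⟨c, hc, hc'⟩ := exists_hasDerivAt_eq_slope G _ hxq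
      (fun z _ => (hGd z).continuousAt.continuousWithinAt) (fun z _ => hGd z)
    obtain ⟨d, hd, hd'⟩ := exists_hasDerivAt_eq_slope g D hc.2
      (fun z _ => (hgd z).continuousAt.continuousWithinAt) (fun z _ => hgd z)
    have hdpos : 0 < D d := hball (by
      rw [Real.dist_eq, abs_lt]
      constructor <;> linarith [hd.1, hd.2, hc.1])
    rw [hgq l hl, eq_div_iff (by linarith [hc.2])] at hd'
    rw [hGq l hl, eq_div_iff (by linarith)] at hc'
    have hgcneg : g c < 0 := by
      have := mul_pos hdpos (sub_pos.2 hc.2)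
      linarith
    have hGx : 0 ≤ G x := hnn x ⟨hx0, hxq.trans_le (h.le_one hl)⟩
    nlinarith [mul_pos (neg_pos.2 hgcneg) (sub_pos.2 hxq)]

end

end SphericalSpinGlass

/-! ### The function `h` and the ratio of consecutive tails -/

namespace SphericalSpinGlass
open MeasureTheory Set Polynomial

/-- For `z ≠ 1` this amounts to `z² - 1 ≤ 2 z log z`, which is `sinh u ≤ u` at `u = log z ≤ 0`. -/
lemma logKernel_le {z : ℝ} (h0 : 0 < z) (h1 : z ≤ 1) : logKernel z ≤ -1 / 2 := by
  unfold logKernel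
  split_ifs with h
  · exact le_rfl
  have hz : z < 1 := lt_of_le_of_ne h1 h
  have hlog : (z - z⁻¹) / 2 ≤ Real.log z := by
    have h2 : Real.sinh (Real.log z) ≤ Real.log z :=
      Real.sinh_le_self_iff.2 (Real.log_nonpos h0.le h1)
    rwa [Real.sinh_eq, Real.exp_neg, Real.exp_log h0] at h2
  have h3 : z ^ 2 - 1 ≤ 2 * (z * Real.log z) := by
    have := mul_le_mul_of_nonneg_left hlog h0.le
    have h4 : z * ((z - z⁻¹) / 2) = (z ^ 2 - 1) / 2 := by field_simp
    linarith
  have hz1 : z - 1 ≠ 0 := by linarith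
  have h5 : 1 / (z - 1) - z / (z - 1) ^ 2 * Real.log z - -1 / 2
      = ((z ^ 2 - 1) - 2 * (z * Real.log z)) / (2 * (z - 1) ^ 2) := by
    field_simp; ring
  have h6 : ((z ^ 2 - 1) - 2 * (z * Real.log z)) / (2 * (z - 1) ^ 2) ≤ 0 :=
    div_nonpos_of_nonpos_of_nonneg (by linarith) (by positivity)
  linarith

section
variable {P : ℝ[X]} {n : ℕ} {q m a : ℕ → ℝ} {Δ : ℝ}

lemma IsMixturePoly.deriv_strictMonoOn (hP : IsMixturePoly P) :
    StrictMonoOn (fun x => (derivative P).eval x) (Ici 0) := by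
  refine strictMonoOn_of_deriv_pos (convex_Ici 0) (derivative P).continuous.continuousOn
    fun x hx => ?_
  rw [interior_Ici] at hx
  rw [((derivative P).hasDerivAt x).deriv]
  exact hP.deriv2_eval_pos hx

lemma IsMixturePoly.deriv2_strictMonoOn (hP : IsMixturePoly P) :
    StrictMonoOn (fun x => (derivative (derivative P)).eval x) (Ici 0) := by
  refine strictMonoOn_of_deriv_pos (convex_Ici 0)
    (derivative (derivative P)).continuous.continuousOn fun x hx => ?_
  rw [interior_Ici] at hx
  rw [((derivative (derivative P)).hasDerivAt x).deriv]
  refine eval_pos_of_coeff_nonneg (coeff_derivative_nonneg hP.deriv2_coeff_nonneg) ?_ hx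
  intro h0
  have h1 := derivative_eq_zero.1 h0
  rw [natDegree_derivative, natDegree_derivative] at h1
  have := hP.three_le_natDegree
  omega

/-- Strict convexity of `ξ'` gives the trapezoid inequality `ξ(t) - ξ(s) - ξ'(s)(t-s) < (ξ'(t) -
ξ'(s))(t-s)/2`, so `h < 0` whenever the kernel is at most `-1/2`. For a solution of the system this
makes the tails decrease, hence the slopes positive. -/
lemma IsMixturePoly.one_lt_of_h_eq_zero (hP : IsMixturePoly P) {s t z : ℝ} (hs : 0 ≤ s)
    (hst : s < t) (hz : 0 < z) (hh : h (fun x => P.eval x) s t z = 0) : 1 < z := by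
  by_contra! hz1
  have hk := logKernel_le hz hz1
  have hF : (derivative P).eval s < (derivative P).eval t :=
    hP.deriv_strictMonoOn hs (hs.trans hst.le) hst
  set φ : ℝ → ℝ := fun x => 1 / 2 * (((derivative P).eval x - (derivative P).eval s) * (x - s))
    - (P.eval x - P.eval s - (derivative P).eval s * (x - s)) with hφ
  have hd : ∀ x, HasDerivAt φ (1 / 2 * ((derivative (derivative P)).eval x * (x - s)
      - ((derivative P).eval x - (derivative P).eval s))) x := by
    intro x
    refine (((((derivative P).hasDerivAt x).sub_const _).mul
      ((hasDerivAt_id x).sub_const s)).const_mul (1 / 2) |>.sub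
      (((P.hasDerivAt x).sub_const _).sub
        (((hasDerivAt_id x).sub_const s).const_mul ((derivative P).eval s)))).congr_deriv ?_
    simp only [id]
    ring
  have hmono : StrictMonoOn φ (Icc s t) := by
    refine strictMonoOn_of_deriv_pos (convex_Icc s t)
      (fun x _ => (hd x).continuousAt.continuousWithinAt) fun x hx => ?_
    rw [interior_Icc] at hx
    rw [(hd x).deriv]
    obtain ⟨c, hc, hc'⟩ := exists_hasDerivAt_eq_slope (fun x => (derivative P).eval x) _ hx.1
      (derivative P).continuous.continuousOn (fun z _ => (derivative P).hasDerivAt z)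
    have h1 : (derivative (derivative P)).eval c < (derivative (derivative P)).eval x :=
      hP.deriv2_strictMonoOn (hs.trans hc.1.le) (hs.trans hx.1.le) hc.2
    rw [hc', div_lt_iff₀ (sub_pos.2 hx.1)] at h1
    linarith
  have h2 := hmono (left_mem_Icc.2 hst.le) (right_mem_Icc.2 hst.le) hst
  simp only [hφ, sub_self, mul_zero] at h2
  unfold h at hh
  rw [deriv_eval_poly] at hh
  have h3 := mul_le_mul_of_nonneg_left hk
    (mul_pos (sub_pos.2 hF) (sub_pos.2 hst)).le
  simp only at hh
  linarith

lemma hasDerivAt_line (c s k x : ℝ) :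
    HasDerivAt (fun x => c + k * (s - x)) (-k) x := by
  simpa using (((hasDerivAt_id x).const_sub s).const_mul k).const_add c

lemma IsStepData.rsqPrimitive_sub (h : IsStepData n q m Δ) {l : ℕ} (hl : l < n) {x : ℝ}
    (hx : x ∈ Icc (q l) (q (l + 1))) :
    rsqPrimitive (stepTail n q m Δ) x - rsqPrimitive (stepTail n q m Δ) (q l)
      = (x - q l) / (stepTail n q m Δ (q l) * stepTail n q m Δ x) := by
  have hrc := continuous_rsq h.isTail.continuous h.tail_pos
  set α := stepTail n q m Δ with hα
  have hm := h.pos l hl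
  have hlin : ∀ y ∈ Icc (q l) (q (l + 1)), α y = α (q (l + 1)) + m l * (q (l + 1) - y) :=
    fun y hy => h.tail_linear hl hy
  have hpos : ∀ y, 0 < α y := h.tail_pos
  have hsub : ∀ y ∈ uIcc (q l) x, y ∈ Icc (q l) (q (l + 1)) := fun y hy => by
    rw [uIcc_of_le hx.1] at hy; exact ⟨hy.1, hy.2.trans hx.2⟩
  have e : rsqPrimitive α x - rsqPrimitive α (q l) = ∫ y in q l..x, 1 / α y ^ 2 := by
    unfold rsqPrimitive
    exact intervalIntegral.integral_interval_sub_left (hrc.intervalIntegrable _ _)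
      (hrc.intervalIntegrable _ _)
  rw [e, intervalIntegral.integral_congr (g := fun y =>
    1 / (α (q (l + 1)) + m l * (q (l + 1) - y)) ^ 2)
    (fun y hy => by simp only; rw [hlin y (hsub y hy)])]
  have hd : ∀ y ∈ uIcc (q l) x, HasDerivAt
      (fun y => (m l)⁻¹ * (α (q (l + 1)) + m l * (q (l + 1) - y))⁻¹)
      (1 / (α (q (l + 1)) + m l * (q (l + 1) - y)) ^ 2) y := by
    intro y hy
    have hne : α (q (l + 1)) + m l * (q (l + 1) - y) ≠ 0 := by
      rw [← hlin y (hsub y hy)]; exact (hpos y).ne'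
    refine (((hasDerivAt_line _ _ _ y).inv hne).const_mul (m l)⁻¹).congr_deriv ?_
    field_simp
  rw [intervalIntegral.integral_eq_sub_of_hasDerivAt hd]
  · rw [← hlin x hx, ← hlin (q l) (left_mem_Icc.2 (h.lt l hl).le)]
    have h1 := hlin x hx
    have h2 := hlin (q l) (left_mem_Icc.2 (h.lt l hl).le)
    have h3 : α (q l) - α x = m l * (x - q l) := by rw [h1, h2]; ring
    have := hpos x
    have := hpos (q l)
    field_simp
    linarith
  · refine ContinuousOn.intervalIntegrable fun y hy => ContinuousAt.continuousWithinAt ?_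
    have hne : α (q (l + 1)) + m l * (q (l + 1) - y) ≠ 0 := by
      rw [← hlin y (hsub y hy)]; exact (hpos y).ne'
    refine continuousAt_const.div ?_ (pow_ne_zero 2 hne)
    fun_prop

lemma IsStepData.tail_sub (h : IsStepData n q m Δ) {l : ℕ} (hl : l < n) :
    stepTail n q m Δ (q l) - stepTail n q m Δ (q (l + 1)) = m l * (q (l + 1) - q l) := by
  rw [h.tail_linear hl (left_mem_Icc.2 (h.lt l hl).le)]; ring

/-- The integral of the gap over a piece is the function `h` at the ratio of the tails. -/
lemma IsStepData.integral_gap (h : IsStepData n q m Δ) {l : ℕ} (hl : l < n)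
    (h0 : stepGap P n q m Δ (q l) = 0) (h1 : stepGap P n q m Δ (q (l + 1)) = 0) :
    ∫ x in q l..q (l + 1), stepGap P n q m Δ x
      = SphericalSpinGlass.h (fun x => P.eval x) (q l) (q (l + 1))
        (stepTail n q m Δ (q l) / stepTail n q m Δ (q (l + 1))) := by
  have hrs := fun x hx => h.rsqPrimitive_sub hl (x := x) hx
  set α := stepTail n q m Δ with hα
  have hm := h.pos l hl
  have hst := h.lt l hl
  have hlin : ∀ y ∈ Icc (q l) (q (l + 1)), α y = α (q (l + 1)) + m l * (q (l + 1) - y) :=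
    fun y hy => h.tail_linear hl hy
  have hpos : ∀ y, 0 < α y := h.tail_pos
  have hab : α (q l) - α (q (l + 1)) = m l * (q (l + 1) - q l) := h.tail_sub hl
  have ha := hpos (q l)
  have hb := hpos (q (l + 1))
  set s := q l with hs
  set t := q (l + 1) with ht
  set A := α s with hA
  set B := α t with hB
  have hF0 : rsqPrimitive α s = (derivative P).eval s := by unfold stepGap at h0; linarith
  have hF1 : rsqPrimitive α t = (derivative P).eval t := by unfold stepGap at h1; linarith
  have hval : ∀ x ∈ uIcc s t, stepGap P n q m Δ x
      = (derivative P).eval x - (derivative P).eval s - (x - s) / (A * (B + m l * (t - x))) := by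
    intro x hx
    rw [uIcc_of_le hst.le] at hx
    have := hrs x hx
    rw [hlin x hx] at this
    unfold stepGap
    linarith
  rw [intervalIntegral.integral_congr hval]
  -- The tail on the piece is `A - m_l (x - s)`, so `(x - s)/(A α)` equals `1/(m_l α) - 1/(A m_l)`;
  -- its primitive is the source of the logarithm in `h`.
  have hd : ∀ x ∈ uIcc s t, HasDerivAt (fun x => P.eval x - (derivative P).eval s * x
      + (A * m l)⁻¹ * (x + A / m l * Real.log (B + m l * (t - x))))
      ((derivative P).eval x - (derivative P).eval s - (x - s) / (A * (B + m l * (t - x)))) x := by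
    intro x hx
    rw [uIcc_of_le hst.le] at hx
    have hp : 0 < B + m l * (t - x) := by rw [← hlin x hx]; exact hpos x
    refine (((P.hasDerivAt x).sub ((hasDerivAt_id x).const_mul _)).add
      (((hasDerivAt_id x).add (((hasDerivAt_line B t (m l) x).log
        hp.ne').const_mul (A / m l))).const_mul (A * m l)⁻¹)).congr_deriv ?_
    have hA' : A = B + m l * (t - s) := by linarith
    have hp' := hp.ne'
    have ha' := ha.ne'
    field_simp
    rw [hA']
    ring
  rw [intervalIntegral.integral_eq_sub_of_hasDerivAt hd]
  · have hm' : m l = (A - B) / (t - s) := by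
      rw [eq_div_iff (by linarith)]; linarith
    have hABpos : 0 < A - B := by rw [hab]; exact mul_pos hm (by linarith)
    have hne : A / B ≠ 1 := by
      intro hcon
      rw [div_eq_one_iff_eq hb.ne'] at hcon
      linarith
    have hFd : (derivative P).eval t - (derivative P).eval s = (t - s) / (A * B) := by
      rw [← hF0, ← hF1]
      exact hrs t (right_mem_Icc.2 hst.le)
    have hBs : B + m l * (t - s) = A := by linarith
    unfold SphericalSpinGlass.h logKernel
    rw [if_neg hne, deriv_eval_poly]
    simp only
    rw [hFd, hBs, sub_self, mul_zero, add_zero, Real.log_div ha.ne' hb.ne', hm']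
    have hts : t - s ≠ 0 := by linarith
    have h3 : A - B ≠ 0 := hABpos.ne'
    have h4 : A / B - 1 = (A - B) / B := by field_simp
    rw [h4]
    field_simp
    ring
  · refine ContinuousOn.intervalIntegrable fun x hx => ContinuousAt.continuousWithinAt ?_
    rw [uIcc_of_le hst.le] at hx
    have hp : B + m l * (t - x) ≠ 0 := by rw [← hlin x hx]; exact (hpos x).ne'
    refine ((derivative P).continuous.continuousAt.sub continuousAt_const).sub ?_
    exact ContinuousAt.div (by fun_prop) (by fun_prop) (mul_ne_zero ha.ne' hp)

/-! ### The functions `𝓕`, `𝓐`, `h_l` in terms of the tails -/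

/-- The quantity governing the increase of the slopes at an interior atom. -/
noncomputable def bend (P : ℝ[X]) (q a : ℕ → ℝ) (l : ℕ) : ℝ :=
  ((derivative P).eval (q (l + 1)) - (derivative P).eval (q (l - 1))) / (q (l + 1) - q (l - 1))
    * (a (l - 1) * a (l + 1))

/-- A positive sequence `a` adapted to the atoms `q`: these are the tails of stationary data. -/
structure IsTailSeq (P : ℝ[X]) (n : ℕ) (q a : ℕ → ℝ) : Prop where
  zero : q 0 = 0
  lt : ∀ l < n, q l < q (l + 1)
  pos : ∀ l ≤ n, 0 < a l
  deriv_sub : ∀ l < n, (derivative P).eval (q (l + 1)) - (derivative P).eval (q l)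
    = (q (l + 1) - q l) / (a l * a (l + 1))

namespace IsTailSeq

lemma q_nonneg (h : IsTailSeq P n q a) {l : ℕ} (hl : l ≤ n) : 0 ≤ q l := by
  induction l with
  | zero => exact h.zero.ge
  | succ l ih => exact (ih (by omega)).trans (h.lt l hl).le

lemma q_pos (h : IsTailSeq P n q a) {l : ℕ} (hl0 : 1 ≤ l) (hl : l ≤ n) : 0 < q l := by
  obtain ⟨k, rfl⟩ : ∃ k, l = k + 1 := ⟨l - 1, by omega⟩
  exact (h.q_nonneg (by omega)).trans_lt (h.lt k hl)

lemma deriv_sub_pos (h : IsTailSeq P n q a) {l : ℕ} (hl : l < n) :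
    0 < (derivative P).eval (q (l + 1)) - (derivative P).eval (q l) := by
  rw [h.deriv_sub l hl]
  exact div_pos (sub_pos.2 (h.lt l hl)) (mul_pos (h.pos l hl.le) (h.pos (l + 1) hl))

/-- Substituting the difference quotients `1/(a_l a_{l+1})` of `ξ'` leaves a ratio of tails two
indices apart, which makes the products in `𝓕` and `𝓐` telescope. -/
lemma rBold_eq (h : IsTailSeq P n q a) {l : ℕ} (hl : l + 1 < n) :
    rBold (fun x => P.eval x) q (l + 1) = a l / a (l + 2) := by
  have h0 := h.pos l (by omega)
  have h1 := h.pos (l + 1) (by omega)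
  have h2 := h.pos (l + 2) (by omega)
  have d1 := sub_pos.2 (h.lt l (by omega))
  have d2 := sub_pos.2 (h.lt (l + 1) hl)
  have e1 := h.deriv_sub l (by omega)
  have e2 := h.deriv_sub (l + 1) hl
  rw [rBold, r₁, deriv_eval_poly]
  simp only [Nat.add_sub_cancel]
  rw [show l + 1 + 1 = l + 2 from rfl] at *
  rw [e1, ← neg_sub, e2, ← neg_sub (q (l + 2))]
  have := d1.ne'
  have := d2.ne'
  field_simp

lemma r₂_left (h : IsTailSeq P n q a) {l : ℕ} (hl : l < n) :
    r₂ (fun x => P.eval x) (q l) (q (l + 1))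
      = (derivative (derivative P)).eval (q (l + 1)) * (a l * a (l + 1)) := by
  have h0 := h.pos l (by omega)
  have h1 := h.pos (l + 1) (by omega)
  have d1 := (sub_pos.2 (h.lt l (by omega))).ne'
  rw [r₂, deriv_eval_poly, deriv_eval_poly]
  simp only
  rw [h.deriv_sub l hl]
  field_simp

lemma r₂_right (h : IsTailSeq P n q a) {l : ℕ} (hl : l < n) :
    r₂ (fun x => P.eval x) (q (l + 1)) (q l)
      = (derivative (derivative P)).eval (q l) * (a l * a (l + 1)) := by
  have h0 := h.pos l (by omega)
  have h1 := h.pos (l + 1) (by omega)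
  have d1 := (sub_pos.2 (h.lt l (by omega))).ne'
  rw [r₂, deriv_eval_poly, deriv_eval_poly]
  simp only
  rw [← neg_sub ((derivative P).eval (q (l + 1))), h.deriv_sub l hl, ← neg_sub (q (l + 1))]
  field_simp

/-- Numerators and denominators telescope separately, along the two parity classes of indices. -/
lemma prod_eq (h : IsTailSeq P n q a) (k : ℕ) (hk : 2 * k + 1 ≤ n) :
    ∏ i ∈ Finset.Icc 1 k, rBold (fun x => P.eval x) q (n + 1 - 2 * i)
      / rBold (fun x => P.eval x) q (n - 2 * i)
      = a (n - 1) / a n * (a (n - 2 * k) / a (n - 2 * k - 1)) := by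
  induction k with
  | zero =>
    have h0 := h.pos n le_rfl
    have h1 := h.pos (n - 1) (by omega)
    rw [show Finset.Icc 1 0 = ∅ from rfl, Finset.prod_empty, mul_zero, Nat.sub_zero]
    field_simp
  | succ k ih =>
    rw [Finset.prod_Icc_succ_top (by omega), ih (by omega)]
    obtain ⟨j, rfl⟩ : ∃ j, n = j + 2 * k + 3 := ⟨n - 2 * k - 3, by omega⟩
    rw [show j + 2 * k + 3 + 1 - 2 * (k + 1) = (j + 1) + 1 by omega,
      show j + 2 * k + 3 - 2 * (k + 1) = j + 1 by omega,
      h.rBold_eq (l := j + 1) (by omega), h.rBold_eq (l := j) (by omega),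
      show j + 2 * k + 3 - 2 * k = j + 3 by omega]
    simp only [Nat.add_sub_cancel, show j + 3 - 1 = j + 2 by omega,
      show j + 1 + 2 = j + 3 by omega]
    have h0 := h.pos j (by omega)
    have h1 := h.pos (j + 1) (by omega)
    have h2 := h.pos (j + 2) (by omega)
    have h3 := h.pos (j + 3) (by omega)
    have h4 := h.pos (j + 2 * k + 3) (by omega)
    field_simp

lemma prod_inv_eq (h : IsTailSeq P n q a) (k : ℕ) (hk : 2 * k + 1 ≤ n) :
    ∏ i ∈ Finset.Icc 1 k, rBold (fun x => P.eval x) q (n - 2 * i)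
      / rBold (fun x => P.eval x) q (n + 1 - 2 * i)
      = (a (n - 1) / a n * (a (n - 2 * k) / a (n - 2 * k - 1)))⁻¹ := by
  rw [← h.prod_eq k hk, ← Finset.prod_inv_distrib]
  exact Finset.prod_congr rfl fun i _ => (inv_div _ _).symm

/-- With `w = a_{n-1}/a_n` the factor `w` appears here and `1/w` in the odd case, so both `𝓕 ≤ w`
and `𝓕 ≤ 1/w` become the parity-free stability condition `ξ''(q_l) a_l² ≤ 1`. -/
lemma calF_even (h : IsTailSeq P n q a) {l : ℕ} (hl0 : 1 ≤ l) (hl : l ≤ n) (he : Even (n - l)) :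
    calF (fun x => P.eval x) n q l
      = (derivative (derivative P)).eval (q l) * a l ^ 2 * (a (n - 1) / a n) := by
  obtain ⟨k, hk⟩ := he
  obtain ⟨j, rfl⟩ : ∃ j, l = j + 1 := ⟨l - 1, by omega⟩
  rw [calF, if_pos ⟨k, hk⟩, show (n - (j + 1)) / 2 = k by omega, h.prod_eq k (by omega),
    show n - 2 * k = j + 1 by omega]
  simp only [Nat.add_sub_cancel]
  rw [h.r₂_left (by omega)]
  have h0 := h.pos j (by omega)
  field_simp

lemma calF_odd (h : IsTailSeq P n q a) {l : ℕ} (hl : l ≤ n) (ho : Odd (n - l)) :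
    calF (fun x => P.eval x) n q l
      = (derivative (derivative P)).eval (q l) * a l ^ 2 / (a (n - 1) / a n) := by
  have hne : ¬ Even (n - l) := Nat.not_even_iff_odd.2 ho
  obtain ⟨k, hk⟩ := ho
  rw [calF, if_neg hne, show (n - l) / 2 = k by omega, h.prod_inv_eq k (by omega),
    show n - 2 * k = l + 1 by omega]
  simp only [Nat.add_sub_cancel]
  rw [h.r₂_right (by omega)]
  have h0 := h.pos l (by omega)
  have h1 := h.pos (l + 1) (by omega)
  have h2 := h.pos n le_rfl
  have h3 := h.pos (n - 1) (by omega)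
  field_simp

lemma calA_even (h : IsTailSeq P n q a) {l : ℕ} (hl0 : 1 ≤ l) (hl : l < n) (he : Even (n - l)) :
    calA (fun x => P.eval x) n q l = bend P q a l / (a (n - 1) / a n) := by
  obtain ⟨k, hk⟩ := he
  obtain ⟨j, rfl⟩ : ∃ j, l = j + 1 := ⟨l - 1, by omega⟩
  rw [calA, if_pos ⟨k, hk⟩, show (n - (j + 1)) / 2 = k by omega, h.prod_inv_eq k (by omega),
    show n - 2 * k = j + 1 by omega, r₁, bend, deriv_eval_poly]
  simp only [Nat.add_sub_cancel]
  rw [h.deriv_sub (j + 1) hl]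
  have h0 := h.pos j (by omega)
  have h1 := h.pos (j + 1) (by omega)
  have h2 := h.pos (j + 1 + 1) (by omega)
  have h3 := h.pos n le_rfl
  have h4 := h.pos (n - 1) (by omega)
  have d1 := sub_pos.2 (h.lt j (by omega))
  have d2 := sub_pos.2 (h.lt (j + 1) hl)
  have d3 : q (j + 1 + 1) - q j ≠ 0 := by linarith
  have d4 := d2.ne'
  field_simp

lemma calA_odd (h : IsTailSeq P n q a) {l : ℕ} (hl0 : 1 ≤ l) (hl : l < n) (ho : Odd (n - l)) :
    calA (fun x => P.eval x) n q l = bend P q a l * (a (n - 1) / a n) := by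
  have hne : ¬ Even (n - l) := Nat.not_even_iff_odd.2 ho
  obtain ⟨k, hk⟩ := ho
  obtain ⟨j, rfl⟩ : ∃ j, l = j + 1 := ⟨l - 1, by omega⟩
  rw [calA, if_neg hne, show (n - (j + 1)) / 2 = k by omega, h.prod_eq k (by omega),
    show n - 2 * k = j + 1 + 1 by omega, r₁, bend, deriv_eval_poly]
  simp only [Nat.add_sub_cancel]
  rw [← neg_sub ((derivative P).eval (q (j + 1))), h.deriv_sub j (by omega),
    ← neg_sub ((derivative P).eval (q (j + 1 + 1))), ← neg_sub (q (j + 1 + 1)) (q j),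
    ← neg_sub (q (j + 1)) (q j)]
  have h0 := h.pos j (by omega)
  have h1 := h.pos (j + 1) (by omega)
  have h2 := h.pos (j + 1 + 1) (by omega)
  have h3 := h.pos n le_rfl
  have h4 := h.pos (n - 1) (by omega)
  have d1 := sub_pos.2 (h.lt j (by omega))
  have d2 := sub_pos.2 (h.lt (j + 1) hl)
  have d3 : q (j + 1 + 1) - q j ≠ 0 := by linarith
  have d4 := d1.ne'
  field_simp

lemma hStep_eq (hP : IsMixturePoly P) (h : IsTailSeq P n q a) {l : ℕ} (hl : l < n) :
    hStep (fun x => P.eval x) n q (l + 1) (a (n - 1) / a n)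
      = SphericalSpinGlass.h (fun x => P.eval x) (q l) (q (l + 1)) (a l / a (l + 1)) := by
  have h0 := h.pos l (by omega)
  have h1 := h.pos (l + 1) hl
  have h3 := h.pos n le_rfl
  have h4 := h.pos (n - 1) (by omega)
  have hf := hP.deriv2_eval_pos (h.q_pos (l := l + 1) (by omega) hl)
  rw [hStep]
  simp only [Nat.add_sub_cancel]
  congr 1
  rw [h.r₂_left hl]
  rcases Nat.even_or_odd (n - (l + 1)) with he | ho
  · rw [he.neg_one_pow, zpow_one, h.calF_even (by omega) hl he]
    field_simp
  · rw [ho.neg_one_pow, zpow_neg_one, h.calF_odd hl ho]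
    field_simp

/-- `bend` is the height at `q_{l+1}` of the chord through the neighbouring values of `a`, divided
by `a_{l+1}`. Being below `1` is strict concavity at this atom. -/
lemma bend_lt_one_iff (h : IsTailSeq P n q a) {l : ℕ} (hl : l + 1 < n) :
    bend P q a (l + 1) < 1 ↔ (a l - a (l + 1)) / (q (l + 1) - q l)
      < (a (l + 1) - a (l + 2)) / (q (l + 2) - q (l + 1)) := by
  have h0 := h.pos l (by omega)
  have h1 := h.pos (l + 1) (by omega)
  have h2 := h.pos (l + 2) (by omega)
  have d1 := sub_pos.2 (h.lt l (by omega))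
  have d2 := sub_pos.2 (h.lt (l + 1) hl)
  have e1 := h.deriv_sub l (by omega)
  have e2 := h.deriv_sub (l + 1) hl
  simp only [show l + 1 + 1 = l + 2 from rfl] at *
  have d3 : 0 < q (l + 2) - q l := by linarith
  have e3 : (derivative P).eval (q (l + 2)) - (derivative P).eval (q l)
      = (q (l + 1) - q l) / (a l * a (l + 1))
        + (q (l + 2) - q (l + 1)) / (a (l + 1) * a (l + 2)) := by linarith
  rw [bend]
  simp only [Nat.add_sub_cancel, show l + 1 + 1 = l + 2 from rfl]
  rw [e3]
  have e4 : ((q (l + 1) - q l) / (a l * a (l + 1))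
        + (q (l + 2) - q (l + 1)) / (a (l + 1) * a (l + 2))) / (q (l + 2) - q l)
        * (a l * a (l + 2))
      = ((q (l + 1) - q l) * a (l + 2) + (q (l + 2) - q (l + 1)) * a l)
        / (a (l + 1) * (q (l + 2) - q l)) := by
    field_simp
  rw [e4, div_lt_one (by positivity), div_lt_div_iff₀ d1 d2]
  constructor <;> intro hh <;> nlinarith

lemma bend_pos (h : IsTailSeq P n q a) {l : ℕ} (hl : l + 1 < n) : 0 < bend P q a (l + 1) := by
  have d1 := h.lt l (by omega)
  have d2 := h.lt (l + 1) hl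
  have e1 := h.deriv_sub_pos (l := l) (by omega)
  have e2 := h.deriv_sub_pos hl
  have h0 := h.pos l (by omega)
  have h2 := h.pos (l + 2) (by omega)
  rw [bend]
  simp only [Nat.add_sub_cancel]
  exact mul_pos (div_pos (by linarith) (by linarith)) (mul_pos h0 h2)

end IsTailSeq

end

end SphericalSpinGlass

/-! ### The system of equations and stationary data -/

namespace SphericalSpinGlass
open MeasureTheory Set Polynomial

section
variable {P : ℝ[X]} {n : ℕ} {q m a : ℕ → ℝ} {Δ : ℝ}

/-- The conditions on `(q, w)`, where `w = 1 + z`. -/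
def IsSolution (P : ℝ[X]) (n : ℕ) (q : ℕ → ℝ) (w : ℝ) : Prop :=
  (∀ l, 1 ≤ l → l ≤ n → hStep (fun x => P.eval x) n q l w = 0) ∧
  (calY (fun x => P.eval x) n q ≤ w ∧ w ≤ (calZ (fun x => P.eval x) n q)⁻¹) ∧
  ∀ l, 1 ≤ l → l < n → (Odd (n - l) → calA (fun x => P.eval x) n q l < w) ∧
    (Even (n - l) → w < (calA (fun x => P.eval x) n q l)⁻¹)

lemma bddAbove_values {p r : ℕ → Prop} (F A : ℕ → ℝ) (n : ℕ) :
    BddAbove ({v | ∃ l, l ≤ n ∧ p l ∧ v = F l} ∪ {v | ∃ l, 1 ≤ l ∧ l < n ∧ r l ∧ v = A l}) := by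
  refine (((finite_Iic n).image F).union ((finite_Iic n).image A)).bddAbove.mono ?_
  refine union_subset_union ?_ ?_
  · rintro v ⟨l, hl, -, rfl⟩
    exact ⟨l, hl, rfl⟩
  · rintro v ⟨l, -, hl, -, rfl⟩
    exact ⟨l, hl.le, rfl⟩

lemma calF_zero_of_even (P : ℝ[X]) (q : ℕ → ℝ) (he : Even (n - 0)) :
    calF (fun x => P.eval x) n q 0 = 0 := by
  rw [calF, if_pos he, r₂]
  simp

lemma IsTailSeq.isSolution_iff (hP : IsMixturePoly P) (h : IsTailSeq P n q a) (hn : 2 ≤ n) :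
    IsSolution P n q (a (n - 1) / a n) ↔
      (∀ l < n, SphericalSpinGlass.h (fun x => P.eval x) (q l) (q (l + 1)) (a l / a (l + 1)) = 0) ∧
      (∀ l ≤ n, (derivative (derivative P)).eval (q l) ≤ 1 / a l ^ 2) ∧
      ∀ l, l + 1 < n → (a l - a (l + 1)) / (q (l + 1) - q l)
        < (a (l + 1) - a (l + 2)) / (q (l + 2) - q (l + 1)) := by
  set w := a (n - 1) / a n with hw
  have hw0 : 0 < w := div_pos (h.pos _ (by omega)) (h.pos n le_rfl)
  have hH : (∀ l, 1 ≤ l → l ≤ n → hStep (fun x => P.eval x) n q l w = 0) ↔ ∀ l < n,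
      SphericalSpinGlass.h (fun x => P.eval x) (q l) (q (l + 1)) (a l / a (l + 1)) = 0 := by
    constructor
    · intro hh l hl
      rw [← h.hStep_eq hP hl]
      exact hh (l + 1) (by omega) hl
    · intro hh l hl0 hl
      obtain ⟨k, rfl⟩ : ∃ k, l = k + 1 := ⟨l - 1, by omega⟩
      rw [hw, h.hStep_eq hP hl]
      exact hh k hl
  have hAodd : ∀ l, 1 ≤ l → l < n → Odd (n - l) →
      (calA (fun x => P.eval x) n q l < w ↔ bend P q a l < 1) := by
    intro l hl0 hl ho
    rw [h.calA_odd hl0 hl ho, ← hw, mul_lt_iff_lt_one_left hw0]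
  have hbpos : ∀ l, 1 ≤ l → l < n → 0 < bend P q a l := by
    intro l hl0 hl
    obtain ⟨k, rfl⟩ : ∃ k, l = k + 1 := ⟨l - 1, by omega⟩
    exact h.bend_pos hl
  have hAeven : ∀ l, 1 ≤ l → l < n → Even (n - l) →
      (w < (calA (fun x => P.eval x) n q l)⁻¹ ↔ bend P q a l < 1) := by
    intro l hl0 hl he
    rw [h.calA_even hl0 hl he, ← hw, inv_div, lt_div_iff₀ (hbpos l hl0 hl),
      mul_lt_iff_lt_one_right hw0]
  have hA : (∀ l, 1 ≤ l → l < n → (Odd (n - l) → calA (fun x => P.eval x) n q l < w) ∧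
      (Even (n - l) → w < (calA (fun x => P.eval x) n q l)⁻¹)) ↔
      ∀ l, l + 1 < n → (a l - a (l + 1)) / (q (l + 1) - q l)
        < (a (l + 1) - a (l + 2)) / (q (l + 2) - q (l + 1)) := by
    constructor
    · intro hh l hl
      rw [← h.bend_lt_one_iff hl]
      rcases Nat.even_or_odd (n - (l + 1)) with he | ho
      · exact (hAeven (l + 1) (by omega) hl he).1 ((hh (l + 1) (by omega) hl).2 he)
      · exact (hAodd (l + 1) (by omega) hl ho).1 ((hh (l + 1) (by omega) hl).1 ho)
    · intro hh l hl0 hl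
      have hb : bend P q a l < 1 := by
        obtain ⟨k, rfl⟩ : ∃ k, l = k + 1 := ⟨l - 1, by omega⟩
        exact (h.bend_lt_one_iff hl).2 (hh k hl)
      exact ⟨fun ho => (hAodd l hl0 hl ho).2 hb, fun he => (hAeven l hl0 hl he).2 hb⟩
  have hS : ∀ l ≤ n, ((derivative (derivative P)).eval (q l) ≤ 1 / a l ^ 2 ↔
      (derivative (derivative P)).eval (q l) * a l ^ 2 ≤ 1) := fun l hl =>
    le_div_iff₀ (pow_pos (h.pos l hl) 2)
  have hFeven : ∀ l, 1 ≤ l → l ≤ n → Even (n - l) → (calF (fun x => P.eval x) n q l ≤ w ↔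
      (derivative (derivative P)).eval (q l) ≤ 1 / a l ^ 2) := by
    intro l hl0 hl he
    rw [h.calF_even hl0 hl he, ← hw, hS l hl, mul_le_iff_le_one_left hw0]
  have hFodd : ∀ l, l ≤ n → Odd (n - l) → (calF (fun x => P.eval x) n q l ≤ w⁻¹ ↔
      (derivative (derivative P)).eval (q l) ≤ 1 / a l ^ 2) := by
    intro l hl ho
    rw [h.calF_odd hl ho, ← hw, hS l hl, div_eq_mul_inv, mul_le_iff_le_one_left (inv_pos.2 hw0)]
  have hodd1 : Odd (n - (n - 1)) := by rw [show n - (n - 1) = 1 by omega]; exact odd_one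
  -- Positivity allows `w ≤ 𝓩⁻¹` to be rewritten as `𝓩 ≤ w⁻¹`; the witness is `𝓕_{n-1}`, whose atom
  -- is positive because `n ≥ 2`.
  have hZpos : 0 < calZ (fun x => P.eval x) n q := by
    refine lt_of_lt_of_le ?_ (le_csSup (bddAbove_values _ _ n)
      (Or.inl ⟨n - 1, by omega, hodd1, rfl⟩))
    rw [h.calF_odd (by omega) hodd1]
    have h1 := hP.deriv2_eval_pos (h.q_pos (l := n - 1) (by omega) (by omega))
    have h2 := h.pos (n - 1) (by omega)
    have h3 := h.pos n le_rfl
    positivity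
  unfold IsSolution
  rw [hH, hA]
  refine and_congr_right fun _ => and_congr_left fun hslope => ?_
  have hA' := hA.2 hslope
  constructor
  · rintro ⟨hY, hZ⟩ l hl
    rcases Nat.even_or_odd (n - l) with he | ho
    · rcases Nat.eq_zero_or_pos l with rfl | hl0
      · rw [h.zero, ← coeff_zero_eq_eval_zero, hP.deriv2_coeff_zero]
        have := h.pos 0 (by omega)
        positivity
      · exact (hFeven l hl0 hl he).1 ((le_csSup (bddAbove_values _ _ n)
          (Or.inl ⟨l, hl, he, rfl⟩)).trans hY)
    · exact (hFodd l hl ho).1 ((le_csSup (bddAbove_values _ _ n)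
        (Or.inl ⟨l, hl, ho, rfl⟩)).trans ((le_inv_comm₀ hw0 hZpos).1 hZ))
  · intro hstab
    constructor
    · refine csSup_le ⟨_, Or.inl ⟨n, le_rfl, by simp, rfl⟩⟩ ?_
      rintro v (⟨l, hl, he, rfl⟩ | ⟨l, hl0, hl, ho, rfl⟩)
      · rcases Nat.eq_zero_or_pos l with rfl | hl0
        · rw [calF_zero_of_even P q he]; exact hw0.le
        · exact (hFeven l hl0 hl he).2 (hstab l hl)
      · exact ((hA' l hl0 hl).1 ho).le
    · rw [le_inv_comm₀ hw0 hZpos]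
      refine csSup_le ⟨_, Or.inl ⟨n - 1, by omega, hodd1, rfl⟩⟩ ?_
      rintro v (⟨l, hl, ho, rfl⟩ | ⟨l, hl0, hl, he, rfl⟩)
      · exact (hFodd l hl ho).2 (hstab l hl)
      · rw [h.calA_even hl0 hl he, ← hw, div_eq_mul_inv]
        exact mul_le_of_le_one_left (inv_pos.2 hw0).le
          ((hAeven l hl0 hl he).1 ((hA' l hl0 hl).2 he)).le

lemma IsStationary.isTailSeq (h : IsStepData n q m Δ) (hs : IsStationary P n q m Δ) :
    IsTailSeq P n q fun l => stepTail n q m Δ (q l) := by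
  refine ⟨h.zero, h.lt, fun l _ => h.tail_pos _, fun l hl => ?_⟩
  have h1 := h.rsqPrimitive_sub hl (right_mem_Icc.2 (h.lt l hl).le)
  have h2 := hs.gap_eq_zero l hl.le
  have h3 := hs.gap_eq_zero (l + 1) hl
  unfold stepGap at h2 h3
  linarith

/-- Stationary step data solve the system. -/
lemma IsStationary.isSolution (hP : IsMixturePoly P) (hn : 2 ≤ n) (h : IsStepData n q m Δ)
    (hs : IsStationary P n q m Δ) :
    IsSolution P n q (stepTail n q m Δ (q (n - 1)) / stepTail n q m Δ (q n)) := by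
  refine ((hs.isTailSeq h).isSolution_iff hP hn).2 ⟨fun l hl => ?_, hs.stable, fun l hl => ?_⟩
  · rw [← h.integral_gap hl (hs.gap_eq_zero l hl.le) (hs.gap_eq_zero (l + 1) hl)]
    exact hs.integral_gap l hl
  · have d1 := sub_pos.2 (h.lt l (by omega))
    have d2 := sub_pos.2 (h.lt (l + 1) hl)
    rw [h.tail_sub (l := l) (by omega), h.tail_sub hl, mul_div_cancel_right₀ _ d1.ne',
      mul_div_cancel_right₀ _ d2.ne']
    exact h.slope_lt l hl

lemma IsStepData.one_lt_ratio (hn : 2 ≤ n) (h : IsStepData n q m Δ) :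
    1 < stepTail n q m Δ (q (n - 1)) / stepTail n q m Δ (q n) := by
  rw [one_lt_div (h.tail_pos _)]
  obtain ⟨k, rfl⟩ : ∃ k, n = k + 1 := ⟨n - 1, by omega⟩
  have h1 := h.tail_sub (l := k) (by omega)
  have h2 := mul_pos (h.pos k (by omega)) (sub_pos.2 (h.lt k (by omega)))
  simp only [Nat.add_sub_cancel]
  linarith

/-- A solution of the system comes from stationary step data. -/
lemma IsSolution.exists_stationary (hP : IsMixturePoly P) (hn : 2 ≤ n) (hq0 : q 0 = 0)
    (hqn : q n = 1) (hq : ∀ l < n, q l < q (l + 1)) {w : ℝ} (hw : 0 < w)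
    (hsol : IsSolution P n q w) :
    ∃ m Δ, IsStepData n q m Δ ∧ IsStationary P n q m Δ ∧
      stepTail n q m Δ (q (n - 1)) / stepTail n q m Δ (q n) = w := by
  have hqnn : ∀ l ≤ n, 0 ≤ q l := by
    intro l
    induction l with
    | zero => intro _; exact hq0.ge
    | succ l ih => intro hl; exact (ih (by omega)).trans (hq l (by omega)).le
  set D : ℕ → ℝ := fun l => ((derivative P).eval (q (l + 1)) - (derivative P).eval (q l))
    / (q (l + 1) - q l) with hD
  have hDpos : ∀ l < n, 0 < D l := fun l hl => div_pos
    (sub_pos.2 (hP.deriv_strictMonoOn (hqnn l hl.le) (hqnn (l + 1) hl) (hq l hl)))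
    (sub_pos.2 (hq l hl))
  -- The tails are rebuilt from the right, `b k` standing for `a_{n-k}`. The recursion is `a_l
  -- a_{l+1} = 1/D_l`, and the initial value is forced by `a_{n-1} = w a_n`, that is, `a_n² = 1/(w
  -- D_{n-1})`.
  set b : ℕ → ℝ := fun k => Nat.rec (√(w * D (n - 1)))⁻¹ (fun j r => (D (n - (j + 1)) * r)⁻¹) k
    with hb
  have hb0 : b 0 = (√(w * D (n - 1)))⁻¹ := rfl
  have hbs : ∀ k, b (k + 1) = (D (n - (k + 1)) * b k)⁻¹ := fun _ => rfl
  have hbpos : ∀ k ≤ n, 0 < b k := by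
    intro k
    induction k with
    | zero =>
      intro _
      rw [hb0]
      exact inv_pos.2 (Real.sqrt_pos.2 (mul_pos hw (hDpos _ (by omega))))
    | succ k ih =>
      intro hk
      rw [hbs]
      exact inv_pos.2 (mul_pos (hDpos _ (by omega)) (ih (by omega)))
  set a : ℕ → ℝ := fun l => b (n - l) with ha
  have hrel : ∀ l < n, a l * (D l * a (l + 1)) = 1 := by
    intro l hl
    have h1 := hbs (n - (l + 1))
    rw [show n - (l + 1) + 1 = n - l by omega, show n - (n - l) = l by omega] at h1
    have h2 : D l * a (l + 1) ≠ 0 := (mul_pos (hDpos l hl) (hbpos _ (by omega))).ne'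
    simp only [ha] at h2 ⊢
    rw [h1, inv_mul_cancel₀ h2]
  have hapos : ∀ l ≤ n, 0 < a l := fun l _ => hbpos _ (by omega)
  have hseq : IsTailSeq P n q a := by
    refine ⟨hq0, hq, hapos, fun l hl => ?_⟩
    have h1 := hrel l hl
    have h2 := (sub_pos.2 (hq l hl)).ne'
    have h3 := (hapos l hl.le).ne'
    have h4 := (hapos (l + 1) hl).ne'
    simp only [hD] at h1
    field_simp at h1 ⊢
    linarith
  have hratio : a (n - 1) / a n = w := by
    have h1 := hrel (n - 1) (by omega)
    rw [show n - 1 + 1 = n by omega] at h1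
    have h2 : a n ^ 2 = (w * D (n - 1))⁻¹ := by
      have hnn : 0 ≤ w * D (n - 1) := (mul_pos hw (hDpos _ (by omega))).le
      simp only [ha, Nat.sub_self]
      rw [hb0, inv_pow, Real.sq_sqrt hnn]
    have h3 := (hapos n le_rfl).ne'
    have h4 := (hDpos (n - 1) (by omega)).ne'
    have h5 : a n ^ 2 * (w * D (n - 1)) = 1 := by
      rw [h2]; exact inv_mul_cancel₀ (mul_ne_zero hw.ne' h4)
    rw [div_eq_iff h3]
    refine mul_right_cancel₀ (mul_ne_zero h4 h3) ?_
    rw [h1, ← h5]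
    ring
  rw [← hratio, hseq.isSolution_iff hP hn] at hsol
  obtain ⟨hh, hstab, hslope⟩ := hsol
  set m : ℕ → ℝ := fun l => (a l - a (l + 1)) / (q (l + 1) - q l) with hm
  have hdata : IsStepData n q m (a n) := by
    refine ⟨hq0, hqn, hq, fun l hl => ?_, hslope, hapos n le_rfl⟩
    have h1 := hP.one_lt_of_h_eq_zero (hqnn l hl.le) (hq l hl)
      (div_pos (hapos l hl.le) (hapos (l + 1) hl)) (hh l hl)
    rw [one_lt_div (hapos (l + 1) hl)] at h1
    exact div_pos (sub_pos.2 h1) (sub_pos.2 (hq l hl))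
  have htail : ∀ l ≤ n, stepTail n q m (a n) (q l) = a l := by
    intro l hl
    induction hl using Nat.decreasingInduction with
    | self => rw [hqn, hdata.tail_one]
    | of_succ l hl ih =>
      have h1 := hdata.tail_sub hl
      rw [ih, hm] at h1
      simp only at h1
      rw [div_mul_cancel₀ _ (sub_pos.2 (hq l hl)).ne'] at h1
      linarith
  have hgap : ∀ l ≤ n, stepGap P n q m (a n) (q l) = 0 := by
    intro l
    induction l with
    | zero =>
      intro _
      rw [hq0, stepGap, hP.deriv_eval_zero, rsqPrimitive]; simp
    | succ l ih =>
      intro hl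
      have h1 := ih (by omega)
      have h2 := hdata.rsqPrimitive_sub (l := l) hl (right_mem_Icc.2 (hq l hl).le)
      have h3 := hseq.deriv_sub l hl
      rw [htail l (by omega), htail (l + 1) hl] at h2
      unfold stepGap at h1 ⊢
      linarith
  refine ⟨m, a n, hdata, ⟨hgap, fun l hl => ?_, fun l hl => ?_⟩, ?_⟩
  · rw [hdata.integral_gap hl (hgap l hl.le) (hgap (l + 1) hl), htail l hl.le, htail (l + 1) hl]
    exact hh l hl
  · rw [htail l hl]; exact hstab l hl
  · rw [htail _ (by omega), htail n le_rfl, hratio]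

end

/-! ### The mixture polynomial and translation of indices -/

/-- The mixture as a polynomial. -/
noncomputable def mixturePoly {n : ℕ} (p : Fin n → ℕ) (lam : Fin n → ℝ) : ℝ[X] :=
  ∑ i, C (lam i) * X ^ p i

section
variable {n : ℕ} {p : Fin n → ℕ} {lam : Fin n → ℝ}

lemma mixture_eq_eval (p : Fin n → ℕ) (lam : Fin n → ℝ) :
    mixture p lam = fun x => (mixturePoly p lam).eval x := by
  ext x
  simp [mixture, mixturePoly, eval_finsetSum]

lemma coeff_mixturePoly (p : Fin n → ℕ) (lam : Fin n → ℝ) (k : ℕ) :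
    (mixturePoly p lam).coeff k = ∑ i, if k = p i then lam i else 0 := by
  simp [mixturePoly, finsetSum_coeff, coeff_C_mul, coeff_X_pow]

lemma isMixturePoly_mixturePoly (hp2 : ∀ i, 2 < p i) (hlam : ∀ i, 0 ≤ lam i)
    (hsum : ∑ i, lam i = 1) : IsMixturePoly (mixturePoly p lam) := by
  refine ⟨fun k => ?_, fun k hk => ?_, fun h0 => ?_⟩
  · rw [coeff_mixturePoly]
    exact Finset.sum_nonneg fun i _ => by split_ifs <;> simp [hlam i]
  · rw [coeff_mixturePoly]
    exact Finset.sum_eq_zero fun i _ => if_neg (by have := hp2 i; omega)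
  · have h1 : (mixturePoly p lam).eval 1 = 1 := by
      simp [mixturePoly, eval_finsetSum, hsum]
    rw [h0] at h1
    simp at h1

lemma card_support_deriv2_mixturePoly_le (p : Fin n → ℕ) (lam : Fin n → ℝ) :
    (derivative (derivative (mixturePoly p lam))).support.card ≤ n := by
  have hsub : (derivative (derivative (mixturePoly p lam))).support
      ⊆ Finset.univ.image fun i => p i - 2 := by
    intro k hk
    rw [mem_support_iff, coeff_derivative, coeff_derivative, coeff_mixturePoly] at hk
    have h1 := left_ne_zero_of_mul (left_ne_zero_of_mul hk)
    obtain ⟨i, -, hi⟩ := Finset.exists_ne_zero_of_sum_ne_zero h1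
    have h2 : k + 1 + 1 = p i := by
      by_contra hcon
      exact hi (if_neg hcon)
    exact Finset.mem_image.2 ⟨i, Finset.mem_univ i, by omega⟩
  exact (Finset.card_le_card hsub).trans (Finset.card_image_le.trans (by simp))

lemma toSeq_of_lt (q : Fin (n + 1) → ℝ) {i : ℕ} (hi : i < n + 1) : toSeq q i = q ⟨i, hi⟩ :=
  dif_pos hi

lemma stepDensity_toSeq (q : Fin (n + 1) → ℝ) (m : ℕ → ℝ) :
    (fun x => ∑ i : Fin n, (Ico (q i.castSucc) (q i.succ)).indicator (fun _ => m i) x)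
      = stepDensity n (toSeq q) m := by
  ext x
  rw [stepDensity, Finset.sum_range]
  refine Finset.sum_congr rfl fun i _ => ?_
  rw [toSeq_of_lt q (i := i) (by omega), toSeq_of_lt q (i := i + 1) (by omega)]
  rfl

lemma toSeq_lt {q : Fin (n + 1) → ℝ} (hq : StrictMono q) {l : ℕ} (hl : l < n) :
    toSeq q l < toSeq q (l + 1) := by
  rw [toSeq_of_lt q (i := l) (by omega), toSeq_of_lt q (i := l + 1) (by omega)]
  exact hq (by simp)

lemma toSeq_zero {q : Fin (n + 1) → ℝ} (hq : q 0 = 0) : toSeq q 0 = 0 := by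
  rw [toSeq_of_lt q (by omega)]; exact hq

lemma toSeq_last {q : Fin (n + 1) → ℝ} (hq : q (Fin.last n) = 1) : toSeq q n = 1 := by
  rw [toSeq_of_lt q (by omega)]; exact hq

lemma IsRSB.exists_stepData {ν : Measure ℝ} (h : IsRSB n ν) :
    ∃ (q : Fin (n + 1) → ℝ) (m : ℕ → ℝ) (Δ : ℝ), StrictMono q ∧ q 0 = 0 ∧ q (Fin.last n) = 1 ∧
      IsStepData n (toSeq q) m Δ ∧ ν = densityAndAtom (stepDensity n (toSeq q) m) Δ := by
  obtain ⟨m, q, Δ, hm0, hm, hq, hq0, hqn, hΔ, rfl⟩ := h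
  set m' : ℕ → ℝ := fun l => if hl : l < n then m ⟨l, hl⟩ else 0 with hm'
  have hm'eq : ∀ i : Fin n, m' i = m i := fun i => dif_pos i.2
  refine ⟨q, m', Δ, hq, hq0, hqn, ⟨toSeq_zero hq0, toSeq_last hqn, fun l hl => toSeq_lt hq hl,
    fun l hl => ?_, fun l hl => ?_, hΔ⟩, ?_⟩
  · rw [hm'eq ⟨l, hl⟩]; exact hm0 _
  · rw [hm'eq ⟨l, by omega⟩, hm'eq ⟨l + 1, hl⟩]
    exact hm (by simp)
  · rw [← stepDensity_toSeq]
    simp only [hm'eq]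

lemma IsStepData.isRSB {q : Fin (n + 1) → ℝ} {m : ℕ → ℝ} {Δ : ℝ} (hq : StrictMono q)
    (hq0 : q 0 = 0) (hqn : q (Fin.last n) = 1) (h : IsStepData n (toSeq q) m Δ) :
    IsRSB n (densityAndAtom (stepDensity n (toSeq q) m) Δ) := by
  refine ⟨fun i => m i, q, Δ, fun i => h.pos i i.2, fun i j hij => ?_, hq, hq0, hqn, h.atom_pos, ?_⟩
  · exact (h.slope_lt i (by omega)).trans_le (h.slope_mono (Nat.succ_le_of_lt hij) j.2)
  · rw [← stepDensity_toSeq]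

end

end SphericalSpinGlass

/-! ### The equivalence -/

theorem theorem10 (n : ℕ) (hn : 2 ≤ n)
    (p : Fin n → ℕ) (hp : StrictMono p) (hp2 : ∀ i, 2 < p i)
    (lam : Fin n → ℝ) (hlam : ∀ i, 0 ≤ lam i) (hsum : ∑ i, lam i = 1) :
    (∃ ν : MeasureTheory.Measure ℝ,
        SphericalSpinGlass.IsParisiMeasure (SphericalSpinGlass.mixture p lam) ν ∧
        SphericalSpinGlass.IsRSB n ν) ↔
      ∃! qz : (Fin (n + 1) → ℝ) × ℝ,
        -- `0 = q_0 < q_1 < ⋯ < q_{n-1} < q_n = 1` and `z_n > 0`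
        (StrictMono qz.1 ∧ qz.1 0 = 0 ∧ qz.1 (Fin.last n) = 1 ∧ 0 < qz.2) ∧
        -- the system of equations
        (∀ l, 1 ≤ l → l ≤ n →
          SphericalSpinGlass.hStep (SphericalSpinGlass.mixture p lam) n
            (SphericalSpinGlass.toSeq qz.1) l (1 + qz.2) = 0) ∧
        -- `𝓨^n ≤ 1 + z_n ≤ (𝓩^n)⁻¹`
        (SphericalSpinGlass.calY (SphericalSpinGlass.mixture p lam) n
            (SphericalSpinGlass.toSeq qz.1) ≤ 1 + qz.2 ∧
          1 + qz.2 ≤ (SphericalSpinGlass.calZ (SphericalSpinGlass.mixture p lam) n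
            (SphericalSpinGlass.toSeq qz.1))⁻¹) ∧
        -- the bounds by the terms `𝓐_l^n` are strict
        (∀ l, 1 ≤ l → l < n →
          (Odd (n - l) →
            SphericalSpinGlass.calA (SphericalSpinGlass.mixture p lam) n
              (SphericalSpinGlass.toSeq qz.1) l < 1 + qz.2) ∧
          (Even (n - l) →
            1 + qz.2 < (SphericalSpinGlass.calA (SphericalSpinGlass.mixture p lam) n
              (SphericalSpinGlass.toSeq qz.1) l)⁻¹)) := by
  have hP := SphericalSpinGlass.isMixturePoly_mixturePoly hp2 hlam hsum
  have hcard := SphericalSpinGlass.card_support_deriv2_mixturePoly_le p lam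
  rw [SphericalSpinGlass.mixture_eq_eval p lam]
  set P := SphericalSpinGlass.mixturePoly p lam with hPdef
  constructor
  · rintro ⟨ν, hν, hrsb⟩
    obtain ⟨q, m, Δ, hq, hq0, hqn, hdata, rfl⟩ := hrsb.exists_stepData
    have hs := hdata.isStationary hP hν
    have hratio := hdata.one_lt_ratio hn
    have hsol := hs.isSolution hP hn hdata
    set Q := SphericalSpinGlass.toSeq q with hQ
    set w := SphericalSpinGlass.stepTail n Q m Δ (Q (n - 1))
      / SphericalSpinGlass.stepTail n Q m Δ (Q n) with hw
    refine ⟨(q, w - 1), ⟨⟨hq, hq0, hqn, by simpa using hratio⟩, ?_⟩, ?_⟩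
    · rw [show 1 + (q, w - 1).2 = w by simp]
      exact hsol
    · rintro ⟨q', z'⟩ ⟨⟨hq', hq0', hqn', hz'⟩, hsol'⟩
      obtain ⟨m', Δ', hdata', hs', hw'⟩ := SphericalSpinGlass.IsSolution.exists_stationary hP hn
        (SphericalSpinGlass.toSeq_zero hq0') (SphericalSpinGlass.toSeq_last hqn')
        (fun l hl => SphericalSpinGlass.toSeq_lt hq' hl) (w := 1 + z') (by simp only at hz'; linarith)
        hsol'
      -- The second solution also comes from stationary data, and their tail agrees with that of the
      -- given Parisi measure; the tail determines the atoms and, through `w = a_{n-1}/a_n`, the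
      -- value of `z_n`.
      have htail := hs'.eq_of_isParisiMeasure hP hcard hdata' hdata hν
      obtain ⟨hqq, -⟩ := hdata'.eq_of_tail_eq hdata htail
      have hq_eq : q' = q := by
        ext i
        have := hqq i (by omega)
        rwa [hQ, SphericalSpinGlass.toSeq_of_lt q' i.2, SphericalSpinGlass.toSeq_of_lt q i.2] at this
      have hmem : ∀ l ≤ n, SphericalSpinGlass.toSeq q' l ∈ Set.Icc (0 : ℝ) 1 := fun l hl =>
        ⟨hdata'.nonneg hl, hdata'.le_one hl⟩
      rw [htail _ (hmem _ (by omega)), htail _ (hmem _ le_rfl), hqq _ (by omega),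
        hqq n le_rfl, ← hw] at hw'
      rw [Prod.mk.injEq]
      exact ⟨hq_eq, by linarith⟩
  · rintro ⟨⟨q, z⟩, ⟨⟨hq, hq0, hqn, hz⟩, hsol⟩, -⟩
    obtain ⟨m, Δ, hdata, hs, -⟩ := SphericalSpinGlass.IsSolution.exists_stationary hP hn
      (SphericalSpinGlass.toSeq_zero hq0) (SphericalSpinGlass.toSeq_last hqn)
      (fun l hl => SphericalSpinGlass.toSeq_lt hq hl) (w := 1 + z) (by simp only at hz; linarith)
      hsol
    exact ⟨_, (hs.isParisiMeasure hP hcard hdata).1, hdata.isRSB hq hq0 hqn⟩
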